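/- Let $G=(V,E)$ be a finite digraph, with parallel arcs allowed, and for $f:E\to\mathbb{R}$ put $\operatorname{div}_f(v)=\sum_{e\text{ leaving }v}f(e)-\sum_{e\text{ entering }v}f(e)$. For disjoint sets $S,T\subseteq V$, a flow from $S$ to $T$ is a function $f:E\to\mathbb{R}_{\ge 0}$ with $\operatorname{div}_f(v)\ge 0$ for $v\in S$, $\operatorname{div}_f(v)\le 0$ for $v\in T$, and $\operatorname{div}_f(v)=0$ for all other nodes; a flow from $s$ to $t$ is a flow from $\{s\}$ to $\{t\}$. Theorem. Let $k$ be fixed. Consider the problem: given a digraph $G=(V,E)$ with $|V|=O(|E|)$, disjoint nonempty sets $S,T\subseteq V$ with $|S|+|T|=k$, and a flow (respectively, an integer flow) $f$ from $S$ to $T$, find flows (respectively, integer flows) $f_{st}$ from $s$ to $t$, for $s\in S$ and $t\in T$, such that $f=\sum_{s\in S,\,t\in T}f_{st}$. This problem can be solved in $O\bigl(|E|\log(2+|V|^2/|E|)\bigr)$ time on a random access machine that adds, subtracts and compares flow values at unit cost; the constant in the bound depends only on $k$ and on the constant in the assumption $|V|=O(|E|)$. -/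

import Mathlib

namespace FlowDecomp

/-- A finite directed graph with node set `Fin n` and arc set `Fin m`; parallel arcs and loops are
allowed. -/
structure Digraph (n m : ℕ) where
  /-- the node that an arc leaves -/
  tail : Fin m → Fin n
  /-- the node that an arc enters -/
  head : Fin m → Fin n

/-- The divergence of `f` at `v`: the total value on the arcs leaving `v` minus the total value on
the arcs entering `v`. -/
noncomputable def Digraph.divergence {n m : ℕ} (G : Digraph n m) (f : Fin m → ℝ) (v : Fin n) : ℝ :=
  (∑ e with G.tail e = v, f e) - (∑ e with G.head e = v, f e)

/-- `f` is a flow from the source set `S` to the sink set `T`. -/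
structure Digraph.IsFlow {n m : ℕ} (G : Digraph n m) (S T : Set (Fin n)) (f : Fin m → ℝ) :
    Prop where
  nonneg : ∀ e, 0 ≤ f e
  source : ∀ v ∈ S, 0 ≤ G.divergence f v
  sink : ∀ v ∈ T, G.divergence f v ≤ 0
  inner : ∀ v, v ∉ S → v ∉ T → G.divergence f v = 0

/-- All values of `f` are integers. -/
def IsIntegral {m : ℕ} (f : Fin m → ℝ) : Prop :=
  ∀ e, ∃ z : ℤ, f e = (z : ℝ)

/-! ### The random access machine

The memory consists of registers and arrays of two sorts. Words are natural numbers; they are used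
for counting and for addressing arrays, and are only ever copied, compared, incremented and
decremented, so that no word exceeds the largest word in the input or program plus the number of
steps made. Numbers are real numbers; they hold the flow values and are only ever copied, compared,
added and subtracted, exactly and at unit cost (no rounding, no multiplication, no conversion
between numbers and words, and no constant other than zero). A program mentions finitely many
registers and arrays; array cells are addressed by the contents of a word register. -/

/-- A memory state. -/
structure Memory where
  /-- word registers -/
  wreg : ℕ → ℕ
  /-- number registers -/
  xreg : ℕ → ℝ
  /-- word arrays: `warr a i` is the cell `i` of the array `a` -/
  warr : ℕ → ℕ → ℕ
  /-- number arrays: `xarr a i` is the cell `i` of the array `a` -/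
  xarr : ℕ → ℕ → ℝ

/-- The elementary instructions. Registers and arrays are given by their names. -/
inductive Instr where
  /-- set the word register `d` to the literal `c` -/
  | wconst (d c : ℕ)
  /-- copy the word register `a` to `d` -/
  | wcopy (d a : ℕ)
  /-- increment the word register `d` -/
  | wsucc (d : ℕ)
  /-- decrement the word register `d` (zero stays zero) -/
  | wpred (d : ℕ)
  /-- read the cell of the word array `a` addressed by the register `i` into `d` -/
  | wload (d a i : ℕ)
  /-- write the word register `b` to the cell of the word array `a` addressed by `i` -/
  | wstore (a i b : ℕ)
  /-- set the number register `d` to zero -/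
  | xzero (d : ℕ)
  /-- copy the number register `a` to `d` -/
  | xcopy (d a : ℕ)
  /-- put the sum of the number registers `a` and `b` into `d` -/
  | xadd (d a b : ℕ)
  /-- put the difference of the number registers `a` and `b` into `d` -/
  | xsub (d a b : ℕ)
  /-- read the cell of the number array `a` addressed by the word register `i` into `d` -/
  | xload (d a i : ℕ)
  /-- write the number register `b` to the cell of the number array `a` addressed by `i` -/
  | xstore (a i b : ℕ)

/-- The effect of an elementary instruction. -/
noncomputable def Instr.effect : Instr → Memory → Memory
  | .wconst d c, σ => { σ with wreg := Function.update σ.wreg d c }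
  | .wcopy d a, σ => { σ with wreg := Function.update σ.wreg d (σ.wreg a) }
  | .wsucc d, σ => { σ with wreg := Function.update σ.wreg d (σ.wreg d + 1) }
  | .wpred d, σ => { σ with wreg := Function.update σ.wreg d (σ.wreg d - 1) }
  | .wload d a i, σ => { σ with wreg := Function.update σ.wreg d (σ.warr a (σ.wreg i)) }
  | .wstore a i b, σ =>
    { σ with
      warr := Function.update σ.warr a (Function.update (σ.warr a) (σ.wreg i) (σ.wreg b)) }
  | .xzero d, σ => { σ with xreg := Function.update σ.xreg d 0 }
  | .xcopy d a, σ => { σ with xreg := Function.update σ.xreg d (σ.xreg a) }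
  | .xadd d a b, σ => { σ with xreg := Function.update σ.xreg d (σ.xreg a + σ.xreg b) }
  | .xsub d a b, σ => { σ with xreg := Function.update σ.xreg d (σ.xreg a - σ.xreg b) }
  | .xload d a i, σ => { σ with xreg := Function.update σ.xreg d (σ.xarr a (σ.wreg i)) }
  | .xstore a i b, σ =>
    { σ with
      xarr := Function.update σ.xarr a (Function.update (σ.xarr a) (σ.wreg i) (σ.xreg b)) }

/-- The elementary tests: comparisons of two word registers or of two number registers. -/
inductive Test where
  | weq (a b : ℕ)
  | wne (a b : ℕ)
  | wlt (a b : ℕ)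
  | wle (a b : ℕ)
  | xeq (a b : ℕ)
  | xne (a b : ℕ)
  | xlt (a b : ℕ)
  | xle (a b : ℕ)

/-- The outcome of a test. -/
def Test.holds : Test → Memory → Prop
  | .weq a b, σ => σ.wreg a = σ.wreg b
  | .wne a b, σ => σ.wreg a ≠ σ.wreg b
  | .wlt a b, σ => σ.wreg a < σ.wreg b
  | .wle a b, σ => σ.wreg a ≤ σ.wreg b
  | .xeq a b, σ => σ.xreg a = σ.xreg b
  | .xne a b, σ => σ.xreg a ≠ σ.xreg b
  | .xlt a b, σ => σ.xreg a < σ.xreg b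
  | .xle a b, σ => σ.xreg a ≤ σ.xreg b

/-- Programs, in structured form. -/
inductive Program where
  | skip
  | op (i : Instr)
  | seq (p q : Program)
  | branch (b : Test) (p q : Program)
  | loop (b : Test) (p : Program)

/-- `Exec p σ k τ`: started in the memory state `σ`, the program `p` terminates in the memory state
`τ` after `k` steps. A step is the execution of one elementary instruction or the evaluation of one
elementary test. -/
inductive Exec : Program → Memory → ℕ → Memory → Prop where
  | skip (σ : Memory) : Exec .skip σ 0 σ
  | op (i : Instr) (σ : Memory) : Exec (.op i) σ 1 (i.effect σ)
  | seq {p q : Program} {σ τ ρ : Memory} {k l : ℕ} :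
      Exec p σ k τ → Exec q τ l ρ → Exec (.seq p q) σ (k + l) ρ
  | branch_true {b : Test} {p q : Program} {σ τ : Memory} {k : ℕ} :
      b.holds σ → Exec p σ k τ → Exec (.branch b p q) σ (k + 1) τ
  | branch_false {b : Test} {p q : Program} {σ τ : Memory} {k : ℕ} :
      ¬ b.holds σ → Exec q σ k τ → Exec (.branch b p q) σ (k + 1) τ
  | loop_true {b : Test} {p : Program} {σ τ ρ : Memory} {k l : ℕ} :
      b.holds σ → Exec p σ k τ → Exec (.loop b p) τ l ρ → Exec (.loop b p) σ (k + l + 1) ρ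
  | loop_false {b : Test} {p : Program} {σ : Memory} :
      ¬ b.holds σ → Exec (.loop b p) σ 1 σ

/-- A finite sequence as the contents of an array, followed by zeros. -/
def toArray {α : Type} [Zero α] {l : ℕ} (g : Fin l → α) (i : ℕ) : α :=
  if h : i < l then g ⟨i, h⟩ else 0

/-- The initial memory state for the instance given by the digraph `G`, the list `s` of its
sources, the list `t` of its sinks and the arc function `f`. The word registers `0, 1, 2, 3` hold
the numbers of nodes, arcs, sources and sinks; the word arrays `0, 1, 2, 3` hold the tails and the
heads of the arcs, the sources and the sinks; the number array `0` holds `f`. Everything else is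
zero. -/
def inputMemory {n m p q : ℕ} (G : Digraph n m) (s : Fin p → Fin n) (t : Fin q → Fin n)
    (f : Fin m → ℝ) : Memory where
  wreg := fun a => match a with
    | 0 => n
    | 1 => m
    | 2 => p
    | 3 => q
    | _ => 0
  xreg := fun _ => 0
  warr := fun a => match a with
    | 0 => toArray (fun e => (G.tail e : ℕ))
    | 1 => toArray (fun e => (G.head e : ℕ))
    | 2 => toArray (fun i => (s i : ℕ))
    | 3 => toArray (fun j => (t j : ℕ))
    | _ => fun _ => 0
  xarr := fun a => match a with
    | 0 => toArray f
    | _ => fun _ => 0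

/-- The arc function output for the `i`-th of `p` sources and the `j`-th of `q` sinks. The outputs
stand in the number array `1`: arc by arc, for each arc source by source, and for each source sink
by sink. -/
def outputFlow {m p q : ℕ} (τ : Memory) (i : Fin p) (j : Fin q) (e : Fin m) : ℝ :=
  τ.xarr 1 (((e : ℕ) * p + i) * q + j)

end FlowDecomp

/-! Join a new node to every source by an arc that carries the divergence of the source, and every
sink to a new node by an arc that carries minus the divergence of the sink. Every original node is
then balanced. It suffices to decompose the extended flow into `p * q` parts, one for each pair of a
new source node and a new sink node: a part vanishes on the new arcs of the other pairs, because
each new node has only one arc, so its restriction to `G` is a flow from `s i` to `t j`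
(`History.Extends.isFlow`).

An original node is eliminated by splicing. An arc entering it and an arc leaving it, of values `x`
and `y`, give up `min x y` to a new arc that bypasses the node. One of the two becomes zero, so a
node of degree `d` needs at most `d` splices, and balance makes both sides run out together. From
time to time parallel arcs are merged. When only new nodes remain, a nonzero arc is a loop or leads
from a source node to a sink node, which tells its commodity (`Sane.decomposes`); a loop is balanced
everywhere and may go to any commodity. Then the operations are undone in reverse order: the
decomposition of a spliced arc is added to both its parts (`Decomposes.unsplice`), and that of a
merged arc is divided greedily (`Decomposes.unmerge`). All values stay in the subgroup of the reals
generated by the values of `f`, which settles the integral case.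

For the running time let `N₀ = m + p + q`. The number of nonzero arcs never exceeds `N₀`, since
every splice that creates one also destroys one (`Derives.sane`). Eliminations are grouped into
phases. With `i` original nodes left, a phase drops zero arcs and merges parallel ones, so that `M ≤
min N₀ ((p + q + i) ^ 2)` arcs remain (`Rebuilding.card_le`), and then goes once through the nodes
and eliminates those whose degree is at that time at most `D`, roughly `4 * (M / i + 1)`. This costs
`O(M + i)` for fixed `p + q`, apart from the length of the old lists. An elimination adds at most `2
* D` to the sum of the other degrees, while survivors have degree above `D`, so a sixth of the nodes
disappears (`runs_phase`). Hence `i` decays geometrically, and the sum of `min N₀ (i ^ 2)` over the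
phases is `O(N₀ * log (1 + n ^ 2 / N₀))`; this is proved with the potential `N₀ * log (1 + i ^ 2 /
N₀)` (`min_le_log_sub_log`, `potential_le`). Undoing costs `O(p * q)` for each arc created, and the
eliminations create at most as many arcs as they make steps (`Exec.wreg_le`). -/

namespace FlowDecomp

/-! ### Reasoning about programs -/

/-- `P`, started in `σ`, terminates in a state satisfying `Q`, which may mention the number of
steps. -/
def Runs (P : Program) (σ : Memory) (Q : ℕ → Memory → Prop) : Prop :=
  ∃ k τ, Exec P σ k τ ∧ Q k τ

/-- The word registers written by an instruction. -/
def Instr.wregs : Instr → List ℕ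
  | .wconst d _ | .wcopy d _ | .wsucc d | .wpred d | .wload d _ _ => [d]
  | _ => []

/-- The number registers written by an instruction. -/
def Instr.xregs : Instr → List ℕ
  | .xzero d | .xcopy d _ | .xadd d _ _ | .xsub d _ _ | .xload d _ _ => [d]
  | _ => []

/-- The word arrays written by an instruction. -/
def Instr.warrs : Instr → List ℕ
  | .wstore a _ _ => [a]
  | _ => []

/-- The number arrays written by an instruction. -/
def Instr.xarrs : Instr → List ℕ
  | .xstore a _ _ => [a]
  | _ => []

/-- The instructions occurring in a program. -/
def Program.instrs : Program → List Instr
  | .skip => []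
  | .op i => [i]
  | .seq p q => p.instrs ++ q.instrs
  | .branch _ p q => p.instrs ++ q.instrs
  | .loop _ p => p.instrs

/-- The states `σ` and `τ` agree outside the registers and arrays that `P` writes. -/
structure Frame (P : Program) (σ τ : Memory) : Prop where
  wreg : ∀ a, a ∉ P.instrs.flatMap Instr.wregs → τ.wreg a = σ.wreg a
  xreg : ∀ a, a ∉ P.instrs.flatMap Instr.xregs → τ.xreg a = σ.xreg a
  warr : ∀ a, a ∉ P.instrs.flatMap Instr.warrs → τ.warr a = σ.warr a
  xarr : ∀ a, a ∉ P.instrs.flatMap Instr.xarrs → τ.xarr a = σ.xarr a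

theorem Frame.refl (P : Program) (σ : Memory) : Frame P σ σ :=
  ⟨fun _ _ => rfl, fun _ _ => rfl, fun _ _ => rfl, fun _ _ => rfl⟩

theorem Frame.trans {P : Program} {σ τ ρ : Memory} (h : Frame P σ τ) (h' : Frame P τ ρ) :
    Frame P σ ρ :=
  ⟨fun a ha => (h'.wreg a ha).trans (h.wreg a ha), fun a ha => (h'.xreg a ha).trans (h.xreg a ha),
   fun a ha => (h'.warr a ha).trans (h.warr a ha), fun a ha => (h'.xarr a ha).trans (h.xarr a ha)⟩

theorem Frame.mono {P P' : Program} {σ τ : Memory} (h : Frame P σ τ)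
    (hs : P.instrs ⊆ P'.instrs) : Frame P' σ τ := by
  refine ⟨fun a ha => h.wreg a ?_, fun a ha => h.xreg a ?_, fun a ha => h.warr a ?_,
    fun a ha => h.xarr a ?_⟩ <;>
  · simp only [List.mem_flatMap, not_exists, not_and] at ha ⊢
    exact fun i hi => ha i (hs hi)

theorem Frame.op (i : Instr) (σ : Memory) : Frame (.op i) σ (i.effect σ) := by
  cases i <;> constructor <;> intro a ha <;>
    simp_all [Program.instrs, Instr.wregs, Instr.xregs, Instr.warrs, Instr.xarrs, Instr.effect]

/-- The frame rule: which cells can change is visible in the program text. Its side conditions are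
decidable for concrete programs, and this is how all unrelated data are carried through the proofs
below. -/
theorem Exec.frame {P : Program} {σ τ : Memory} {k : ℕ} (h : Exec P σ k τ) : Frame P σ τ := by
  induction h with
  | skip σ => exact Frame.refl _ _
  | op i σ => exact Frame.op i σ
  | seq _ _ h₁ h₂ =>
    exact (h₁.mono (List.subset_append_left _ _)).trans (h₂.mono (List.subset_append_right _ _))
  | branch_true _ _ h => exact h.mono (List.subset_append_left _ _)
  | branch_false _ _ h => exact h.mono (List.subset_append_right _ _)
  | loop_true _ _ _ h₁ h₂ => exact (h₁.mono (P' := .loop _ _) (List.Subset.refl _)).trans h₂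
  | loop_false _ => exact Frame.refl _ _

theorem Runs.mono {P : Program} {σ : Memory} {Q Q' : ℕ → Memory → Prop} (h : Runs P σ Q)
    (hQ : ∀ k τ, Frame P σ τ → Q k τ → Q' k τ) : Runs P σ Q' := by
  obtain ⟨k, τ, he, hq⟩ := h
  exact ⟨k, τ, he, hQ k τ he.frame hq⟩

theorem Runs.skip {σ : Memory} {Q : ℕ → Memory → Prop} (h : Q 0 σ) : Runs .skip σ Q :=
  ⟨0, σ, .skip σ, h⟩

theorem Runs.seq {p q : Program} {σ : Memory} {R Q : ℕ → Memory → Prop} (h₁ : Runs p σ R)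
    (h₂ : ∀ k τ, Frame p σ τ → R k τ → Runs q τ fun l ρ => Q (k + l) ρ) :
    Runs (.seq p q) σ Q := by
  obtain ⟨k, τ, he, hr⟩ := h₁
  obtain ⟨l, ρ, he', hq⟩ := h₂ k τ he.frame hr
  exact ⟨k + l, ρ, he.seq he', hq⟩

theorem Runs.branch {b : Test} {p q : Program} {σ : Memory} {Q : ℕ → Memory → Prop}
    (h₁ : b.holds σ → Runs p σ fun k τ => Q (k + 1) τ)
    (h₂ : ¬ b.holds σ → Runs q σ fun k τ => Q (k + 1) τ) : Runs (.branch b p q) σ Q := by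
  by_cases hb : b.holds σ
  · obtain ⟨k, τ, he, hq⟩ := h₁ hb
    exact ⟨k + 1, τ, .branch_true hb he, hq⟩
  · obtain ⟨k, τ, he, hq⟩ := h₂ hb
    exact ⟨k + 1, τ, .branch_false hb he, hq⟩

/-- The rule for loops. The invariant `I t` means that the loop may still take `t` steps, apart from
its last test. -/
theorem Runs.loop {b : Test} {p : Program} {σ₀ : Memory} {Q : ℕ → Memory → Prop}
    (I : ℕ → Memory → Prop) (t₀ : ℕ) (h₀ : I t₀ σ₀)
    (step : ∀ t σ, Frame p σ₀ σ → I t σ → b.holds σ →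
      Runs p σ fun k τ => ∃ t', I t' τ ∧ k + 1 + t' ≤ t)
    (post : ∀ k t τ, Frame p σ₀ τ → I t τ → ¬ b.holds τ → k + t ≤ t₀ + 1 → Q k τ) :
    Runs (.loop b p) σ₀ Q := by
  -- The final test is not covered by the credit `t`, hence the `+ 1`; unused credit `t'` is handed
  -- to `post`.
  suffices H : ∀ t σ, Frame p σ₀ σ → I t σ →
      ∃ k t' τ, Exec (.loop b p) σ k τ ∧ Frame p σ₀ τ ∧ I t' τ ∧ ¬ b.holds τ ∧ k + t' ≤ t + 1 by
    obtain ⟨k, t, τ, he, hf, hi, hb, hk⟩ := H t₀ σ₀ (Frame.refl _ _) h₀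
    exact ⟨k, τ, he, post k t τ hf hi hb hk⟩
  intro t
  induction t using Nat.strong_induction_on with
  | _ t ih =>
    intro σ hf hi
    by_cases hb : b.holds σ
    · obtain ⟨k, τ, he, t', hi', hk⟩ := step t σ hf hi hb
      obtain ⟨l, t'', ρ, he', hf', hi'', hb', hl⟩ := ih t' (by omega) τ (hf.trans he.frame) hi'
      exact ⟨k + l + 1, t'', ρ, .loop_true hb he he', hf', hi'', hb', by omega⟩
    · exact ⟨1, t, σ, .loop_false hb, hf, hi, hb, by omega⟩

/-- Straight-line code. -/
def ops : List Instr → Program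
  | [] => .skip
  | i :: l => .seq (.op i) (ops l)

theorem Runs.ops {l : List Instr} {σ : Memory} {Q : ℕ → Memory → Prop}
    (h : ∀ τ, τ = l.foldl (fun σ i => i.effect σ) σ → Q l.length τ) :
    Runs (FlowDecomp.ops l) σ Q := by
  refine ⟨l.length, _, ?_, h _ rfl⟩
  clear h
  induction l generalizing σ with
  | nil => exact .skip σ
  | cons i l ih =>
    rw [List.length_cons, add_comm]
    exact (Exec.op i σ).seq ih

theorem Runs.ops_frame {l : List Instr} {σ : Memory} {Q : ℕ → Memory → Prop}
    (h : ∀ τ, Frame (FlowDecomp.ops l) σ τ → τ = l.foldl (fun σ i => i.effect σ) σ →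
      Q l.length τ) : Runs (FlowDecomp.ops l) σ Q :=
  (Runs.ops (Q := fun k τ => k = l.length ∧ τ = l.foldl (fun σ i => i.effect σ) σ)
    fun _ hτ => ⟨rfl, hτ⟩).mono fun _ τ hf hτ => hτ.1 ▸ h τ hf hτ.2

/-- Sequential composition of a list of programs. -/
def block : List Program → Program
  | [] => .skip
  | [p] => p
  | p :: l => .seq p (block l)

end FlowDecomp

namespace FlowDecomp

/-! ### Elimination histories -/

/-- The record of a sequence of eliminations: the tail and the head of every arc ever created, and
for an arc `N` created later than the initial ones how it came about. Either it is spliced from the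
arcs `pa N` and `pb N` (and `kd N = 1`), or it is a placeholder for the event that the value `dl N`
of the arc `pa N` was moved to the parallel arc `pb N` (and `kd N = 0`). -/
structure History where
  tl : ℕ → ℕ
  hd : ℕ → ℕ
  kd : ℕ → ℕ
  pa : ℕ → ℕ
  pb : ℕ → ℕ
  dl : ℕ → ℝ

/-- The entry of the incidence matrix. -/
noncomputable def History.inc (H : History) (e v : ℕ) : ℝ :=
  (if H.tl e = v then 1 else 0) - (if H.hd e = v then 1 else 0)

/-- The divergence at `v` of `g` on the first `N` arcs. -/
noncomputable def History.net (H : History) (N : ℕ) (g : ℕ → ℝ) (v : ℕ) : ℝ :=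
  ∑ e ∈ Finset.range N, g e * H.inc e v

/-- The properties of arc values that eliminations preserve. There are `n` inner nodes, followed by
`p` nodes that no arc enters and by `q` nodes that no arc leaves. -/
structure Sane (n p q N₀ : ℕ) (A : AddSubgroup ℝ) (H : History) (N : ℕ) (F : ℕ → ℝ) : Prop where
  pos : 0 < n
  le : N₀ ≤ N
  nonneg : ∀ e < N, 0 ≤ F e
  mem : ∀ e < N, F e ∈ A
  bal : ∀ v < n, H.net N F v = 0
  tl_lt : ∀ e < N, H.tl e < n + p
  hd_lt : ∀ e < N, H.hd e < n ∨ (n + p ≤ H.hd e ∧ H.hd e < n + p + q)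
  card : ((Finset.range N).filter fun e => F e ≠ 0).card ≤ N₀

/-- The arc values `F` on `N` arcs come from `F₀` by the operations that `H` records. -/
inductive Derives (n p q N₀ : ℕ) (A : AddSubgroup ℝ) (H : History) (F₀ : ℕ → ℝ) :
    ℕ → (ℕ → ℝ) → Prop where
  | base : Sane n p q N₀ A H N₀ F₀ → Derives n p q N₀ A H F₀ N₀ F₀
  | pair {N : ℕ} {F : ℕ → ℝ} (F' : ℕ → ℝ) (δ : ℝ) : Derives n p q N₀ A H F₀ N F →
      H.pa N < N → H.pb N < N → H.pa N ≠ H.pb N → H.kd N = 1 → H.tl N = H.tl (H.pa N) →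
      H.hd N = H.hd (H.pb N) → H.hd (H.pa N) = H.tl (H.pb N) →
      δ = min (F (H.pa N)) (F (H.pb N)) →
      F' = Function.update (Function.update (Function.update F (H.pa N) (F (H.pa N) - δ))
        (H.pb N) (F (H.pb N) - δ)) N δ → Derives n p q N₀ A H F₀ (N + 1) F'
  | merge {N : ℕ} {F : ℕ → ℝ} (F' : ℕ → ℝ) : Derives n p q N₀ A H F₀ N F →
      H.pa N < N → H.pb N < N → H.pa N ≠ H.pb N → H.kd N = 0 → H.tl N = 0 → H.hd N = 0 →
      H.tl (H.pa N) = H.tl (H.pb N) → H.hd (H.pa N) = H.hd (H.pb N) → H.dl N = F (H.pa N) →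
      F' = Function.update (Function.update (Function.update F (H.pb N)
        (F (H.pb N) + F (H.pa N))) (H.pa N) 0) N 0 → Derives n p q N₀ A H F₀ (N + 1) F'

/-- The new arc is charged to the old arc `x`, which becomes zero: if the new arc is nonzero, then
`x` was nonzero before. -/
theorem card_support_le {N x : ℕ} {F F' : ℕ → ℝ} (hx : x < N) (hx' : F' x = 0)
    (hN : F' N ≠ 0 → F x ≠ 0) (h : ∀ e < N, F' e ≠ 0 → F e ≠ 0) :
    ((Finset.range (N + 1)).filter fun e => F' e ≠ 0).card ≤
      ((Finset.range N).filter fun e => F e ≠ 0).card := by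
  by_cases h0 : F' N = 0
  · refine Finset.card_le_card fun e he => ?_
    simp only [Finset.mem_filter, Finset.mem_range] at he ⊢
    have : e < N := lt_of_le_of_ne (by omega) fun h' => he.2 (h' ▸ h0)
    exact ⟨this, h e this he.2⟩
  · have hxs : x ∈ (Finset.range N).filter fun e => F e ≠ 0 := by simp [hx, hN h0]
    have : ((Finset.range (N + 1)).filter fun e => F' e ≠ 0) ⊆
        insert N (((Finset.range N).filter fun e => F e ≠ 0).erase x) := by
      intro e he
      simp only [Finset.mem_filter, Finset.mem_range, Finset.mem_insert, Finset.mem_erase] at he ⊢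
      rcases Nat.lt_succ_iff_lt_or_eq.1 he.1 with h1 | h1
      · exact Or.inr ⟨fun h' => he.2 (h' ▸ hx'), h1, h e h1 he.2⟩
      · exact Or.inl h1
    refine (Finset.card_le_card this).trans ((Finset.card_insert_le _ _).trans ?_)
    rw [Finset.card_erase_of_mem hxs]
    have := Finset.card_pos.2 ⟨x, hxs⟩
    omega

theorem History.net_succ (H : History) (N : ℕ) (g : ℕ → ℝ) (v : ℕ) :
    H.net (N + 1) g v = H.net N g v + g N * H.inc N v := Finset.sum_range_succ _ _

theorem History.net_congr {H H' : History} {N : ℕ} {g g' : ℕ → ℝ} {v : ℕ}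
    (h : ∀ e < N, g e = g' e) (ht : ∀ e < N, H.tl e = H'.tl e) (hh : ∀ e < N, H.hd e = H'.hd e) :
    H.net N g v = H'.net N g' v := by
  refine Finset.sum_congr rfl fun e he => ?_
  have he := Finset.mem_range.1 he
  simp only [History.inc, h e he, ht e he, hh e he]

/-- Both operations and their inverses alter just two old arcs, so this computes every change of a
divergence. -/
theorem History.net_add_two {H : History} {N a b : ℕ} {g g' : ℕ → ℝ} {α β : ℝ} (v : ℕ) (ha : a < N)
    (hb : b < N)
    (h : ∀ e < N, g' e = g e + (if e = a then α else 0) + (if e = b then β else 0)) :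
    H.net N g' v = H.net N g v + α * H.inc a v + β * H.inc b v := by
  have : H.net N g' v = ∑ e ∈ Finset.range N, (g e * H.inc e v +
      (if e = a then α * H.inc e v else 0) + (if e = b then β * H.inc e v else 0)) := by
    refine Finset.sum_congr rfl fun e he => ?_
    rw [h e (Finset.mem_range.1 he)]
    split_ifs <;> ring
  rw [this, Finset.sum_add_distrib, Finset.sum_add_distrib, Finset.sum_ite_eq' _ a,
    Finset.sum_ite_eq' _ b, if_pos (Finset.mem_range.2 ha), if_pos (Finset.mem_range.2 hb)]
  rfl

/-- At the middle node the head of the first part and the tail of the second cancel. -/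
theorem History.inc_splice {H : History} {a b c : ℕ} (h₁ : H.tl c = H.tl a) (h₂ : H.hd c = H.hd b)
    (h₃ : H.hd a = H.tl b) (v : ℕ) : H.inc c v = H.inc a v + H.inc b v := by
  simp only [History.inc, h₁, h₂, h₃]; ring

theorem History.inc_loop {H : History} {c : ℕ} (h : H.tl c = H.hd c) (v : ℕ) : H.inc c v = 0 := by
  simp [History.inc, h]

theorem History.inc_parallel {H : History} {a b : ℕ} (h : H.tl a = H.tl b) (h' : H.hd a = H.hd b)
    (v : ℕ) : H.inc a v = H.inc b v := by
  simp [History.inc, h, h']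

variable {n p q N₀ : ℕ} {A : AddSubgroup ℝ} {H : History} {F₀ : ℕ → ℝ}

/-- A splice moves `δ` from a path of two arcs to an arc with the same ends, a merge moves a value
to a parallel arc, and neither changes a divergence. A minimum is one of its arguments, so `δ` stays
in `A`, and one of the two parts becomes zero. -/
theorem Derives.sane {N : ℕ} {F : ℕ → ℝ} (h : Derives n p q N₀ A H F₀ N F) :
    Sane n p q N₀ A H N F := by
  induction h with
  | base h => exact h
  | @pair N F F' δ _ ha hb hab _ ht hh hm hδ hF ih =>
    have hNa : N ≠ H.pa N := ha.ne'
    have hNb : N ≠ H.pb N := hb.ne'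
    have hFN : F' N = δ := by simp [hF]
    have hFa : F' (H.pa N) = F (H.pa N) - δ := by
      rw [hF, Function.update_of_ne hNa.symm, Function.update_of_ne hab, Function.update_self]
    have hFb : F' (H.pb N) = F (H.pb N) - δ := by
      rw [hF, Function.update_of_ne hNb.symm, Function.update_self]
    have hFe : ∀ e, e ≠ N → e ≠ H.pa N → e ≠ H.pb N → F' e = F e := by
      intro e h1 h2 h3
      rw [hF, Function.update_of_ne h1, Function.update_of_ne h3, Function.update_of_ne h2]
    have h0a := ih.nonneg _ ha
    have h0b := ih.nonneg _ hb
    have hδ0 : 0 ≤ δ := hδ ▸ le_min h0a h0b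
    have hδa : δ ≤ F (H.pa N) := hδ ▸ min_le_left _ _
    have hδb : δ ≤ F (H.pb N) := hδ ▸ min_le_right _ _
    have hδA : δ ∈ A := by
      rcases min_choice (F (H.pa N)) (F (H.pb N)) with h | h
      · rw [hδ, h]; exact ih.mem _ ha
      · rw [hδ, h]; exact ih.mem _ hb
    have cases4 : ∀ {P : ℕ → Prop}, P N → P (H.pa N) → P (H.pb N) →
        (∀ e < N, e ≠ N → e ≠ H.pa N → e ≠ H.pb N → P e) → ∀ e < N + 1, P e := by
      intro P h1 h2 h3 h4 e he
      by_cases e1 : e = N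
      · exact e1 ▸ h1
      by_cases e2 : e = H.pa N
      · exact e2 ▸ h2
      by_cases e3 : e = H.pb N
      · exact e3 ▸ h3
      exact h4 e (by omega) e1 e2 e3
    refine ⟨ih.pos, ih.le.trans (Nat.le_succ _), ?_, ?_, ?_, ?_, ?_, ?_⟩
    · refine cases4 (by rw [hFN]; exact hδ0) (by rw [hFa]; linarith) (by rw [hFb]; linarith) ?_
      intro e he h1 h2 h3
      rw [hFe e h1 h2 h3]; exact ih.nonneg e he
    · refine cases4 (by rw [hFN]; exact hδA) (by rw [hFa]; exact A.sub_mem (ih.mem _ ha) hδA)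
        (by rw [hFb]; exact A.sub_mem (ih.mem _ hb) hδA) ?_
      intro e he h1 h2 h3
      rw [hFe e h1 h2 h3]; exact ih.mem e he
    · intro v hv
      have := History.net_add_two (H := H) (g := F) (g' := F') (α := -δ) (β := -δ) v ha hb (by
        intro e he
        by_cases e2 : e = H.pa N
        · subst e2; rw [hFa]; simp [hab]; ring
        by_cases e3 : e = H.pb N
        · subst e3; rw [hFb]; simp [e2]; ring
        rw [hFe e he.ne e2 e3]; simp [e2, e3])
      rw [History.net_succ, this, hFN, ih.bal v hv, History.inc_splice ht hh hm]
      ring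
    · intro e he
      rcases Nat.lt_succ_iff_lt_or_eq.1 he with h | h
      · exact ih.tl_lt e h
      · rw [h, ht]; exact ih.tl_lt _ ha
    · intro e he
      rcases Nat.lt_succ_iff_lt_or_eq.1 he with h | h
      · exact ih.hd_lt e h
      · rw [h, hh]; exact ih.hd_lt _ hb
    · refine le_trans ?_ ih.card
      have hsub : ∀ e < N, F' e ≠ 0 → F e ≠ 0 := by
        intro e he h1 h2
        by_cases e2 : e = H.pa N
        · subst e2; rw [hFa] at h1; exact h1 (by linarith)
        by_cases e3 : e = H.pb N
        · subst e3; rw [hFb] at h1; exact h1 (by linarith)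
        exact h1 (by rw [hFe e he.ne e2 e3, h2])
      rcases min_choice (F (H.pa N)) (F (H.pb N)) with h | h
      · exact card_support_le ha (by rw [hFa, hδ, h, sub_self]) (by rw [hFN, hδ, h]; exact id) hsub
      · exact card_support_le hb (by rw [hFb, hδ, h, sub_self]) (by rw [hFN, hδ, h]; exact id) hsub
  | @merge N F F' _ ha hb hab _ ht hh hm hm' _ hF ih =>
    have hNa : N ≠ H.pa N := ha.ne'
    have hNb : N ≠ H.pb N := hb.ne'
    have hFN : F' N = 0 := by simp [hF]
    have hFa : F' (H.pa N) = 0 := by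
      rw [hF, Function.update_of_ne hNa.symm, Function.update_self]
    have hFb : F' (H.pb N) = F (H.pb N) + F (H.pa N) := by
      rw [hF, Function.update_of_ne hNb.symm, Function.update_of_ne hab.symm, Function.update_self]
    have hFe : ∀ e, e ≠ N → e ≠ H.pa N → e ≠ H.pb N → F' e = F e := by
      intro e h1 h2 h3
      rw [hF, Function.update_of_ne h1, Function.update_of_ne h2, Function.update_of_ne h3]
    have h0a := ih.nonneg _ ha
    have h0b := ih.nonneg _ hb
    have cases4 : ∀ {P : ℕ → Prop}, P N → P (H.pa N) → P (H.pb N) →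
        (∀ e < N, e ≠ N → e ≠ H.pa N → e ≠ H.pb N → P e) → ∀ e < N + 1, P e := by
      intro P h1 h2 h3 h4 e he
      by_cases e1 : e = N
      · exact e1 ▸ h1
      by_cases e2 : e = H.pa N
      · exact e2 ▸ h2
      by_cases e3 : e = H.pb N
      · exact e3 ▸ h3
      exact h4 e (by omega) e1 e2 e3
    refine ⟨ih.pos, ih.le.trans (Nat.le_succ _), ?_, ?_, ?_, ?_, ?_, ?_⟩
    · refine cases4 (by rw [hFN]) (by rw [hFa]) (by rw [hFb]; linarith) ?_
      intro e he h1 h2 h3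
      rw [hFe e h1 h2 h3]; exact ih.nonneg e he
    · refine cases4 (by rw [hFN]; exact A.zero_mem) (by rw [hFa]; exact A.zero_mem)
        (by rw [hFb]; exact A.add_mem (ih.mem _ hb) (ih.mem _ ha)) ?_
      intro e he h1 h2 h3
      rw [hFe e h1 h2 h3]; exact ih.mem e he
    · intro v hv
      have := History.net_add_two (H := H) (g := F) (g' := F') (α := -F (H.pa N))
        (β := F (H.pa N)) v ha hb (by
        intro e he
        by_cases e2 : e = H.pa N
        · subst e2; rw [hFa]; simp [hab]
        by_cases e3 : e = H.pb N
        · subst e3; rw [hFb]; simp [e2]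
        rw [hFe e he.ne e2 e3]; simp [e2, e3])
      rw [History.net_succ, this, hFN, ih.bal v hv, History.inc_parallel hm hm']
      ring
    · intro e he
      rcases Nat.lt_succ_iff_lt_or_eq.1 he with h | h
      · exact ih.tl_lt e h
      · rw [h, ht]; have := ih.pos; omega
    · intro e he
      rcases Nat.lt_succ_iff_lt_or_eq.1 he with h | h
      · exact ih.hd_lt e h
      · rw [h, hh]; exact Or.inl ih.pos
    · refine le_trans ?_ ih.card
      -- Moving a zero value changes nothing. Moving a nonzero value can make `pb N` nonzero, but
      -- then `pa N` becomes zero in exchange.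
      by_cases hz : F (H.pa N) = 0
      · refine card_support_le ha hFa (fun h => (h hFN).elim) ?_
        intro e he h1 h2
        by_cases e2 : e = H.pa N
        · exact h1 (e2 ▸ hFa)
        by_cases e3 : e = H.pb N
        · subst e3; rw [hFb] at h1; exact h1 (by linarith)
        exact h1 (by rw [hFe e he.ne e2 e3, h2])
      · have hsub : ((Finset.range (N + 1)).filter fun e => F' e ≠ 0) ⊆
            insert (H.pb N) (((Finset.range N).filter fun e => F e ≠ 0).erase (H.pa N)) := by
          intro e he
          simp only [Finset.mem_filter, Finset.mem_range, Finset.mem_insert,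
            Finset.mem_erase] at he ⊢
          by_cases e3 : e = H.pb N
          · exact Or.inl e3
          have e1 : e ≠ N := fun h => he.2 (h ▸ hFN)
          have e2 : e ≠ H.pa N := fun h => he.2 (h ▸ hFa)
          exact Or.inr ⟨e2, by omega, by rw [← hFe e e1 e2 e3]; exact he.2⟩
        have hmem : H.pa N ∈ (Finset.range N).filter fun e => F e ≠ 0 := by simp [ha, hz]
        refine (Finset.card_le_card hsub).trans ((Finset.card_insert_le _ _).trans ?_)
        rw [Finset.card_erase_of_mem hmem]
        have := Finset.card_pos.2 ⟨_, hmem⟩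
        omega

/-- Two histories agree on the first `N` arcs. -/
structure History.Agree (H H' : History) (N : ℕ) : Prop where
  tl : ∀ e < N, H.tl e = H'.tl e
  hd : ∀ e < N, H.hd e = H'.hd e
  kd : ∀ e < N, H.kd e = H'.kd e
  pa : ∀ e < N, H.pa e = H'.pa e
  pb : ∀ e < N, H.pb e = H'.pb e
  dl : ∀ e < N, H.dl e = H'.dl e

theorem History.Agree.mono {H H' : History} {N M : ℕ} (h : H.Agree H' N) (hM : M ≤ N) :
    H.Agree H' M :=
  ⟨fun e he => h.tl e (he.trans_le hM), fun e he => h.hd e (he.trans_le hM),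
   fun e he => h.kd e (he.trans_le hM), fun e he => h.pa e (he.trans_le hM),
   fun e he => h.pb e (he.trans_le hM), fun e he => h.dl e (he.trans_le hM)⟩

theorem Sane.congr {H' : History} {N : ℕ} {F : ℕ → ℝ} (h : Sane n p q N₀ A H N F)
    (ht : ∀ e < N, H.tl e = H'.tl e) (hh : ∀ e < N, H.hd e = H'.hd e) :
    Sane n p q N₀ A H' N F where
  pos := h.pos
  le := h.le
  nonneg := h.nonneg
  mem := h.mem
  bal v hv := by rw [← h.bal v hv]; exact (History.net_congr (fun _ _ => rfl) ht hh).symm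
  tl_lt e he := ht e he ▸ h.tl_lt e he
  hd_lt e he := hh e he ▸ h.hd_lt e he
  card := h.card

/-- A derivation reads the history only below `N`, so it survives the writes that record the next
operation. -/
theorem Derives.congr {H' : History} {N : ℕ} {F : ℕ → ℝ} (h : Derives n p q N₀ A H F₀ N F)
    (hH : H.Agree H' N) : Derives n p q N₀ A H' F₀ N F := by
  induction h with
  | base h => exact .base (h.congr hH.tl hH.hd)
  | @pair N F F' δ _ ha hb hab hk ht hh hm hδ hF ih =>
    have hN := Nat.lt_succ_self N
    have ea := hH.pa N hN
    have eb := hH.pb N hN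
    have ha' := ha.trans hN
    have hb' := hb.trans hN
    rw [hH.tl N hN, hH.tl _ ha'] at ht
    rw [hH.hd N hN, hH.hd _ hb'] at hh
    rw [hH.hd _ ha', hH.tl _ hb'] at hm
    rw [hH.kd N hN] at hk
    rw [ea] at ha hab ht hm hδ hF
    rw [eb] at hb hab hh hm hδ hF
    exact .pair F' δ (ih (hH.mono (Nat.le_succ N))) ha hb hab hk ht hh hm hδ hF
  | @merge N F F' _ ha hb hab hk ht hh hm hm' hd hF ih =>
    have hN := Nat.lt_succ_self N
    have ea := hH.pa N hN
    have eb := hH.pb N hN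
    have ha' := ha.trans hN
    have hb' := hb.trans hN
    rw [hH.tl N hN] at ht
    rw [hH.hd N hN] at hh
    rw [hH.tl _ ha', hH.tl _ hb'] at hm
    rw [hH.hd _ ha', hH.hd _ hb'] at hm'
    rw [hH.kd N hN] at hk
    rw [hH.dl N hN] at hd
    rw [ea] at ha hab hm hm' hd hF
    rw [eb] at hb hab hm hm' hF
    exact .merge F' (ih (hH.mono (Nat.le_succ N))) ha hb hab hk ht hh hm hm' hd hF

/-! ### Decompositions -/

/-- `X` decomposes the values `F` of the first `N` arcs into `p * q` nonnegative functions, of which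
number `i * q + j` is balanced except at the nodes `n + i` and `n + p + j`. -/
structure Decomposes (n p q : ℕ) (A : AddSubgroup ℝ) (H : History) (N : ℕ) (F : ℕ → ℝ)
    (X : ℕ → ℕ → ℝ) : Prop where
  nonneg : ∀ e < N, ∀ c < p * q, 0 ≤ X e c
  mem : ∀ e < N, ∀ c < p * q, X e c ∈ A
  sum : ∀ e < N, ∑ c ∈ Finset.range (p * q), X e c = F e
  bal : ∀ c < p * q, ∀ v, v ≠ n + c / q → v ≠ n + p + c % q → H.net N (fun e => X e c) v = 0

/-- Each commodity on the spliced arc is rerouted along the two parts, which leaves its divergence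
unchanged at every node; the sums over the commodities restore the `δ` taken from the parts. -/
theorem Decomposes.unsplice {N : ℕ} {F F' : ℕ → ℝ} {δ : ℝ} {X X' : ℕ → ℕ → ℝ}
    (h : Decomposes n p q A H (N + 1) F' X') (ha : H.pa N < N) (hb : H.pb N < N)
    (hab : H.pa N ≠ H.pb N) (ht : H.tl N = H.tl (H.pa N)) (hh : H.hd N = H.hd (H.pb N))
    (hm : H.hd (H.pa N) = H.tl (H.pb N))
    (hF : F' = Function.update (Function.update (Function.update F (H.pa N) (F (H.pa N) - δ))
        (H.pb N) (F (H.pb N) - δ)) N δ)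
    (hX : ∀ e < N, ∀ c < p * q, X e c = X' e c + (if e = H.pa N then X' N c else 0) +
      (if e = H.pb N then X' N c else 0)) : Decomposes n p q A H N F X := by
  have hN := Nat.lt_succ_self N
  refine ⟨?_, ?_, ?_, ?_⟩
  · intro e he c hc
    rw [hX e he c hc]
    have h1 := h.nonneg e (he.trans hN) c hc
    have h2 := h.nonneg N hN c hc
    split_ifs <;> linarith
  · intro e he c hc
    rw [hX e he c hc]
    have h1 := h.mem e (he.trans hN) c hc
    have h2 := h.mem N hN c hc
    refine A.add_mem (A.add_mem h1 ?_) ?_ <;> split_ifs <;> first | exact h2 | exact A.zero_mem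
  · intro e he
    rw [Finset.sum_congr rfl fun c hc => hX e he c (Finset.mem_range.1 hc),
      Finset.sum_add_distrib, Finset.sum_add_distrib, h.sum e (he.trans hN)]
    have hs := h.sum N hN
    have hFN : F' N = δ := by simp [hF]
    rw [hFN] at hs
    by_cases e2 : e = H.pa N
    · subst e2
      simp [hab, hs, hF, ha.ne]
    by_cases e3 : e = H.pb N
    · subst e3
      simp [hab.symm, hs, hF, hb.ne]
    simp [e2, e3, hF, he.ne]
  · intro c hc v hv hv'
    rw [History.net_add_two (g := fun e => X' e c) v ha hb (fun e he => hX e he c hc)]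
    have := h.bal c hc v hv hv'
    rw [History.net_succ, History.inc_splice ht hh hm] at this
    linarith

/-- Any portion `Y` of the decomposition of the merged arc that has the right total may be moved
back, since the two arcs are parallel. -/
theorem Decomposes.unmerge {N : ℕ} {F F' : ℕ → ℝ} {X X' : ℕ → ℕ → ℝ} {Y : ℕ → ℝ}
    (h : Decomposes n p q A H (N + 1) F' X') (ha : H.pa N < N)
    (hb : H.pb N < N)
    (hab : H.pa N ≠ H.pb N) (ht : H.tl N = 0) (hh : H.hd N = 0)
    (hm : H.tl (H.pa N) = H.tl (H.pb N)) (hm' : H.hd (H.pa N) = H.hd (H.pb N))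
    (hF : F' = Function.update (Function.update (Function.update F (H.pb N)
        (F (H.pb N) + F (H.pa N))) (H.pa N) 0) N 0)
    (hY0 : ∀ c < p * q, 0 ≤ Y c) (hYA : ∀ c < p * q, Y c ∈ A)
    (hY : ∀ c < p * q, Y c ≤ X' (H.pb N) c) (hYs : ∑ c ∈ Finset.range (p * q), Y c = F (H.pa N))
    (hX : ∀ e < N, ∀ c < p * q, X e c =
      if e = H.pa N then Y c else if e = H.pb N then X' e c - Y c else X' e c) :
    Decomposes n p q A H N F X := by
  have hN := Nat.lt_succ_self N
  -- The arc `pa N` has value zero after the merge, so its nonnegative parts vanish, and setting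
  -- them to `Y` amounts to adding `Y`.
  have hXa : ∀ c < p * q, X' (H.pa N) c = 0 := by
    have hs := h.sum _ (ha.trans hN)
    rw [show F' (H.pa N) = 0 by simp [hF, ha.ne], Finset.sum_eq_zero_iff_of_nonneg
      fun c hc => h.nonneg _ (ha.trans hN) c (Finset.mem_range.1 hc)] at hs
    exact fun c hc => hs c (Finset.mem_range.2 hc)
  refine ⟨?_, ?_, ?_, ?_⟩
  · intro e he c hc
    rw [hX e he c hc]
    split_ifs with h1 h2
    · exact hY0 c hc
    · rw [h2]; linarith [hY c hc]
    · exact h.nonneg e (he.trans hN) c hc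
  · intro e he c hc
    rw [hX e he c hc]
    split_ifs with h1 h2
    · exact hYA c hc
    · exact A.sub_mem (h.mem e (he.trans hN) c hc) (hYA c hc)
    · exact h.mem e (he.trans hN) c hc
  · intro e he
    rw [Finset.sum_congr rfl fun c hc => hX e he c (Finset.mem_range.1 hc)]
    split_ifs with h1 h2
    · rw [hYs, h1]
    · rw [Finset.sum_sub_distrib, hYs, h.sum e (he.trans hN), h2]
      simp [hF, hb.ne, hab.symm]
    · rw [h.sum e (he.trans hN)]
      simp [hF, he.ne, h1, h2]
  · intro c hc v hv hv'
    rw [History.net_add_two (g := fun e => X' e c) (α := Y c) (β := - Y c) v ha hb ?_]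
    · have := h.bal c hc v hv hv'
      rw [History.net_succ, History.inc_loop (ht.trans hh.symm)] at this
      rw [History.inc_parallel hm hm']
      linarith
    · intro e he
      rw [hX e he c hc]
      split_ifs with h1 h2 h3
      · exact absurd (h1.symm.trans h2) hab
      · rw [h1, hXa c hc]; ring
      · ring
      · ring

/-- After the elimination of all inner nodes, the decomposition can be read off. -/
theorem Sane.decomposes {N : ℕ} {F : ℕ → ℝ} {X : ℕ → ℕ → ℝ} (h : Sane n p q N₀ A H N F)
    (hp : 0 < p) (hq : 0 < q)
    (hend : ∀ e < N, F e ≠ 0 → H.tl e ≠ H.hd e → n ≤ H.tl e ∧ n ≤ H.hd e)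
    (hX : ∀ e < N, ∀ c < p * q, X e c = if (H.tl e = H.hd e ∧ c = 0) ∨
      (H.tl e = n + c / q ∧ H.hd e = n + p + c % q) then F e else 0) :
    Decomposes n p q A H N F X := by
  refine ⟨?_, ?_, ?_, ?_⟩
  · intro e he c hc
    rw [hX e he c hc]
    split_ifs
    exacts [h.nonneg e he, le_rfl]
  · intro e he c hc
    rw [hX e he c hc]
    split_ifs
    exacts [h.mem e he, A.zero_mem]
  · intro e he
    rw [Finset.sum_congr rfl fun c hc => hX e he c (Finset.mem_range.1 hc)]
    by_cases hF : F e = 0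
    · simp [hF]
    by_cases hl : H.tl e = H.hd e
    -- Loops go to commodity `0`. The second alternative in `hX` never applies to them, because `c /
    -- q < p` separates the source nodes from the sink nodes.
    · rw [Finset.sum_eq_single 0]
      · simp [hl]
      · intro c hc hc0
        rw [if_neg]
        rintro (h1 | h1)
        · exact hc0 h1.2
        · have hcp : c / q < p := by
            rw [Nat.div_lt_iff_lt_mul hq]; exact Finset.mem_range.1 hc
          omega
      · intro h0
        exact absurd (Finset.mem_range.2 (Nat.mul_pos hp hq)) h0
    -- Now the tail is some `n + i` and the head some `n + p + j`, so `i * q + j` is the only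
    -- matching commodity.
    · obtain ⟨h1, h2⟩ := hend e he hF hl
      have h3 := h.tl_lt e he
      have h4 := h.hd_lt e he
      obtain ⟨i, hi⟩ := Nat.exists_eq_add_of_le h1
      obtain ⟨j, hj⟩ := Nat.exists_eq_add_of_le (show n + p ≤ H.hd e by omega)
      have hjq : j < q := by omega
      have hip : i < p := by omega
      have hc1 : (i * q + j) / q = i := by
        rw [mul_comm, Nat.mul_add_div hq, Nat.div_eq_of_lt hjq, add_zero]
      have hc2 : (i * q + j) % q = j := by
        rw [mul_comm, Nat.mul_add_mod, Nat.mod_eq_of_lt hjq]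
      rw [Finset.sum_eq_single (i * q + j)]
      · rw [if_pos]
        right
        rw [hc1, hc2]
        exact ⟨hi, hj⟩
      · intro c hc hcne
        rw [if_neg]
        rintro (h5 | h5)
        · exact hl h5.1
        · apply hcne
          rw [← Nat.div_add_mod c q, mul_comm]
          congr 1
          · congr 1; omega
          · omega
      · intro h0
        refine absurd (Finset.mem_range.2 ?_) h0
        calc i * q + j < i * q + q := by omega
          _ = (i + 1) * q := by ring
          _ ≤ p * q := Nat.mul_le_mul_right _ hip
  · intro c hc v hv hv'
    refine Finset.sum_eq_zero fun e he => ?_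
    beta_reduce
    rw [hX e (Finset.mem_range.1 he) c hc]
    split_ifs with h1
    · rcases h1 with h1 | h1
      · rw [History.inc_loop h1.1, mul_zero]
      · simp [History.inc, h1.1, h1.2, hv.symm, hv'.symm]
    · rw [zero_mul]

end FlowDecomp

namespace FlowDecomp

/-! ### The extended network -/

/-- `H` starts with the arcs of `G`, followed by an arc from a new node to every source and an arc
from every sink to a new node. -/
structure History.Extends {n m p q : ℕ} (H : History) (G : Digraph n m) (s : Fin p → Fin n)
    (t : Fin q → Fin n) : Prop where
  tl : ∀ e : Fin m, H.tl e = G.tail e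
  hd : ∀ e : Fin m, H.hd e = G.head e
  tl_source : ∀ i : Fin p, H.tl (m + i) = n + i
  hd_source : ∀ i : Fin p, H.hd (m + i) = s i
  tl_sink : ∀ j : Fin q, H.tl (m + p + j) = t j
  hd_sink : ∀ j : Fin q, H.hd (m + p + j) = n + p + j

section

variable {n m p q : ℕ} {H : History} {G : Digraph n m} {s : Fin p → Fin n} {t : Fin q → Fin n}

theorem Digraph.divergence_eq_sum (G : Digraph n m) (f : Fin m → ℝ) (v : Fin n) :
    G.divergence f v =
      ∑ e, f e * ((if G.tail e = v then 1 else 0) - (if G.head e = v then 1 else 0)) := by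
  simp only [Digraph.divergence, Finset.sum_filter, mul_sub, mul_ite, mul_one, mul_zero,
    Finset.sum_sub_distrib]

theorem History.Extends.net (h : H.Extends G s t) (g : ℕ → ℝ) (v : ℕ) :
    H.net (m + p + q) g v =
      (∑ e : Fin m, g e * ((if (G.tail e : ℕ) = v then 1 else 0) -
        (if (G.head e : ℕ) = v then 1 else 0))) +
      (∑ i : Fin p, g (m + i) * ((if n + (i : ℕ) = v then 1 else 0) -
        (if (s i : ℕ) = v then 1 else 0))) +
      ∑ j : Fin q, g (m + p + j) * ((if (t j : ℕ) = v then 1 else 0) -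
        (if n + p + (j : ℕ) = v then 1 else 0)) := by
  rw [History.net, Finset.sum_range_add, Finset.sum_range_add, Finset.sum_range, Finset.sum_range,
    Finset.sum_range]
  simp only [History.inc, h.tl, h.hd, h.tl_source, h.hd_source, h.tl_sink, h.hd_sink]

theorem History.Extends.net_inner (h : H.Extends G s t) (g : ℕ → ℝ) (v : Fin n) :
    H.net (m + p + q) g v = G.divergence (fun e => g e) v -
      (∑ i : Fin p, if s i = v then g (m + i) else 0) +
      ∑ j : Fin q, if t j = v then g (m + p + j) else 0 := by
  rw [h.net, Digraph.divergence_eq_sum, sub_eq_add_neg, ← Finset.sum_neg_distrib]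
  congr 1
  · congr 1
    · simp only [Fin.val_inj]
    · refine Finset.sum_congr rfl fun i _ => ?_
      have : n + (i : ℕ) ≠ v := by have := v.2; omega
      simp only [this, if_false, Fin.val_inj]
      split_ifs <;> simp
  · refine Finset.sum_congr rfl fun j _ => ?_
    have : n + p + (j : ℕ) ≠ v := by have := v.2; omega
    simp only [this, if_false, Fin.val_inj]
    split_ifs <;> simp

/-- Only the arc `m + i` touches the node `n + i`. -/
theorem History.Extends.net_source (h : H.Extends G s t) (g : ℕ → ℝ) (i : Fin p) :
    H.net (m + p + q) g (n + i) = g (m + i) := by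
  rw [h.net, Finset.sum_eq_zero, Finset.sum_eq_single i, Finset.sum_eq_zero]
  · have : (s i : ℕ) ≠ n + i := by have := (s i).2; omega
    simp [this]
  · intro j _
    have h1 : (t j : ℕ) ≠ n + i := by have := (t j).2; omega
    have h2 : n + p + (j : ℕ) ≠ n + i := by have := i.2; omega
    simp [h1, h2]
  · intro j _ hj
    have h1 : (s j : ℕ) ≠ n + i := by have := (s j).2; omega
    have h2 : n + (j : ℕ) ≠ n + i := by have := Fin.val_ne_of_ne hj; omega
    rw [if_neg h1, if_neg h2]; simp
  · simp
  · intro e _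
    have h1 : (G.tail e : ℕ) ≠ n + i := by have := (G.tail e).2; omega
    have h2 : (G.head e : ℕ) ≠ n + i := by have := (G.head e).2; omega
    simp [h1, h2]

theorem History.Extends.net_sink (h : H.Extends G s t) (g : ℕ → ℝ) (j : Fin q) :
    H.net (m + p + q) g (n + p + j) = - g (m + p + j) := by
  rw [h.net, Finset.sum_eq_zero, Finset.sum_eq_zero, Finset.sum_eq_single j]
  · have : (t j : ℕ) ≠ n + p + j := by have := (t j).2; omega
    simp [this]
  · intro i _ hi
    have h1 : (t i : ℕ) ≠ n + p + j := by have := (t i).2; omega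
    have h2 : n + p + (i : ℕ) ≠ n + p + j := by have := Fin.val_ne_of_ne hi; omega
    rw [if_neg h1, if_neg h2]; simp
  · simp
  · intro i _
    have h1 : (s i : ℕ) ≠ n + p + j := by have := (s i).2; omega
    have h2 : n + (i : ℕ) ≠ n + p + j := by have := i.2; omega
    simp [h1, h2]
  · intro e _
    have h1 : (G.tail e : ℕ) ≠ n + p + j := by have := (G.tail e).2; omega
    have h2 : (G.head e : ℕ) ≠ n + p + j := by have := (G.head e).2; omega
    simp [h1, h2]

theorem index_cases {m p q : ℕ} {P : ℕ → Prop} (h₁ : ∀ e : Fin m, P e) (h₂ : ∀ i : Fin p, P (m + i))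
    (h₃ : ∀ j : Fin q, P (m + p + j)) : ∀ e < m + p + q, P e := by
  intro e he
  by_cases h : e < m
  · exact h₁ ⟨e, h⟩
  by_cases h' : e < m + p
  · have := h₂ ⟨e - m, by omega⟩
    rwa [show m + (e - m) = e by omega] at this
  · have := h₃ ⟨e - (m + p), by omega⟩
    rwa [show m + p + (e - (m + p)) = e by omega] at this

/-- The new arcs cancel the divergences of the sources and the sinks. Injectivity and disjointness
ensure that no node is corrected twice. A divergence is a signed sum of values of `f`, so it lies in
`A`. -/
theorem History.Extends.sane (h : H.Extends G s t) {f : Fin m → ℝ} {F : ℕ → ℝ} {A : AddSubgroup ℝ}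
    (hs : Function.Injective s) (ht : Function.Injective t)
    (hst : Disjoint (Set.range s) (Set.range t)) (hf : G.IsFlow (Set.range s) (Set.range t) f)
    (hA : ∀ e, f e ∈ A) (hn : 0 < n) (hF : ∀ e : Fin m, F e = f e)
    (hFs : ∀ i : Fin p, F (m + i) = G.divergence f (s i))
    (hFt : ∀ j : Fin q, F (m + p + j) = - G.divergence f (t j)) :
    Sane n p q (m + p + q) A H (m + p + q) F where
  pos := hn
  le := le_rfl
  nonneg := index_cases (fun e => by rw [hF]; exact hf.nonneg e)
    (fun i => by rw [hFs]; exact hf.source _ ⟨i, rfl⟩)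
    (fun j => by rw [hFt]; linarith [hf.sink _ ⟨j, rfl⟩])
  mem := by
    have hd : ∀ v, G.divergence f v ∈ A := fun v =>
      A.sub_mem (A.sum_mem fun e _ => hA e) (A.sum_mem fun e _ => hA e)
    exact index_cases (fun e => by rw [hF]; exact hA e) (fun i => by rw [hFs]; exact hd _)
      (fun j => by rw [hFt]; exact A.neg_mem (hd _))
  bal v hv := by
    have := h.net_inner F ⟨v, hv⟩
    simp only at this
    rw [this]
    simp only [hF, hFs, hFt]
    by_cases h1 : ∃ i, s i = ⟨v, hv⟩
    · obtain ⟨i, hi⟩ := h1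
      rw [Finset.sum_eq_single i, if_pos hi, hi, Finset.sum_eq_zero]
      · simp
      · intro j _
        rw [if_neg]
        intro hj
        exact Set.disjoint_left.1 hst ⟨i, hi⟩ ⟨j, hj⟩
      · intro j _ hj
        exact if_neg fun h' => hj (hs (h'.trans hi.symm))
      · simp
    · rw [Finset.sum_eq_zero fun i _ => if_neg fun hi => h1 ⟨i, hi⟩]
      by_cases h2 : ∃ j, t j = ⟨v, hv⟩
      · obtain ⟨j, hj⟩ := h2
        rw [Finset.sum_eq_single j, if_pos hj, hj]
        · simp
        · intro i _ hi
          exact if_neg fun h' => hi (ht (h'.trans hj.symm))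
        · simp
      · rw [Finset.sum_eq_zero fun i _ => if_neg fun hi => h2 ⟨i, hi⟩,
          hf.inner _ (fun hi => h1 hi) (fun hi => h2 hi)]
        simp
  tl_lt := index_cases (fun e => by rw [h.tl]; have := (G.tail e).2; omega)
    (fun i => by rw [h.tl_source]; have := i.2; omega)
    (fun j => by rw [h.tl_sink]; have := (t j).2; omega)
  hd_lt := index_cases (fun e => by rw [h.hd]; exact Or.inl (G.head e).2)
    (fun i => by rw [h.hd_source]; exact Or.inl (s i).2)
    (fun j => by rw [h.hd_sink]; have := j.2; omega)
  card := (Finset.card_filter_le _ _).trans (Finset.card_range _).le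

theorem pair_div_mod {i j q : ℕ} (hj : j < q) : (i * q + j) / q = i ∧ (i * q + j) % q = j := by
  have hq : 0 < q := by omega
  rw [mul_comm, Nat.mul_add_div hq, Nat.div_eq_of_lt hj, add_zero, Nat.mul_add_mod,
    Nat.mod_eq_of_lt hj]
  exact ⟨rfl, rfl⟩

theorem pair_lt {i j p q : ℕ} (hi : i < p) (hj : j < q) : i * q + j < p * q := calc
  i * q + j < i * q + q := by omega
  _ = (i + 1) * q := by ring
  _ ≤ p * q := Nat.mul_le_mul_right _ hi

/-- The commodity `i * q + j` is balanced at all new nodes except `n + i` and `n + p + j`, hence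
zero on all other new arcs. Its divergence in `G` is therefore its value on the arc `m + i` at `s
i`, minus its value on `m + p + j` at `t j`, and zero elsewhere. -/
theorem History.Extends.isFlow (h : H.Extends G s t) {F : ℕ → ℝ} {X : ℕ → ℕ → ℝ}
    {A : AddSubgroup ℝ} (hX : Decomposes n p q A H (m + p + q) F X)
    (hst : Disjoint (Set.range s) (Set.range t)) (i : Fin p) (j : Fin q) :
    G.IsFlow {s i} {t j} fun e => X e (i * q + j) := by
  have hc := pair_lt i.2 j.2
  obtain ⟨hc1, hc2⟩ := pair_div_mod (i := i) j.2
  have key : ∀ v : Fin n, G.divergence (fun e : Fin m => X e (i * q + j)) v =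
      (if s i = v then X (m + i) (i * q + j) else 0) -
        (if t j = v then X (m + p + j) (i * q + j) else 0) := by
    intro v
    have h1 := h.net_inner (fun e => X e (i * q + j)) v
    have h2 : ∀ i' : Fin p, i' ≠ i → X (m + i') (i * q + j) = 0 := by
      intro i' hi'
      rw [← h.net_source (fun e => X e (i * q + j)) i']
      refine hX.bal _ hc _ ?_ ?_
      · have := Fin.val_ne_of_ne hi'; omega
      · have := i'.2; omega
    have h3 : ∀ j' : Fin q, j' ≠ j → X (m + p + j') (i * q + j) = 0 := by
      intro j' hj'
      have := h.net_sink (fun e => X e (i * q + j)) j'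
      rw [hX.bal _ hc _ (by have := i.2; omega) (by have := Fin.val_ne_of_ne hj'; omega)] at this
      linarith
    rw [hX.bal _ hc _ (by have := v.2; omega) (by have := v.2; omega),
      Finset.sum_eq_single i (fun i' _ hi' => by rw [h2 i' hi', ite_self]) (by simp),
      Finset.sum_eq_single j (fun j' _ hj' => by rw [h3 j' hj', ite_self]) (by simp)] at h1
    linarith
  have hne : t j ≠ s i := fun h' => Set.disjoint_left.1 hst ⟨i, rfl⟩ ⟨j, h'⟩
  have hi0 := hX.nonneg (m + i) (by have := i.2; omega) _ hc
  have hj0 := hX.nonneg (m + p + j) (by have := j.2; omega) _ hc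
  refine ⟨fun e => hX.nonneg _ (by have := e.2; omega) _ hc, ?_, ?_, ?_⟩
  · rintro v rfl
    rw [key, if_pos rfl, if_neg hne]; linarith
  · rintro v rfl
    rw [key, if_pos rfl, if_neg hne.symm]; linarith
  · intro v hv hv'
    rw [key, if_neg fun h' => hv h'.symm, if_neg fun h' => hv' h'.symm, sub_zero]

end

theorem sum_pairs (p q : ℕ) (g : ℕ → ℝ) :
    ∑ c ∈ Finset.range (p * q), g c = ∑ i : Fin p, ∑ j : Fin q, g (i * q + j) := by
  rw [Finset.sum_range, ← finProdFinEquiv.sum_comp, Fintype.sum_prod_type]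
  refine Finset.sum_congr rfl fun i _ => Finset.sum_congr rfl fun j _ => ?_
  simp [finProdFinEquiv, add_comm, mul_comm]

/-! ### The potential -/

/-- By `log r ≥ 1 - 1 / r` the difference is at least `μ * (x ^ 2 - y ^ 2) / (μ + x ^ 2)`. From `y ≤
5 / 6 * x` one gets `x ^ 2 - y ^ 2 ≥ 11 / 36 * x ^ 2`, and `μ * x ^ 2 / (μ + x ^ 2)` is at least
half of `min μ (x ^ 2)`. With `x` and `y` the numbers of nodes before and after a phase, the drop
pays for the arcs handled in that phase. -/
theorem min_le_log_sub_log {μ x y : ℝ} (hμ : 0 < μ) (hy : 0 ≤ y) (hxy : 6 * y ≤ 5 * x) :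
    11 / 72 * min μ (x ^ 2) ≤
      μ * Real.log (1 + x ^ 2 / μ) - μ * Real.log (1 + y ^ 2 / μ) := by
  have hx : 0 ≤ x := by linarith
  have h1 : 0 < 1 + y ^ 2 / μ := by positivity
  have h2 : 0 < 1 + x ^ 2 / μ := by positivity
  have hlog : 1 - (1 + y ^ 2 / μ) / (1 + x ^ 2 / μ) ≤
      Real.log (1 + x ^ 2 / μ) - Real.log (1 + y ^ 2 / μ) := by
    rw [← Real.log_div h2.ne' h1.ne']
    have := Real.one_sub_inv_le_log_of_pos (div_pos h2 h1)
    rwa [inv_div] at this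
  have hq : 1 - (1 + y ^ 2 / μ) / (1 + x ^ 2 / μ) = (x ^ 2 - y ^ 2) / (μ + x ^ 2) := by
    field_simp
    ring
  have hd : 11 / 36 * x ^ 2 ≤ x ^ 2 - y ^ 2 := by nlinarith
  have h3 : 11 / 72 * min μ (x ^ 2) ≤ μ * ((x ^ 2 - y ^ 2) / (μ + x ^ 2)) := by
    rw [← mul_div_assoc, le_div_iff₀ (by positivity)]
    have ha : min μ (x ^ 2) ≤ μ := min_le_left _ _
    have hb : min μ (x ^ 2) ≤ x ^ 2 := min_le_right _ _
    have hm : 0 ≤ min μ (x ^ 2) := le_min hμ.le (sq_nonneg x)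
    have hprod : min μ (x ^ 2) * (μ + x ^ 2) ≤ 2 * (μ * x ^ 2) := by
      nlinarith [mul_le_mul_of_nonneg_right hb hμ.le, mul_le_mul_of_nonneg_right ha (sq_nonneg x)]
    nlinarith [mul_le_mul_of_nonneg_left hd hμ.le]
  calc _ ≤ _ := h3
    _ = μ * (1 - (1 + y ^ 2 / μ) / (1 + x ^ 2 / μ)) := by rw [hq]
    _ ≤ μ * (Real.log (1 + x ^ 2 / μ) - Real.log (1 + y ^ 2 / μ)) :=
      mul_le_mul_of_nonneg_left hlog hμ.le
    _ = _ := by ring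

end FlowDecomp

namespace FlowDecomp

/-! ### Linked lists and array segments -/

/-- The list `l` is stored from the pointer `a` on; the pointer to the entry `e` is `e + 1`, and
`0` is the end. -/
def Chained (next : ℕ → ℕ) : ℕ → List ℕ → Prop
  | a, [] => a = 0
  | a, e :: l => a = e + 1 ∧ Chained next (next e) l

theorem Chained.update {next : ℕ → ℕ} {a : ℕ} {l : List ℕ} (h : Chained next a l) {e x : ℕ}
    (he : e ∉ l) : Chained (Function.update next e x) a l := by
  induction l generalizing a with
  | nil => exact h
  | cons b l ih =>
    simp only [List.mem_cons, not_or] at he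
    refine ⟨h.1, ?_⟩
    rw [Function.update_of_ne (Ne.symm he.1)]
    exact ih h.2 he.2

theorem Chained.push {next : ℕ → ℕ} {a : ℕ} {l : List ℕ} (h : Chained next a l) {e : ℕ}
    (he : e ∉ l) : Chained (Function.update next e a) (e + 1) (e :: l) :=
  ⟨rfl, by rw [Function.update_self]; exact h.update he⟩

/-- The cells of `R` from number `a` on hold the list `l`. -/
def Segment (R : ℕ → ℕ) : ℕ → List ℕ → Prop
  | _, [] => True
  | a, x :: l => R a = x ∧ Segment R (a + 1) l

theorem segment_append {R : ℕ → ℕ} {a : ℕ} {l l' : List ℕ} :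
    Segment R a (l ++ l') ↔ Segment R a l ∧ Segment R (a + l.length) l' := by
  induction l generalizing a with
  | nil => simp [Segment]
  | cons b l ih =>
    simp only [List.cons_append, Segment, ih, List.length_cons, and_assoc]
    rw [show a + 1 + l.length = a + (l.length + 1) by omega]

theorem Segment.congr {R R' : ℕ → ℕ} {a : ℕ} {l : List ℕ} (h : Segment R a l)
    (hR : ∀ i, a ≤ i → i < a + l.length → R' i = R i) : Segment R' a l := by
  induction l generalizing a with
  | nil => exact trivial
  | cons b l ih =>
    rw [List.length_cons] at hR
    exact ⟨(hR a le_rfl (by omega)).trans h.1, ih h.2 fun i h1 h2 => hR i (by omega) (by omega)⟩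

theorem Segment.update {R : ℕ → ℕ} {a i x : ℕ} {l : List ℕ} (h : Segment R a l)
    (hi : i < a ∨ a + l.length ≤ i) : Segment (Function.update R i x) a l :=
  h.congr fun j h1 h2 => Function.update_of_ne (by omega) _ _

/-! ### The program -/

/-- The history that stands in the memory. -/
def Memory.history (σ : Memory) : History where
  tl := σ.warr 0
  hd := σ.warr 1
  kd := σ.warr 11
  pa := σ.warr 12
  pb := σ.warr 13
  dl := σ.xarr 2

/-- Add up the divergences in the number array `3`. -/
def divergenceLoop : Program := .loop (.wlt 10 1) (ops
  [.wload 11 0 10, .wload 12 1 10, .xload 1 0 10, .xload 2 3 11, .xadd 2 2 1, .xstore 3 11 2,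
   .xload 2 3 12, .xsub 2 2 1, .xstore 3 12 2, .wsucc 10])

/-- Create an arc to every source. -/
def sourceLoop : Program := .loop (.wlt 10 2) (ops
  [.wload 23 2 10, .xload 1 3 23, .wstore 0 4 27, .wstore 1 4 23, .xstore 0 4 1, .wsucc 4,
   .wsucc 27, .wsucc 10])

/-- Create an arc from every sink. -/
def sinkLoop : Program := .loop (.wlt 10 3) (ops
  [.wload 23 3 10, .xload 1 3 23, .xsub 1 0 1, .wstore 0 4 23, .wstore 1 4 27, .xstore 0 4 1,
   .wsucc 4, .wsucc 27, .wsucc 10])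

/-- Multiply the number of sources by the number of sinks. -/
def productLoop : Program := .loop (.wlt 10 2) (block
  [ops [.wconst 31 0], .loop (.wlt 31 3) (ops [.wsucc 7, .wsucc 31]), ops [.wsucc 10]])

/-- Append the nodes from the register `23` up to the register `b` to the list of the remaining
nodes. -/
def nodeLoop (b : ℕ) : Program := .loop (.wlt 23 b) (ops
  [.wstore 10 5 23, .wsucc 5, .wsucc 23])

/-- Insert the arc in the register `13` into the list of the arcs that leave the node in the
register `11` and into the list of the arcs that enter the node in the register `12`. -/
def push : Program := ops
  [.wload 16 5 11, .wstore 6 13 16, .wload 16 7 12, .wstore 8 13 16, .wcopy 16 13, .wsucc 16,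
   .wstore 5 11 16, .wstore 7 12 16, .wload 16 9 11, .wsucc 16, .wstore 9 11 16, .wload 16 9 12,
   .wsucc 16, .wstore 9 12 16]

/-- Insert all arcs but the loops into the lists. -/
def insertLoop : Program := .loop (.wlt 13 4) (block
  [ops [.wload 11 0 13, .wload 12 1 13], .branch (.weq 11 12) .skip push, ops [.wsucc 13]])

/-- Set up the extended network. -/
def setup : Program := block
  -- Word registers 4, 5, 6, 7, 8 come to hold the numbers of arcs, listed nodes, new nodes,
  -- commodities and initial arcs; 26 and 27 hold `n + p` and `n + p + q`. Word register 9 and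
  -- number register 0 are never written and serve as zeros. Arrays 5 and 6 (7 and 8) hold first
  -- pointers and successors of the lists of leaving (entering) arcs, 9 degree counters, and 10 the
  -- list of nodes, in which the new nodes come first.
  [divergenceLoop, ops [.wcopy 4 1, .wcopy 27 0, .wconst 10 0], sourceLoop,
   ops [.wcopy 26 27, .wconst 10 0], sinkLoop, ops [.wcopy 8 4, .wconst 10 0], productLoop,
   ops [.wcopy 23 0], nodeLoop 27, ops [.wcopy 6 5, .wconst 23 0], nodeLoop 0,
   ops [.wconst 13 0], insertLoop]

/-- Clear the lists of the entering arcs. -/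
def resetLoop : Program := .loop (.wlt 10 5) (ops
  [.wload 23 10 10, .wstore 7 23 9, .wstore 9 23 9, .wsucc 10])

/-- Move the value of the arc in the register `13` to the arc in the register `16`. -/
def merge : Program := ops
  [.xload 2 0 16, .xadd 2 2 1, .xstore 0 16 2, .xstore 0 13 0, .wstore 11 4 9, .wstore 12 4 13,
   .wstore 13 4 16, .xstore 2 4 1, .wstore 0 4 9, .wstore 1 4 9, .xstore 0 4 0, .wsucc 4]

/-- Put `1` into the register `17` if the arc with the pointer in the register `16` leaves the node
in the register `11`, and `0` otherwise. -/
def compareTail : Program := block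
  [ops [.wconst 17 0],
   .branch (.weq 16 9) .skip (block
     [ops [.wpred 16, .wload 25 0 16], .branch (.weq 25 11) (ops [.wconst 17 1]) .skip])]

/-- Keep, merge or forget the next arc of an old list. -/
def rebuildArc : Program := block
  [ops [.wcopy 13 14, .wpred 13, .wload 14 6 13, .xload 1 0 13],
   .branch (.xeq 1 0) .skip (block
     -- All arcs leaving one node are treated consecutively, so a kept arc parallel to the present
     -- one must be the first in the list of its head, and one comparison decides.
     [ops [.wload 12 1 13, .wload 16 7 12], compareTail,
      .branch (.weq 17 9) (block [push, ops [.wsucc 20]]) merge])]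

/-- Build the lists of the nonzero arcs anew, with parallel arcs merged. -/
def rebuildLoop : Program := .loop (.wlt 10 5) (block
  [ops [.wload 11 10 10, .wload 14 5 11, .wstore 5 11 9], .loop (.wne 14 9) rebuildArc,
   ops [.wsucc 10]])

/-- Compute a bound on the degrees of the nodes that are to be eliminated. -/
def thresholdLoop : Program := .loop (.wlt 10 20) (block
  [ops [.wsucc 10, .wsucc 22],
   -- Division by counting: register 22 runs cyclically through the positions of the inner nodes,
   -- and every completed cycle adds 4 to the bound.
   .branch (.weq 22 5) (ops [.wcopy 22 6, .wsucc 21, .wsucc 21, .wsucc 21, .wsucc 21]) .skip])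

/-- Splice the first arc of the list of entering arcs with the first arc of the list of leaving
arcs. -/
def splice : Program := block
  [ops [.wcopy 18 14, .wpred 18, .wcopy 19 15, .wpred 19, .xload 1 0 18, .xload 2 0 19],
   .branch (.xle 1 2) (ops [.xcopy 3 1, .wload 14 8 18]) (ops [.xcopy 3 2, .wload 15 6 19]),
   ops [.xsub 1 1 3, .xsub 2 2 3, .xstore 0 18 1, .xstore 0 19 2, .xstore 0 4 3, .wload 11 0 18,
     .wload 12 1 19, .wstore 0 4 11, .wstore 1 4 12, .wconst 17 1, .wstore 11 4 17, .wstore 12 4 18,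
     .wstore 13 4 19, .wcopy 13 4, .wsucc 4],
   .branch (.weq 11 12) .skip push]

/-- Eliminate the node in the register `23`. -/
def eliminate : Program := block
  [ops [.wload 14 7 23, .wload 15 5 23],
   -- If no leaving arc is left, balance forces the remaining entering arcs to be zero, so they are
   -- abandoned.
   .loop (.wne 14 9) (.branch (.weq 15 9) (ops [.wconst 14 0]) splice)]

/-- Eliminate the nodes of small degree. -/
def eliminateLoop : Program := .loop (.wlt 10 5) (block
  [ops [.wload 23 10 10, .wload 25 9 23],
   -- Survivors are compacted in place; the writing position 24 never overtakes the reading position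
   -- 10.
   .branch (.wle 25 21) eliminate (ops [.wstore 10 24 23, .wsucc 24]), ops [.wsucc 10]])

/-- A phase of the elimination. -/
def phase : Program := block
  [ops [.wconst 10 0], resetLoop, ops [.wconst 20 0, .wconst 10 0], rebuildLoop,
   ops [.wconst 21 4, .wcopy 22 6, .wconst 10 0], thresholdLoop, ops [.wcopy 10 6, .wcopy 24 6],
   eliminateLoop, ops [.wcopy 5 24]]

/-- Assign the value of an arc to the commodity that it serves. -/
def assignArc : Program := .loop (.wlt 31 7) (block
  [.branch (.weq 11 29) (.branch (.weq 12 30) (ops [.xstore 1 28 1]) .skip) .skip,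
   ops [.wsucc 28, .wsucc 31, .wsucc 30],
   .branch (.weq 30 27) (ops [.wcopy 30 26, .wsucc 29]) .skip])

/-- Decompose the values that remain after the eliminations. -/
def assignLoop : Program := .loop (.wlt 13 4) (block
  [ops [.wload 11 0 13, .wload 12 1 13, .xload 1 0 13, .wstore 4 13 28],
   .branch (.weq 11 12) (ops [.xstore 1 28 1]) .skip,
   ops [.wconst 31 0, .wcopy 29 0, .wcopy 30 26], assignArc, ops [.wsucc 13]])

/-- Distribute a spliced arc to its parts. -/
def unspliceLoop : Program := .loop (.wlt 31 7) (ops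
  [.xload 1 1 30, .xload 2 1 28, .xadd 2 2 1, .xstore 1 28 2, .xload 2 1 29, .xadd 2 2 1,
   .xstore 1 29 2, .wsucc 28, .wsucc 29, .wsucc 30, .wsucc 31])

/-- Separate parallel arcs. -/
def unmergeLoop : Program := .loop (.wlt 31 7) (block
  [ops [.xload 2 1 29], .branch (.xle 2 3) (ops [.xcopy 1 2]) (ops [.xcopy 1 3]),
   ops [.xsub 2 2 1, .xsub 3 3 1, .xstore 1 29 2, .xstore 1 28 1, .wsucc 28, .wsucc 29,
     .wsucc 31]])

/-- Undo the eliminations. -/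
def undoLoop : Program := .loop (.wlt 8 4) (block
  [ops [.wpred 4, .wload 18 12 4, .wload 19 13 4, .wload 28 4 18, .wload 29 4 19, .wload 30 4 4,
     .wload 17 11 4, .wconst 31 0, .xload 3 2 4],
   .branch (.weq 17 9) unmergeLoop unspliceLoop])

/-- The decomposition algorithm. -/
def decompose : Program := block
  [setup, .loop (.wlt 6 5) phase, ops [.wconst 13 0, .wconst 28 0], assignLoop, undoLoop]

end FlowDecomp

namespace FlowDecomp

/-! ### The setup -/

/-- The second cell is read after the first write, so the formula also covers a loop, `u = w`, where
the two changes cancel. -/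
theorem update_add_update_sub (g : ℕ → ℝ) (y : ℝ) (u w v : ℕ) :
    Function.update (Function.update g u (g u + y)) w (Function.update g u (g u + y) w - y) v =
      g v + y * ((if u = v then 1 else 0) - (if w = v then 1 else 0)) := by
  simp only [Function.update_apply]
  grind

/-- Here, as in the other counting loops, the credit in the invariant is the cost of a turn times
the number of turns left; a turn takes ten instructions and one test. -/
theorem runs_divergenceLoop {σ₀ : Memory} (h10 : σ₀.wreg 10 = 0) (hacc : ∀ v, σ₀.xarr 3 v = 0) :
    Runs divergenceLoop σ₀ fun k τ => k ≤ 11 * σ₀.wreg 1 + 1 ∧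
      ∀ v, τ.xarr 3 v = σ₀.history.net (σ₀.wreg 1) (σ₀.xarr 0) v := by
  refine Runs.loop (fun t σ => σ.wreg 10 ≤ σ₀.wreg 1 ∧ t = 11 * (σ₀.wreg 1 - σ.wreg 10) ∧
    ∀ v, σ.xarr 3 v = σ₀.history.net (σ.wreg 10) (σ₀.xarr 0) v) _ ⟨by omega, rfl, ?_⟩ ?_ ?_
  · simp [h10, hacc, History.net]
  · rintro t σ hf ⟨hle, ht, hinv⟩ hb
    have e1 : σ.wreg 1 = σ₀.wreg 1 := hf.wreg 1 (by decide)
    have e2 : σ.warr 0 = σ₀.warr 0 := hf.warr 0 (by decide)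
    have e3 : σ.warr 1 = σ₀.warr 1 := hf.warr 1 (by decide)
    have e4 : σ.xarr 0 = σ₀.xarr 0 := hf.xarr 0 (by decide)
    simp only [Test.holds, e1] at hb
    refine Runs.ops fun τ hτ => ⟨11 * (σ₀.wreg 1 - τ.wreg 10), ⟨?_, rfl, ?_⟩, ?_⟩
    · simp [hτ, Instr.effect]; omega
    · intro v
      have t10 : τ.wreg 10 = σ.wreg 10 + 1 := by simp [hτ, Instr.effect]
      have tx : τ.xarr 3 = Function.update (Function.update (σ.xarr 3) (σ₀.warr 0 (σ.wreg 10))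
          (σ.xarr 3 (σ₀.warr 0 (σ.wreg 10)) + σ₀.xarr 0 (σ.wreg 10))) (σ₀.warr 1 (σ.wreg 10))
          (Function.update (σ.xarr 3) (σ₀.warr 0 (σ.wreg 10)) (σ.xarr 3 (σ₀.warr 0 (σ.wreg 10)) +
            σ₀.xarr 0 (σ.wreg 10)) (σ₀.warr 1 (σ.wreg 10)) - σ₀.xarr 0 (σ.wreg 10)) := by
        simp [hτ, Instr.effect, e2, e3, e4]
      rw [t10, History.net_succ, ← hinv, tx]
      exact update_add_update_sub _ _ _ _ _
    · simp [hτ, Instr.effect]; omega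
  · rintro k t τ hf ⟨hle, ht, hinv⟩ hb hk
    have e1 : τ.wreg 1 = σ₀.wreg 1 := hf.wreg 1 (by decide)
    simp only [Test.holds, e1] at hb
    have : τ.wreg 10 = σ₀.wreg 1 := by omega
    exact ⟨by omega, by simpa [this] using hinv⟩


theorem runs_sourceLoop {σ₀ : Memory} (h10 : σ₀.wreg 10 = 0) :
    Runs sourceLoop σ₀ fun k τ => k ≤ 9 * σ₀.wreg 2 + 1 ∧ τ.wreg 4 = σ₀.wreg 4 + σ₀.wreg 2 ∧
      τ.wreg 27 = σ₀.wreg 27 + σ₀.wreg 2 ∧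
      (∀ e < σ₀.wreg 4, τ.warr 0 e = σ₀.warr 0 e ∧ τ.warr 1 e = σ₀.warr 1 e ∧
        τ.xarr 0 e = σ₀.xarr 0 e) ∧
      ∀ i < σ₀.wreg 2, τ.warr 0 (σ₀.wreg 4 + i) = σ₀.wreg 27 + i ∧
        τ.warr 1 (σ₀.wreg 4 + i) = σ₀.warr 2 i ∧
        τ.xarr 0 (σ₀.wreg 4 + i) = σ₀.xarr 3 (σ₀.warr 2 i) := by
  refine Runs.loop (fun t σ => σ.wreg 10 ≤ σ₀.wreg 2 ∧ t = 9 * (σ₀.wreg 2 - σ.wreg 10) ∧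
      σ.wreg 4 = σ₀.wreg 4 + σ.wreg 10 ∧ σ.wreg 27 = σ₀.wreg 27 + σ.wreg 10 ∧
      (∀ e < σ₀.wreg 4, σ.warr 0 e = σ₀.warr 0 e ∧ σ.warr 1 e = σ₀.warr 1 e ∧
        σ.xarr 0 e = σ₀.xarr 0 e) ∧
      ∀ i < σ.wreg 10, σ.warr 0 (σ₀.wreg 4 + i) = σ₀.wreg 27 + i ∧
        σ.warr 1 (σ₀.wreg 4 + i) = σ₀.warr 2 i ∧
        σ.xarr 0 (σ₀.wreg 4 + i) = σ₀.xarr 3 (σ₀.warr 2 i)) _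
    ⟨by omega, rfl, by omega, by omega, fun _ _ => ⟨rfl, rfl, rfl⟩, by omega⟩ ?_ ?_
  · rintro t σ hf ⟨hle, ht, h4, h27, hold, hnew⟩ hb
    have e1 : σ.wreg 2 = σ₀.wreg 2 := hf.wreg 2 (by decide)
    have e2 : σ.warr 2 = σ₀.warr 2 := hf.warr 2 (by decide)
    have e4 : σ.xarr 3 = σ₀.xarr 3 := hf.xarr 3 (by decide)
    simp only [Test.holds, e1] at hb
    refine Runs.ops fun τ hτ => ⟨9 * (σ₀.wreg 2 - τ.wreg 10), ?_⟩
    have t10 : τ.wreg 10 = σ.wreg 10 + 1 := by simp [hτ, Instr.effect]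
    have t4 : τ.wreg 4 = σ.wreg 4 + 1 := by simp [hτ, Instr.effect]
    have t27 : τ.wreg 27 = σ.wreg 27 + 1 := by simp [hτ, Instr.effect]
    have t0 : τ.warr 0 = Function.update (σ.warr 0) (σ.wreg 4) (σ.wreg 27) := by
      simp [hτ, Instr.effect]
    have t1 : τ.warr 1 = Function.update (σ.warr 1) (σ.wreg 4) (σ₀.warr 2 (σ.wreg 10)) := by
      simp [hτ, Instr.effect, e2]
    have tx : τ.xarr 0 = Function.update (σ.xarr 0) (σ.wreg 4)
        (σ₀.xarr 3 (σ₀.warr 2 (σ.wreg 10))) := by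
      simp [hτ, Instr.effect, e2, e4]
    clear hτ
    refine ⟨⟨by omega, rfl, by omega, by omega, ?_, ?_⟩, ?_⟩
    · intro e he
      have : e ≠ σ.wreg 4 := by omega
      simpa [t0, t1, tx, this] using hold e he
    · intro i hi
      rw [t0, t1, tx]
      rcases Nat.lt_succ_iff_lt_or_eq.1 (t10 ▸ hi) with h | h
      · have : σ₀.wreg 4 + i ≠ σ.wreg 4 := by omega
        simpa [this] using hnew i h
      · rw [h, ← h4, h27]
        simp
    · simp only [List.length]; omega
  · rintro k t τ hf ⟨hle, ht, h4, h27, hold, hnew⟩ hb hk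
    have e1 : τ.wreg 2 = σ₀.wreg 2 := hf.wreg 2 (by decide)
    simp only [Test.holds, e1] at hb
    have : τ.wreg 10 = σ₀.wreg 2 := by omega
    rw [this] at h4 h27 hnew
    exact ⟨by omega, h4, h27, hold, hnew⟩

theorem runs_sinkLoop {σ₀ : Memory} (h10 : σ₀.wreg 10 = 0) (h0 : σ₀.xreg 0 = 0) :
    Runs sinkLoop σ₀ fun k τ => k ≤ 10 * σ₀.wreg 3 + 1 ∧ τ.wreg 4 = σ₀.wreg 4 + σ₀.wreg 3 ∧
      τ.wreg 27 = σ₀.wreg 27 + σ₀.wreg 3 ∧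
      (∀ e < σ₀.wreg 4, τ.warr 0 e = σ₀.warr 0 e ∧ τ.warr 1 e = σ₀.warr 1 e ∧
        τ.xarr 0 e = σ₀.xarr 0 e) ∧
      ∀ i < σ₀.wreg 3, τ.warr 1 (σ₀.wreg 4 + i) = σ₀.wreg 27 + i ∧
        τ.warr 0 (σ₀.wreg 4 + i) = σ₀.warr 3 i ∧
        τ.xarr 0 (σ₀.wreg 4 + i) = - σ₀.xarr 3 (σ₀.warr 3 i) := by
  refine Runs.loop (fun t σ => σ.wreg 10 ≤ σ₀.wreg 3 ∧ t = 10 * (σ₀.wreg 3 - σ.wreg 10) ∧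
      σ.wreg 4 = σ₀.wreg 4 + σ.wreg 10 ∧ σ.wreg 27 = σ₀.wreg 27 + σ.wreg 10 ∧
      (∀ e < σ₀.wreg 4, σ.warr 0 e = σ₀.warr 0 e ∧ σ.warr 1 e = σ₀.warr 1 e ∧
        σ.xarr 0 e = σ₀.xarr 0 e) ∧
      ∀ i < σ.wreg 10, σ.warr 1 (σ₀.wreg 4 + i) = σ₀.wreg 27 + i ∧
        σ.warr 0 (σ₀.wreg 4 + i) = σ₀.warr 3 i ∧
        σ.xarr 0 (σ₀.wreg 4 + i) = - σ₀.xarr 3 (σ₀.warr 3 i)) _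
    ⟨by omega, rfl, by omega, by omega, fun _ _ => ⟨rfl, rfl, rfl⟩, by omega⟩ ?_ ?_
  · rintro t σ hf ⟨hle, ht, h4, h27, hold, hnew⟩ hb
    have e1 : σ.wreg 3 = σ₀.wreg 3 := hf.wreg 3 (by decide)
    have e2 : σ.warr 3 = σ₀.warr 3 := hf.warr 3 (by decide)
    have e4 : σ.xarr 3 = σ₀.xarr 3 := hf.xarr 3 (by decide)
    have e5 : σ.xreg 0 = 0 := (hf.xreg 0 (by decide)).trans h0
    simp only [Test.holds, e1] at hb
    refine Runs.ops fun τ hτ => ⟨10 * (σ₀.wreg 3 - τ.wreg 10), ?_⟩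
    have t10 : τ.wreg 10 = σ.wreg 10 + 1 := by simp [hτ, Instr.effect]
    have t4 : τ.wreg 4 = σ.wreg 4 + 1 := by simp [hτ, Instr.effect]
    have t27 : τ.wreg 27 = σ.wreg 27 + 1 := by simp [hτ, Instr.effect]
    have t1 : τ.warr 1 = Function.update (σ.warr 1) (σ.wreg 4) (σ.wreg 27) := by
      simp [hτ, Instr.effect]
    have t0 : τ.warr 0 = Function.update (σ.warr 0) (σ.wreg 4) (σ₀.warr 3 (σ.wreg 10)) := by
      simp [hτ, Instr.effect, e2]
    have tx : τ.xarr 0 = Function.update (σ.xarr 0) (σ.wreg 4)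
        (- σ₀.xarr 3 (σ₀.warr 3 (σ.wreg 10))) := by
      simp [hτ, Instr.effect, e2, e4, e5]
    clear hτ
    refine ⟨⟨by omega, rfl, by omega, by omega, ?_, ?_⟩, ?_⟩
    · intro e he
      have : e ≠ σ.wreg 4 := by omega
      simpa [t0, t1, tx, this] using hold e he
    · intro i hi
      rw [t0, t1, tx]
      rcases Nat.lt_succ_iff_lt_or_eq.1 (t10 ▸ hi) with h | h
      · have : σ₀.wreg 4 + i ≠ σ.wreg 4 := by omega
        simpa [this] using hnew i h
      · rw [h, ← h4, h27]
        simp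
    · simp only [List.length]; omega
  · rintro k t τ hf ⟨hle, ht, h4, h27, hold, hnew⟩ hb hk
    have e1 : τ.wreg 3 = σ₀.wreg 3 := hf.wreg 3 (by decide)
    simp only [Test.holds, e1] at hb
    have : τ.wreg 10 = σ₀.wreg 3 := by omega
    rw [this] at h4 h27 hnew
    exact ⟨by omega, h4, h27, hold, hnew⟩

theorem runs_productLoop {σ₀ : Memory} (h10 : σ₀.wreg 10 = 0) (h7 : σ₀.wreg 7 = 0) :
    Runs productLoop σ₀ fun k τ => k ≤ σ₀.wreg 2 * (3 * σ₀.wreg 3 + 4) + 1 ∧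
      τ.wreg 7 = σ₀.wreg 2 * σ₀.wreg 3 := by
  refine Runs.loop (fun t σ => σ.wreg 10 ≤ σ₀.wreg 2 ∧
      t = (σ₀.wreg 2 - σ.wreg 10) * (3 * σ₀.wreg 3 + 4) ∧
      σ.wreg 7 = σ.wreg 10 * σ₀.wreg 3) _ ⟨by omega, rfl, by simp [h7, h10]⟩ ?_ ?_
  · rintro t σ hf ⟨hle, ht, h7⟩ hb
    have e2 : σ.wreg 2 = σ₀.wreg 2 := hf.wreg 2 (by decide)
    have e3 : σ.wreg 3 = σ₀.wreg 3 := hf.wreg 3 (by decide)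
    simp only [Test.holds, e2] at hb
    refine Runs.seq (R := fun k τ => k = 1 ∧ τ.wreg 31 = 0)
      (Runs.ops fun τ hτ => ⟨rfl, by simp [hτ, Instr.effect]⟩) ?_
    rintro k₁ σ₁ hf₁ ⟨rfl, h31⟩
    have e4 : σ₁.wreg 3 = σ₀.wreg 3 := (hf₁.wreg 3 (by decide)).trans e3
    have e5 : σ₁.wreg 7 = σ.wreg 7 := hf₁.wreg 7 (by decide)
    have e6 : σ₁.wreg 10 = σ.wreg 10 := hf₁.wreg 10 (by decide)
    refine Runs.seq (R := fun k τ => k ≤ 3 * σ₀.wreg 3 + 1 ∧ τ.wreg 7 = σ.wreg 7 + σ₀.wreg 3)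
      (Runs.loop (fun t τ => τ.wreg 31 ≤ σ₀.wreg 3 ∧ t = 3 * (σ₀.wreg 3 - τ.wreg 31) ∧
        τ.wreg 7 = σ.wreg 7 + τ.wreg 31) _ ⟨by omega, rfl, by omega⟩ ?_ ?_) ?_
    · rintro t τ hf' ⟨hle', ht', h7'⟩ hb'
      have e7 : τ.wreg 3 = σ₀.wreg 3 := (hf'.wreg 3 (by decide)).trans e4
      simp only [Test.holds, e7] at hb'
      refine Runs.ops fun ρ hρ => ⟨3 * (σ₀.wreg 3 - ρ.wreg 31), ?_⟩
      have r7 : ρ.wreg 7 = τ.wreg 7 + 1 := by simp [hρ, Instr.effect]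
      have r31 : ρ.wreg 31 = τ.wreg 31 + 1 := by simp [hρ, Instr.effect]
      exact ⟨⟨by omega, rfl, by omega⟩, by simp only [List.length]; omega⟩
    · rintro k t τ hf' ⟨hle', ht', h7'⟩ hb' hk
      have e7 : τ.wreg 3 = σ₀.wreg 3 := (hf'.wreg 3 (by decide)).trans e4
      simp only [Test.holds, e7] at hb'
      omega
    · rintro k₂ σ₂ hf₂ ⟨hk₂, h72⟩
      have e8 : σ₂.wreg 10 = σ.wreg 10 := (hf₂.wreg 10 (by decide)).trans e6
      refine Runs.ops fun ρ hρ => ⟨(σ₀.wreg 2 - ρ.wreg 10) * (3 * σ₀.wreg 3 + 4), ?_⟩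
      have r7 : ρ.wreg 7 = σ₂.wreg 7 := by simp [hρ, Instr.effect]
      have r10 : ρ.wreg 10 = σ.wreg 10 + 1 := by simp [hρ, Instr.effect, e8]
      refine ⟨⟨by omega, rfl, ?_⟩, ?_⟩
      · rw [r7, h72, h7, r10]; ring
      · obtain ⟨d, hd⟩ := Nat.exists_eq_add_of_lt hb
        rw [ht, r10, hd, show σ.wreg 10 + d + 1 - (σ.wreg 10 + 1) = d by omega,
          show σ.wreg 10 + d + 1 - σ.wreg 10 = d + 1 by omega]
        simp only [List.length, add_mul, one_mul]
        omega
  · rintro k t τ hf ⟨hle, ht, h7⟩ hb hk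
    have e2 : τ.wreg 2 = σ₀.wreg 2 := hf.wreg 2 (by decide)
    simp only [Test.holds, e2] at hb
    have : τ.wreg 10 = σ₀.wreg 2 := by omega
    rw [this] at h7
    rw [h10, Nat.sub_zero] at hk
    exact ⟨by omega, h7⟩

theorem runs_nodeLoop {σ₀ : Memory} {b : ℕ} (hb : b ∉ [5, 23]) (hle : σ₀.wreg 23 ≤ σ₀.wreg b) :
    Runs (nodeLoop b) σ₀ fun k τ => k ≤ 4 * (σ₀.wreg b - σ₀.wreg 23) + 1 ∧
      τ.wreg 5 = σ₀.wreg 5 + (σ₀.wreg b - σ₀.wreg 23) ∧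
      (∀ i < σ₀.wreg 5, τ.warr 10 i = σ₀.warr 10 i) ∧
      Segment (τ.warr 10) (σ₀.wreg 5)
        (List.range' (σ₀.wreg 23) (σ₀.wreg b - σ₀.wreg 23)) := by
  refine Runs.loop (fun t σ => σ₀.wreg 23 ≤ σ.wreg 23 ∧ σ.wreg 23 ≤ σ₀.wreg b ∧
      t = 4 * (σ₀.wreg b - σ.wreg 23) ∧ σ.wreg 5 = σ₀.wreg 5 + (σ.wreg 23 - σ₀.wreg 23) ∧
      (∀ i < σ₀.wreg 5, σ.warr 10 i = σ₀.warr 10 i) ∧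
      Segment (σ.warr 10) (σ₀.wreg 5) (List.range' (σ₀.wreg 23) (σ.wreg 23 - σ₀.wreg 23))) _
    ⟨le_rfl, hle, rfl, by omega, fun _ _ => rfl, by simp [Segment]⟩ ?_ ?_
  · rintro t σ hf ⟨hle1, hle2, ht, h5, hold, hseg⟩ hb'
    have e1 : σ.wreg b = σ₀.wreg b :=
      hf.wreg b (by simpa [ops, Program.instrs, Instr.wregs] using hb)
    simp only [Test.holds, e1] at hb'
    refine Runs.ops fun τ hτ => ⟨4 * (σ₀.wreg b - τ.wreg 23), ?_⟩
    have t5 : τ.wreg 5 = σ.wreg 5 + 1 := by simp [hτ, Instr.effect]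
    have t23 : τ.wreg 23 = σ.wreg 23 + 1 := by simp [hτ, Instr.effect]
    have tR : τ.warr 10 = Function.update (σ.warr 10) (σ.wreg 5) (σ.wreg 23) := by
      simp [hτ, Instr.effect]
    clear hτ
    refine ⟨⟨by omega, by omega, rfl, by omega, ?_, ?_⟩, by simp only [List.length]; omega⟩
    · intro i hi
      rw [tR, Function.update_of_ne (by omega), hold i hi]
    · rw [t23, show σ.wreg 23 + 1 - σ₀.wreg 23 = σ.wreg 23 - σ₀.wreg 23 + 1 by omega,
        List.range'_concat, segment_append, tR]
      refine ⟨hseg.update (by simp; omega), ?_⟩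
      rw [List.length_range', ← h5]
      exact ⟨by simp; omega, trivial⟩
  · rintro k t τ hf ⟨hle1, hle2, ht, h5, hold, hseg⟩ hb' hk
    have e1 : τ.wreg b = σ₀.wreg b :=
      hf.wreg b (by simpa [ops, Program.instrs, Instr.wregs] using hb)
    simp only [Test.holds, e1] at hb'
    have : τ.wreg 23 = σ₀.wreg b := by omega
    rw [this] at h5 hseg
    exact ⟨by omega, h5, hold, hseg⟩

end FlowDecomp

namespace FlowDecomp

/-! ### Adjacency lists -/

/-- For each node `v` in `V`, the lists `O v` and `I v` of arcs leaving and entering `v` are stored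
in the memory. The arcs are among the first `N` ones, and there are no loops. -/
structure Lists (V : Finset ℕ) (N : ℕ) (σ : Memory) (O I : ℕ → List ℕ) : Prop where
  out : ∀ v ∈ V, Chained (σ.warr 6) (σ.warr 5 v) (O v)
  inn : ∀ v ∈ V, Chained (σ.warr 8) (σ.warr 7 v) (I v)
  out_mem : ∀ v ∈ V, ∀ e ∈ O v, e < N ∧ σ.warr 0 e = v ∧ σ.warr 1 e ≠ v
  inn_mem : ∀ v ∈ V, ∀ e ∈ I v, e < N ∧ σ.warr 1 e = v ∧ σ.warr 0 e ≠ v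
  nodup : ∀ v ∈ V, (O v).Nodup

/-- The effect of `push`. -/
structure Pushed (σ τ : Memory) : Prop where
  frame : Frame push σ τ
  out : τ.warr 5 = Function.update (σ.warr 5) (σ.wreg 11) (σ.wreg 13 + 1)
  out_next : τ.warr 6 = Function.update (σ.warr 6) (σ.wreg 13) (σ.warr 5 (σ.wreg 11))
  inn : τ.warr 7 = Function.update (σ.warr 7) (σ.wreg 12) (σ.wreg 13 + 1)
  inn_next : τ.warr 8 = Function.update (σ.warr 8) (σ.wreg 13) (σ.warr 7 (σ.wreg 12))
  len : τ.warr 9 = Function.update (Function.update (σ.warr 9) (σ.wreg 11)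
    (σ.warr 9 (σ.wreg 11) + 1)) (σ.wreg 12) (Function.update (σ.warr 9) (σ.wreg 11)
    (σ.warr 9 (σ.wreg 11) + 1) (σ.wreg 12) + 1)

theorem runs_push {σ : Memory} {Q : ℕ → Memory → Prop} (h : ∀ τ, Pushed σ τ → Q 14 τ) :
    Runs push σ Q := by
  refine Runs.ops_frame fun τ hf hτ => h τ ⟨hf, ?_, ?_, ?_, ?_, ?_⟩ <;>
  · rw [hτ]; simp [Instr.effect]

theorem Pushed.len_apply {σ τ : Memory} (h : Pushed σ τ) (v : ℕ) : τ.warr 9 v = σ.warr 9 v +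
    (if v = σ.wreg 11 then 1 else 0) + (if v = σ.wreg 12 then 1 else 0) := by
  rw [h.len]
  simp only [Function.update_apply]
  grind

theorem Pushed.sum_len {σ τ : Memory} (h : Pushed σ τ) (V : Finset ℕ) :
    ∑ v ∈ V, τ.warr 9 v = ∑ v ∈ V, σ.warr 9 v + (if σ.wreg 11 ∈ V then 1 else 0) +
      (if σ.wreg 12 ∈ V then 1 else 0) := by
  simp only [h.len_apply, Finset.sum_add_distrib, Finset.sum_ite_eq']

theorem Lists.push {V : Finset ℕ} {N N' : ℕ} {σ τ : Memory} {O I : ℕ → List ℕ}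
    (h : Lists V N σ O I) (hτ : Pushed σ τ) (hN : N ≤ N') (he : σ.wreg 13 < N')
    (hO : ∀ v ∈ V, σ.wreg 13 ∉ O v) (hI : ∀ v ∈ V, σ.wreg 13 ∉ I v)
    (ht : σ.warr 0 (σ.wreg 13) = σ.wreg 11) (hh : σ.warr 1 (σ.wreg 13) = σ.wreg 12)
    (hne : σ.wreg 11 ≠ σ.wreg 12) :
    Lists V N' τ (Function.update O (σ.wreg 11) (σ.wreg 13 :: O (σ.wreg 11)))
      (Function.update I (σ.wreg 12) (σ.wreg 13 :: I (σ.wreg 12))) := by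
  have e0 : τ.warr 0 = σ.warr 0 := hτ.frame.warr 0 (by decide)
  have e1 : τ.warr 1 = σ.warr 1 := hτ.frame.warr 1 (by decide)
  refine ⟨?_, ?_, ?_, ?_, ?_⟩
  · intro v hv
    rw [hτ.out, hτ.out_next]
    by_cases hvu : v = σ.wreg 11
    · subst hvu
      simpa using (h.out _ hv).push (hO _ hv)
    · simpa [hvu] using (h.out _ hv).update (hO _ hv)
  · intro v hv
    rw [hτ.inn, hτ.inn_next]
    by_cases hvu : v = σ.wreg 12
    · subst hvu
      simpa using (h.inn _ hv).push (hI _ hv)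
    · simpa [hvu] using (h.inn _ hv).update (hI _ hv)
  · intro v hv e hev
    rw [e0, e1]
    by_cases hvu : v = σ.wreg 11
    · subst hvu
      rw [Function.update_self, List.mem_cons] at hev
      rcases hev with rfl | hev
      · exact ⟨he, ht, by rw [hh]; exact hne.symm⟩
      · have := h.out_mem _ hv e hev
        exact ⟨this.1.trans_le hN, this.2⟩
    · rw [Function.update_of_ne hvu] at hev
      have := h.out_mem _ hv e hev
      exact ⟨this.1.trans_le hN, this.2⟩
  · intro v hv e hev
    rw [e0, e1]
    by_cases hvu : v = σ.wreg 12
    · subst hvu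
      rw [Function.update_self, List.mem_cons] at hev
      rcases hev with rfl | hev
      · exact ⟨he, hh, by rw [ht]; exact hne⟩
      · have := h.inn_mem _ hv e hev
        exact ⟨this.1.trans_le hN, this.2⟩
    · rw [Function.update_of_ne hvu] at hev
      have := h.inn_mem _ hv e hev
      exact ⟨this.1.trans_le hN, this.2⟩
  · intro v hv
    by_cases hvu : v = σ.wreg 11
    · subst hvu
      rw [Function.update_self]
      exact List.nodup_cons.2 ⟨hO _ hv, h.nodup _ hv⟩
    · rw [Function.update_of_ne hvu]; exact h.nodup _ hv

theorem Lists.congr {V : Finset ℕ} {N N' : ℕ} {σ τ : Memory} {O I : ℕ → List ℕ}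
    (h : Lists V N σ O I) (hN : N ≤ N') (h0 : ∀ e < N, τ.warr 0 e = σ.warr 0 e)
    (h1 : ∀ e < N, τ.warr 1 e = σ.warr 1 e) (h5 : τ.warr 5 = σ.warr 5)
    (h6 : τ.warr 6 = σ.warr 6) (h7 : τ.warr 7 = σ.warr 7) (h8 : τ.warr 8 = σ.warr 8) :
    Lists V N' τ O I where
  out v hv := by rw [h5, h6]; exact h.out v hv
  inn v hv := by rw [h7, h8]; exact h.inn v hv
  out_mem v hv e he := by
    obtain ⟨h2, h3⟩ := h.out_mem v hv e he
    rw [h0 e h2, h1 e h2]; exact ⟨h2.trans_le hN, h3⟩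
  inn_mem v hv e he := by
    obtain ⟨h2, h3⟩ := h.inn_mem v hv e he
    rw [h0 e h2, h1 e h2]; exact ⟨h2.trans_le hN, h3⟩
  nodup := h.nodup

theorem Lists.mono {V V' : Finset ℕ} {N : ℕ} {σ : Memory} {O I : ℕ → List ℕ}
    (h : Lists V N σ O I) (hV : V' ⊆ V) : Lists V' N σ O I :=
  ⟨fun v hv => h.out v (hV hv), fun v hv => h.inn v (hV hv), fun v hv => h.out_mem v (hV hv),
    fun v hv => h.inn_mem v (hV hv), fun v hv => h.nodup v (hV hv)⟩

theorem Pushed.mem {σ τ : Memory} (_ : Pushed σ τ) {O : ℕ → List ℕ} {u e v x : ℕ}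
    (h : x ∈ O v) : x ∈ Function.update O u (e :: O u) v := by
  by_cases hv : v = u
  · subst hv; simp [h]
  · rwa [Function.update_of_ne hv]

theorem length_update_cons (O : ℕ → List ℕ) (u e v : ℕ) :
    (Function.update O u (e :: O u) v).length = (O v).length + if v = u then 1 else 0 := by
  by_cases hv : v = u
  · subst hv; simp
  · simp [hv]

/-- After the setup. -/
theorem runs_insertLoop {σ₀ : Memory} (V : Finset ℕ) (h13 : σ₀.wreg 13 = 0)
    (h5 : ∀ v, σ₀.warr 5 v = 0) (h7 : ∀ v, σ₀.warr 7 v = 0) (h9 : ∀ v, σ₀.warr 9 v = 0) :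
    Runs insertLoop σ₀ fun k τ => k ≤ 19 * σ₀.wreg 4 + 1 ∧ ∃ O I,
      Lists V (σ₀.wreg 4) τ O I ∧
      (∀ e < σ₀.wreg 4, σ₀.warr 0 e ≠ σ₀.warr 1 e →
        e ∈ O (σ₀.warr 0 e) ∧ e ∈ I (σ₀.warr 1 e)) ∧
      (∀ v, (O v).length + (I v).length = τ.warr 9 v) ∧
      ∑ v ∈ V, τ.warr 9 v ≤ 2 * σ₀.wreg 4 := by
  refine Runs.loop (fun t σ => σ.wreg 13 ≤ σ₀.wreg 4 ∧ t = 19 * (σ₀.wreg 4 - σ.wreg 13) ∧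
    ∃ O I, Lists V (σ.wreg 13) σ O I ∧
      (∀ e < σ.wreg 13, σ₀.warr 0 e ≠ σ₀.warr 1 e →
        e ∈ O (σ₀.warr 0 e) ∧ e ∈ I (σ₀.warr 1 e)) ∧
      (∀ v, (O v).length + (I v).length = σ.warr 9 v) ∧
      ∑ v ∈ V, σ.warr 9 v ≤ 2 * σ.wreg 13) _
    ⟨by omega, rfl, fun _ => [], fun _ => [], ⟨fun v _ => h5 v, fun v _ => h7 v, by simp,
      by simp, by simp⟩, by omega, by simp [h9], by simp [h9]⟩ ?_ ?_
  · rintro t σ hf ⟨hle, ht, O, I, hL, hcov, hlen, hsum⟩ hb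
    have e4 : σ.wreg 4 = σ₀.wreg 4 := hf.wreg 4 (by decide)
    have e0 : σ.warr 0 = σ₀.warr 0 := hf.warr 0 (by decide)
    have e1 : σ.warr 1 = σ₀.warr 1 := hf.warr 1 (by decide)
    simp only [Test.holds, e4] at hb
    refine Runs.seq (R := fun k τ => k = 2 ∧ τ.wreg 11 = σ₀.warr 0 (σ.wreg 13) ∧
      τ.wreg 12 = σ₀.warr 1 (σ.wreg 13))
      (Runs.ops fun τ hτ => ⟨rfl, by simp [hτ, Instr.effect, e0],
        by simp [hτ, Instr.effect, e1]⟩) ?_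
    rintro k₁ σ₁ hf₁ ⟨rfl, h11, h12⟩
    have f13 : σ₁.wreg 13 = σ.wreg 13 := hf₁.wreg 13 (by decide)
    have f0 : σ₁.warr 0 = σ₀.warr 0 := (hf₁.warr 0 (by decide)).trans e0
    have f1 : σ₁.warr 1 = σ₀.warr 1 := (hf₁.warr 1 (by decide)).trans e1
    have f5 : σ₁.warr 5 = σ.warr 5 := hf₁.warr 5 (by decide)
    have f6 : σ₁.warr 6 = σ.warr 6 := hf₁.warr 6 (by decide)
    have f7 : σ₁.warr 7 = σ.warr 7 := hf₁.warr 7 (by decide)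
    have f8 : σ₁.warr 8 = σ.warr 8 := hf₁.warr 8 (by decide)
    have f9 : σ₁.warr 9 = σ.warr 9 := hf₁.warr 9 (by decide)
    have hL₁ : Lists V (σ.wreg 13) σ₁ O I :=
      hL.congr le_rfl (by simp [f0, e0]) (by simp [f1, e1]) f5 f6 f7 f8
    refine Runs.seq (R := fun k τ => k ≤ 15 ∧ τ.wreg 13 = σ.wreg 13 ∧ ∃ O I,
      Lists V (σ.wreg 13 + 1) τ O I ∧
      (∀ e < σ.wreg 13 + 1, σ₀.warr 0 e ≠ σ₀.warr 1 e →
        e ∈ O (σ₀.warr 0 e) ∧ e ∈ I (σ₀.warr 1 e)) ∧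
      (∀ v, (O v).length + (I v).length = τ.warr 9 v) ∧
      ∑ v ∈ V, τ.warr 9 v ≤ 2 * (σ.wreg 13 + 1)) (Runs.branch ?_ ?_) ?_
    · intro hb1
      refine Runs.skip ⟨by omega, f13, O, I, hL₁.congr (by omega) (fun _ _ => rfl)
        (fun _ _ => rfl) rfl rfl rfl rfl, ?_, by simpa [f9] using hlen, by rw [f9]; omega⟩
      intro e he hne
      simp only [Test.holds, h11, h12] at hb1
      have : e ≠ σ.wreg 13 := fun h => hne (h ▸ hb1)
      exact hcov e (by omega) hne
    · intro hb1
      simp only [Test.holds, h11, h12] at hb1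
      refine runs_push fun τ hτ => ⟨le_rfl, (hτ.frame.wreg 13 (by decide)).trans f13, _, _,
        hL₁.push hτ (Nat.le_succ _) (by omega) ?_ ?_ (by rw [h11, f0, f13]) (by rw [h12, f1, f13])
          (by rwa [h11, h12]), ?_, ?_, ?_⟩
      · intro v hv h
        have := (hL₁.out_mem v hv _ h).1; omega
      · intro v hv h
        have := (hL₁.inn_mem v hv _ h).1; omega
      · intro e he hne
        by_cases h : e = σ.wreg 13
        · simp [h, h11, h12, f13]
        · have := hcov e (by omega) hne
          exact ⟨hτ.mem this.1, hτ.mem this.2⟩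
      · intro v
        rw [length_update_cons, length_update_cons, hτ.len_apply, f9, ← hlen]
        omega
      · rw [hτ.sum_len, f9]
        split_ifs <;> omega
    · rintro k₂ σ₂ hf₂ ⟨hk₂, g13, O', I', hL', hcov', hlen', hsum'⟩
      refine Runs.ops fun τ hτ => ⟨19 * (σ₀.wreg 4 - τ.wreg 13), ?_⟩
      have t13 : τ.wreg 13 = σ.wreg 13 + 1 := by simp [hτ, Instr.effect, g13]
      have tw : τ.warr = σ₂.warr := by simp [hτ, Instr.effect]
      refine ⟨⟨by omega, rfl, O', I', ?_, ?_, ?_, ?_⟩, by simp only [List.length]; omega⟩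
      · rw [t13]
        exact hL'.congr le_rfl (by simp [tw]) (by simp [tw]) (by rw [tw]) (by rw [tw])
          (by rw [tw]) (by rw [tw])
      · rwa [t13]
      · rwa [tw]
      · rwa [tw, t13]
  · rintro k t τ hf ⟨hle, ht, O, I, hL, hcov, hlen, hsum⟩ hb hk
    have e4 : τ.wreg 4 = σ₀.wreg 4 := hf.wreg 4 (by decide)
    simp only [Test.holds, e4] at hb
    have : τ.wreg 13 = σ₀.wreg 4 := by omega
    rw [this] at hL hcov hsum
    exact ⟨by omega, O, I, hL, hcov, hlen, hsum⟩

end FlowDecomp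

/-! ### The invariant between phases, and the setup that establishes it -/

namespace FlowDecomp

/-- Every nonzero arc other than a loop joins nodes in `V` and occurs in their lists. -/
def Covers (V : Finset ℕ) (σ : Memory) (O I : ℕ → List ℕ) : Prop :=
  ∀ e < σ.wreg 4, σ.xarr 0 e ≠ 0 → σ.warr 0 e ≠ σ.warr 1 e →
    σ.warr 0 e ∈ V ∧ σ.warr 1 e ∈ V ∧ e ∈ O (σ.warr 0 e) ∧ e ∈ I (σ.warr 1 e)

/-- The nodes that are never eliminated. -/
def terminals (n p q : ℕ) : List ℕ := List.range' n (p + q)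

/-- The nodes present when the inner nodes in `L` remain. -/
def present (n p q : ℕ) (L : List ℕ) : Finset ℕ := (terminals n p q ++ L).toFinset

/-- The state between two phases, when the inner nodes in `L` remain. -/
structure Ready (n p q N₀ : ℕ) (A : AddSubgroup ℝ) (F₀ : ℕ → ℝ) (σ : Memory) (L : List ℕ)
    (O I : ℕ → List ℕ) : Prop where
  derives : Derives n p q N₀ A σ.history F₀ (σ.wreg 4) (σ.xarr 0)
  nodes : Segment (σ.warr 10) 0 (terminals n p q ++ L)
  count : σ.wreg 5 = p + q + L.length
  terminals : σ.wreg 6 = p + q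
  wzero : σ.wreg 9 = 0
  xzero : σ.xreg 0 = 0
  nodup : L.Nodup
  lt : ∀ v ∈ L, v < n
  lists : Lists (present n p q L) (σ.wreg 4) σ O I
  covers : Covers (present n p q L) σ O I
  len : ∀ v ∈ present n p q L, (O v).length + (I v).length ≤ σ.warr 9 v

theorem toArray_apply {α : Type} [Zero α] {l : ℕ} (g : Fin l → α) (i : Fin l) :
    toArray g i = g i := by
  simp [toArray, i.2]

-- Combines the loops of the setup; most of the work is carrying values through frames. The number
-- array `1` must still be zero because the final assignment writes only the cells of matching
-- commodities. The bound on the sum of the degree counters is the initial value that enters the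
-- potential.
set_option maxHeartbeats 1000000 in
theorem runs_setup {n m p q : ℕ} (G : Digraph n m) (s : Fin p → Fin n) (t : Fin q → Fin n)
    (f : Fin m → ℝ) (A : AddSubgroup ℝ) (hp : 0 < p) (hs : Function.Injective s)
    (ht : Function.Injective t) (hst : Disjoint (Set.range s) (Set.range t))
    (hf : G.IsFlow (Set.range s) (Set.range t) f) (hA : ∀ e, f e ∈ A) :
    Runs setup (inputMemory G s t f) fun k τ =>
      k ≤ 50 * (m + n + p * q + p + q + 1) ∧ τ.wreg 0 = n ∧ τ.wreg 26 = n + p ∧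
      τ.wreg 27 = n + p + q ∧ τ.wreg 7 = p * q ∧ τ.wreg 8 = m + p + q ∧ (∀ e, τ.xarr 1 e = 0) ∧
      τ.history.Extends G s t ∧ (∀ e : Fin m, τ.xarr 0 e = f e) ∧ τ.wreg 4 = m + p + q ∧
      ∃ O I, Ready n p q (m + p + q) A (τ.xarr 0) τ (List.range n) O I ∧
        ∑ v ∈ present n p q (List.range n), τ.warr 9 v ≤ 2 * (m + p + q) := by
  have hn : 0 < n := (s ⟨0, hp⟩).pos
  set σ := inputMemory G s t f with hσ
  -- the divergences
  refine Runs.seq (runs_divergenceLoop rfl fun _ => rfl) ?_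
  rintro k₁ σ₁ hf₁ ⟨hk₁, hdiv⟩
  have hdiv' : ∀ v : Fin n, σ₁.xarr 3 v = G.divergence f v := by
    intro v
    rw [hdiv, Digraph.divergence_eq_sum]
    change ∑ e ∈ Finset.range m, _ = _
    rw [Finset.sum_range]
    refine Finset.sum_congr rfl fun e _ => ?_
    change toArray f e * ((if toArray (fun e => (G.tail e : ℕ)) e = v then 1 else 0) -
      (if toArray (fun e => (G.head e : ℕ)) e = v then 1 else 0)) = _
    simp only [toArray_apply, Fin.val_inj]
  refine Runs.seq (R := fun k τ => k = 3 ∧ τ.wreg 4 = σ₁.wreg 1 ∧ τ.wreg 27 = σ₁.wreg 0 ∧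
    τ.wreg 10 = 0) (Runs.ops fun τ hτ => ⟨rfl, by simp [hτ, Instr.effect],
    by simp [hτ, Instr.effect], by simp [hτ, Instr.effect]⟩) ?_
  rintro k₂ σ₂ hf₂ ⟨rfl, h₂4, h₂27, h₂10⟩
  rw [hf₁.wreg 1 (by decide)] at h₂4
  rw [hf₁.wreg 0 (by decide)] at h₂27
  change σ₂.wreg 4 = m at h₂4
  change σ₂.wreg 27 = n at h₂27
  -- the arcs to the sources
  refine Runs.seq (runs_sourceLoop h₂10) ?_
  have h₂2 : σ₂.wreg 2 = p := (hf₂.wreg 2 (by decide)).trans (hf₁.wreg 2 (by decide))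
  rw [h₂2, h₂4, h₂27]
  rintro k₃ σ₃ hf₃ ⟨hk₃, h₃4, h₃27, hold₃, hnew₃⟩
  refine Runs.seq (R := fun k τ => k = 2 ∧ τ.wreg 26 = n + p ∧ τ.wreg 10 = 0)
    (Runs.ops fun τ hτ => ⟨rfl, by simp [hτ, Instr.effect, h₃27],
    by simp [hτ, Instr.effect]⟩) ?_
  rintro k₄ σ₄ hf₄ ⟨rfl, h₄26, h₄10⟩
  have h₄4 : σ₄.wreg 4 = m + p := (hf₄.wreg 4 (by decide)).trans h₃4
  have h₄27 : σ₄.wreg 27 = n + p := (hf₄.wreg 27 (by decide)).trans h₃27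
  have h₄3 : σ₄.wreg 3 = q := (hf₄.wreg 3 (by decide)).trans <| (hf₃.wreg 3 (by decide)).trans <|
    (hf₂.wreg 3 (by decide)).trans (hf₁.wreg 3 (by decide))
  have h₄x : σ₄.xreg 0 = 0 := (hf₄.xreg 0 (by decide)).trans <| (hf₃.xreg 0 (by decide)).trans <|
    (hf₂.xreg 0 (by decide)).trans (hf₁.xreg 0 (by decide))
  -- the arcs from the sinks
  refine Runs.seq (runs_sinkLoop h₄10 h₄x) ?_
  rw [h₄3, h₄4, h₄27]
  rintro k₅ σ₅ hf₅ ⟨hk₅, h₅4, h₅27, hold₅, hnew₅⟩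
  refine Runs.seq (R := fun k τ => k = 2 ∧ τ.wreg 8 = m + p + q ∧ τ.wreg 10 = 0)
    (Runs.ops fun τ hτ => ⟨rfl, by simp [hτ, Instr.effect, h₅4],
    by simp [hτ, Instr.effect]⟩) ?_
  rintro k₆ σ₆ hf₆ ⟨rfl, h₆8, h₆10⟩
  have h₆7 : σ₆.wreg 7 = 0 := (hf₆.wreg 7 (by decide)).trans <| (hf₅.wreg 7 (by decide)).trans <|
    (hf₄.wreg 7 (by decide)).trans <| (hf₃.wreg 7 (by decide)).trans <|
    (hf₂.wreg 7 (by decide)).trans (hf₁.wreg 7 (by decide))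
  have h₆2 : σ₆.wreg 2 = p := (hf₆.wreg 2 (by decide)).trans <| (hf₅.wreg 2 (by decide)).trans <|
    (hf₄.wreg 2 (by decide)).trans <| (hf₃.wreg 2 (by decide)).trans h₂2
  have h₆3 : σ₆.wreg 3 = q := (hf₆.wreg 3 (by decide)).trans <|
    (hf₅.wreg 3 (by decide)).trans h₄3
  refine Runs.seq (runs_productLoop h₆10 h₆7) ?_
  rw [h₆2, h₆3]
  rintro k₇ σ₇ hf₇ ⟨hk₇, h₇7⟩
  have h₇0 : σ₇.wreg 0 = n := (hf₇.wreg 0 (by decide)).trans <| (hf₆.wreg 0 (by decide)).trans <|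
    (hf₅.wreg 0 (by decide)).trans <|
    (hf₄.wreg 0 (by decide)).trans <| (hf₃.wreg 0 (by decide)).trans <|
    (hf₂.wreg 0 (by decide)).trans (hf₁.wreg 0 (by decide))
  refine Runs.seq (R := fun k τ => k = 1 ∧ τ.wreg 23 = n)
    (Runs.ops fun τ hτ => ⟨rfl, by simp [hτ, Instr.effect, h₇0]⟩) ?_
  rintro k₈ σ₈ hf₈ ⟨rfl, h₈23⟩
  have h₈27 : σ₈.wreg 27 = n + p + q := (hf₈.wreg 27 (by decide)).trans <|
    (hf₇.wreg 27 (by decide)).trans <| (hf₆.wreg 27 (by decide)).trans h₅27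
  have h₈5 : σ₈.wreg 5 = 0 := (hf₈.wreg 5 (by decide)).trans <| (hf₇.wreg 5 (by decide)).trans <|
    (hf₆.wreg 5 (by decide)).trans <| (hf₅.wreg 5 (by decide)).trans <|
    (hf₄.wreg 5 (by decide)).trans <| (hf₃.wreg 5 (by decide)).trans <|
    (hf₂.wreg 5 (by decide)).trans (hf₁.wreg 5 (by decide))
  -- the list of the nodes
  refine Runs.seq (runs_nodeLoop (b := 27) (by decide) (by omega)) ?_
  rw [h₈27, h₈23, h₈5, show n + p + q - n = p + q by omega]
  rintro k₉ σ₉ hf₉ ⟨hk₉, h₉5, -, hseg₉⟩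
  refine Runs.seq (R := fun k τ => k = 2 ∧ τ.wreg 6 = p + q ∧ τ.wreg 23 = 0)
    (Runs.ops fun τ hτ => ⟨rfl, by simp [hτ, Instr.effect, h₉5],
    by simp [hτ, Instr.effect]⟩) ?_
  rintro k₁₀ σ₁₀ hf₁₀ ⟨rfl, h₁₀6, h₁₀23⟩
  have h₁₀5 : σ₁₀.wreg 5 = p + q := (hf₁₀.wreg 5 (by decide)).trans (h₉5.trans (by omega))
  have h₁₀0 : σ₁₀.wreg 0 = n := (hf₁₀.wreg 0 (by decide)).trans <|
    (hf₉.wreg 0 (by decide)).trans <| (hf₈.wreg 0 (by decide)).trans h₇0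
  refine Runs.seq (runs_nodeLoop (b := 0) (by decide) (by omega)) ?_
  rw [h₁₀5, h₁₀0, h₁₀23, Nat.sub_zero]
  rintro k₁₁ σ₁₁ hf₁₁ ⟨hk₁₁, h₁₁5, hold₁₁, hseg₁₁⟩
  refine Runs.seq (R := fun k τ => k = 1 ∧ τ.wreg 13 = 0)
    (Runs.ops fun τ hτ => ⟨rfl, by simp [hτ, Instr.effect]⟩) ?_
  rintro k₁₂ σ₁₂ hf₁₂ ⟨rfl, h₁₂13⟩
  have hwarr : ∀ a, a ∉ [0, 1, 10] → σ₁₂.warr a = σ.warr a := by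
    intro a ha
    simp only [List.mem_cons, List.not_mem_nil, or_false, not_or] at ha
    have hx : ∀ {P : Program} {σ τ : Memory}, Frame P σ τ →
        (∀ b ∈ P.instrs.flatMap Instr.warrs, b ∈ [0, 1, 10]) → τ.warr a = σ.warr a := by
      intro P σ τ hf hP
      refine hf.warr a fun hmem => ?_
      have := hP a hmem
      simp only [List.mem_cons, List.not_mem_nil, or_false] at this
      omega
    rw [hx hf₁₂ (by decide), hx hf₁₁ (by decide), hx hf₁₀ (by decide), hx hf₉ (by decide),
      hx hf₈ (by decide), hx hf₇ (by decide), hx hf₆ (by decide), hx hf₅ (by decide),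
      hx hf₄ (by decide), hx hf₃ (by decide), hx hf₂ (by decide), hx hf₁ (by decide)]
  have h₁₂4 : σ₁₂.wreg 4 = m + p + q := (hf₁₂.wreg 4 (by decide)).trans <|
    (hf₁₁.wreg 4 (by decide)).trans <| (hf₁₀.wreg 4 (by decide)).trans <|
    (hf₉.wreg 4 (by decide)).trans <| (hf₈.wreg 4 (by decide)).trans <|
    (hf₇.wreg 4 (by decide)).trans <| (hf₆.wreg 4 (by decide)).trans h₅4
  -- the lists of the arcs
  refine (runs_insertLoop (present n p q (List.range n)) h₁₂13
    (fun v => by rw [hwarr 5 (by decide)]; rfl) (fun v => by rw [hwarr 7 (by decide)]; rfl)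
    (fun v => by rw [hwarr 9 (by decide)]; rfl)).mono ?_
  rw [h₁₂4]
  rintro k₁₃ τ hf₁₃ ⟨hk₁₃, O, I, hL, hcov, hlen, hsum⟩
  have hw : ∀ a, a ∉ [4, 5, 6, 7, 8, 9, 10, 11, 12, 13, 16, 23, 26, 27, 31] →
      τ.wreg a = σ.wreg a := by
    intro a ha
    have hx : ∀ {P : Program} {σ τ : Memory}, Frame P σ τ →
        (∀ b ∈ P.instrs.flatMap Instr.wregs,
          b ∈ [4, 5, 6, 7, 8, 9, 10, 11, 12, 13, 16, 23, 26, 27, 31]) → τ.wreg a = σ.wreg a :=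
      fun hf hP => hf.wreg a fun hmem => ha (hP a hmem)
    rw [hx hf₁₃ (by decide), hx hf₁₂ (by decide), hx hf₁₁ (by decide), hx hf₁₀ (by decide),
      hx hf₉ (by decide), hx hf₈ (by decide), hx hf₇ (by decide), hx hf₆ (by decide),
      hx hf₅ (by decide), hx hf₄ (by decide), hx hf₃ (by decide), hx hf₂ (by decide),
      hx hf₁ (by decide)]
  have e9 : τ.wreg 9 = 0 := (hf₁₃.wreg 9 (by decide)).trans <|
    (hf₁₂.wreg 9 (by decide)).trans <|
    (hf₁₁.wreg 9 (by decide)).trans <| (hf₁₀.wreg 9 (by decide)).trans <|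
    (hf₉.wreg 9 (by decide)).trans <| (hf₈.wreg 9 (by decide)).trans <|
    (hf₇.wreg 9 (by decide)).trans <| (hf₆.wreg 9 (by decide)).trans <|
    (hf₅.wreg 9 (by decide)).trans <|
    (hf₄.wreg 9 (by decide)).trans <| (hf₃.wreg 9 (by decide)).trans <|
    (hf₂.wreg 9 (by decide)).trans (hf₁.wreg 9 (by decide))
  have ex0 : τ.xreg 0 = 0 := (hf₁₃.xreg 0 (by decide)).trans <|
    (hf₁₂.xreg 0 (by decide)).trans <|
    (hf₁₁.xreg 0 (by decide)).trans <| (hf₁₀.xreg 0 (by decide)).trans <|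
    (hf₉.xreg 0 (by decide)).trans <| (hf₈.xreg 0 (by decide)).trans <|
    (hf₇.xreg 0 (by decide)).trans <| (hf₆.xreg 0 (by decide)).trans <|
    (hf₅.xreg 0 (by decide)).trans h₄x
  have h₅w : ∀ a < 2, τ.warr a = σ₅.warr a := by
    intro a ha
    have hx : ∀ {P : Program} {σ τ : Memory}, Frame P σ τ →
        (∀ b ∈ P.instrs.flatMap Instr.warrs, 2 ≤ b) → τ.warr a = σ.warr a :=
      fun hf hP => hf.warr a fun hmem => absurd (hP a hmem) (by omega)
    rw [hx hf₁₃ (by decide), hx hf₁₂ (by decide), hx hf₁₁ (by decide), hx hf₁₀ (by decide),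
      hx hf₉ (by decide), hx hf₈ (by decide), hx hf₇ (by decide), hx hf₆ (by decide)]
  have h₅x : τ.xarr 0 = σ₅.xarr 0 := (hf₁₃.xarr 0 (by decide)).trans <|
    (hf₁₂.xarr 0 (by decide)).trans <|
    (hf₁₁.xarr 0 (by decide)).trans <| (hf₁₀.xarr 0 (by decide)).trans <|
    (hf₉.xarr 0 (by decide)).trans <| (hf₈.xarr 0 (by decide)).trans <|
    (hf₇.xarr 0 (by decide)).trans (hf₆.xarr 0 (by decide))
  have h₄w : ∀ a < 2, σ₄.warr a = σ₃.warr a := by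
    intro a ha
    refine hf₄.warr a fun hmem => ?_
    have : ∀ b ∈ (ops [Instr.wcopy 26 27, Instr.wconst 10 0]).instrs.flatMap Instr.warrs,
        2 ≤ b := by
      decide
    exact absurd (this a hmem) (by omega)
  have h₄x' : σ₄.xarr 0 = σ₃.xarr 0 := hf₄.xarr 0 (by decide)
  have h₂w : ∀ a, σ₂.warr a = σ.warr a := by
    intro a
    rw [hf₂.warr a, hf₁.warr a] <;> simp [divergenceLoop, ops, Program.instrs, Instr.warrs]
  have h₂x : σ₂.xarr 0 = σ.xarr 0 := (hf₂.xarr 0 (by decide)).trans (hf₁.xarr 0 (by decide))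
  have h₂d : ∀ v : Fin n, σ₂.xarr 3 v = G.divergence f v := by
    intro v
    rw [hf₂.xarr 3 (by decide), hdiv']
  have h₄d : ∀ v : Fin n, σ₄.xarr 3 v = G.divergence f v := by
    intro v
    rw [hf₄.xarr 3 (by decide), hf₃.xarr 3 (by decide), h₂d]
  have h₄t : σ₄.warr 3 = toArray fun j => (t j : ℕ) := (hf₄.warr 3 (by decide)).trans <|
    (hf₃.warr 3 (by decide)).trans (h₂w 3)
  have hext : τ.history.Extends G s t := by
    refine ⟨?_, ?_, ?_, ?_, ?_, ?_⟩
    · intro e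
      have he := e.2
      change τ.warr 0 e = _
      rw [h₅w 0 (by omega), (hold₅ e (by omega)).1, h₄w 0 (by omega), (hold₃ e he).1, h₂w]
      exact toArray_apply (fun e => (G.tail e : ℕ)) e
    · intro e
      have he := e.2
      change τ.warr 1 e = _
      rw [h₅w 1 (by omega), (hold₅ e (by omega)).2.1, h₄w 1 (by omega), (hold₃ e he).2.1, h₂w]
      exact toArray_apply (fun e => (G.head e : ℕ)) e
    · intro i
      have hi := i.2
      change τ.warr 0 _ = _
      rw [h₅w 0 (by omega), (hold₅ _ (by omega)).1, h₄w 0 (by omega), (hnew₃ i hi).1]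
    · intro i
      have hi := i.2
      change τ.warr 1 _ = _
      rw [h₅w 1 (by omega), (hold₅ _ (by omega)).2.1, h₄w 1 (by omega), (hnew₃ i hi).2.1, h₂w]
      exact toArray_apply (fun i => (s i : ℕ)) i
    · intro j
      change τ.warr 0 _ = _
      rw [h₅w 0 (by omega), (hnew₅ j j.2).2.1, h₄t, toArray_apply]
    · intro j
      change τ.warr 1 _ = _
      rw [h₅w 1 (by omega), (hnew₅ j j.2).1]
  have hF : ∀ e : Fin m, τ.xarr 0 e = f e := by
    intro e
    have he := e.2
    rw [h₅x, (hold₅ e (by omega)).2.2, h₄x', (hold₃ e he).2.2, h₂x]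
    exact toArray_apply f e
  have hsane : Sane n p q (m + p + q) A τ.history (m + p + q) (τ.xarr 0) := by
    refine hext.sane hs ht hst hf hA hn hF ?_ ?_
    · intro i
      have hi := i.2
      rw [h₅x, (hold₅ _ (by omega)).2.2, h₄x', (hnew₃ i hi).2.2, h₂w]
      refine Eq.trans ?_ (h₂d (s i))
      exact congrArg _ (toArray_apply (fun i => (s i : ℕ)) i)
    · intro j
      rw [h₅x, (hnew₅ j j.2).2.2, h₄t, toArray_apply, h₄d]
  have hτ4 : τ.wreg 4 = m + p + q := (hf₁₃.wreg 4 (by decide)).trans h₁₂4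
  have hR : τ.warr 10 = σ₁₁.warr 10 :=
    (hf₁₃.warr 10 (by decide)).trans (hf₁₂.warr 10 (by decide))
  have htl : σ₁₂.warr 0 = τ.warr 0 := (hf₁₃.warr 0 (by decide)).symm
  have hhd : σ₁₂.warr 1 = τ.warr 1 := (hf₁₃.warr 1 (by decide)).symm
  rw [htl, hhd] at hcov
  refine ⟨?_, hw 0 (by decide), ?_, ?_, ?_, ?_, ?_, hext, hF, hτ4, O, I, ⟨?_, ?_, ?_, ?_, e9, ex0,
    List.nodup_range, fun v hv => List.mem_range.1 hv, ?_, ?_, fun v _ => (hlen v).le⟩, hsum⟩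
  · have hpq : p * (3 * q + 4) = 3 * (p * q) + 4 * p := by ring
    change k₁ ≤ 11 * m + 1 at hk₁
    rw [hpq] at hk₇
    omega
  · rw [← h₄26, hf₁₃.wreg 26 (by decide), hf₁₂.wreg 26 (by decide), hf₁₁.wreg 26 (by decide),
      hf₁₀.wreg 26 (by decide), hf₉.wreg 26 (by decide), hf₈.wreg 26 (by decide),
      hf₇.wreg 26 (by decide), hf₆.wreg 26 (by decide), hf₅.wreg 26 (by decide)]
  · rw [← h₈27, hf₁₃.wreg 27 (by decide), hf₁₂.wreg 27 (by decide), hf₁₁.wreg 27 (by decide),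
      hf₁₀.wreg 27 (by decide), hf₉.wreg 27 (by decide)]
  · rw [← h₇7, hf₁₃.wreg 7 (by decide), hf₁₂.wreg 7 (by decide), hf₁₁.wreg 7 (by decide),
      hf₁₀.wreg 7 (by decide), hf₉.wreg 7 (by decide), hf₈.wreg 7 (by decide)]
  · rw [← h₆8, hf₁₃.wreg 8 (by decide), hf₁₂.wreg 8 (by decide), hf₁₁.wreg 8 (by decide),
      hf₁₀.wreg 8 (by decide), hf₉.wreg 8 (by decide), hf₈.wreg 8 (by decide),
      hf₇.wreg 8 (by decide)]
  · intro e
    rw [hf₁₃.xarr 1 (by decide), hf₁₂.xarr 1 (by decide), hf₁₁.xarr 1 (by decide),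
      hf₁₀.xarr 1 (by decide), hf₉.xarr 1 (by decide), hf₈.xarr 1 (by decide),
      hf₇.xarr 1 (by decide), hf₆.xarr 1 (by decide), hf₅.xarr 1 (by decide),
      hf₄.xarr 1 (by decide), hf₃.xarr 1 (by decide), hf₂.xarr 1 (by decide),
      hf₁.xarr 1 (by decide)]
    rfl
  · rw [hτ4]; exact .base hsane
  · rw [hR, segment_append]
    have hlt : (terminals n p q).length = p + q := by simp [terminals]
    rw [hlt, zero_add, List.range_eq_range']
    refine ⟨?_, hseg₁₁⟩
    have : Segment (σ₁₀.warr 10) 0 (terminals n p q) := by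
      rw [hf₁₀.warr 10 (by decide)]; exact hseg₉
    exact this.congr fun i _ h2 => hold₁₁ i (by omega)
  · rw [hf₁₃.wreg 5 (by decide), hf₁₂.wreg 5 (by decide), h₁₁5, List.length_range]
  · rw [← h₁₀6, hf₁₃.wreg 6 (by decide), hf₁₂.wreg 6 (by decide), hf₁₁.wreg 6 (by decide)]
  · rw [hτ4]; exact hL
  · intro e he _ hne
    rw [hτ4] at he
    have h1 := hsane.tl_lt e he
    have h2 := hsane.hd_lt e he
    change τ.warr 0 e < n + p at h1
    change τ.warr 1 e < n ∨ _ ≤ τ.warr 1 e ∧ τ.warr 1 e < _ at h2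
    refine ⟨?_, ?_, hcov e he hne⟩ <;>
    · simp only [present, terminals, List.mem_toFinset, List.mem_append, List.mem_range'_1,
        List.mem_range]
      omega

end FlowDecomp

namespace FlowDecomp

/-! ### A phase: the preparations -/

/-- Only the lists of entering arcs and the counters are cleared; the old lists of leaving arcs are
still needed, since the rebuilding traverses them. -/
theorem runs_resetLoop {σ₀ : Memory} {l : List ℕ} (h10 : σ₀.wreg 10 = 0) (h9 : σ₀.wreg 9 = 0)
    (hl : Segment (σ₀.warr 10) 0 l) (h5 : σ₀.wreg 5 = l.length) :
    Runs resetLoop σ₀ fun k τ => k ≤ 5 * l.length + 1 ∧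
      ∀ v ∈ l, τ.warr 7 v = 0 ∧ τ.warr 9 v = 0 := by
  refine Runs.loop (fun t σ => ∃ l₁ l₂, l = l₁ ++ l₂ ∧ σ.wreg 10 = l₁.length ∧
    t = 5 * l₂.length ∧ ∀ v ∈ l₁, σ.warr 7 v = 0 ∧ σ.warr 9 v = 0) _
    ⟨[], l, rfl, h10, rfl, by simp⟩ ?_ ?_
  · rintro t σ hf ⟨l₁, l₂, rfl, h, rfl, hinv⟩ hb
    have e5 : σ.wreg 5 = σ₀.wreg 5 := hf.wreg 5 (by decide)
    have e9 : σ.wreg 9 = 0 := (hf.wreg 9 (by decide)).trans h9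
    have e10 : σ.warr 10 = σ₀.warr 10 := hf.warr 10 (by decide)
    simp only [Test.holds, e5, h5, h, List.length_append] at hb
    obtain _ | ⟨v, l₂⟩ := l₂
    · simp at hb
    have hv : σ.warr 10 (σ.wreg 10) = v := by
      rw [e10, h]
      simpa using (segment_append.1 hl).2.1
    refine Runs.ops fun τ hτ => ⟨5 * l₂.length, ⟨l₁ ++ [v], l₂, by simp, ?_, rfl, ?_⟩, ?_⟩
    · simp [hτ, Instr.effect, h]
    · have t7 : τ.warr 7 = Function.update (σ.warr 7) v 0 := by
        simp [hτ, Instr.effect, e9, hv]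
      have t9 : τ.warr 9 = Function.update (σ.warr 9) v 0 := by
        simp [hτ, Instr.effect, e9, hv]
      intro w hw
      rw [t7, t9]
      by_cases hwv : w = v
      · simp [hwv]
      · simp only [List.mem_append, List.mem_singleton, hwv, or_false] at hw
        simpa [hwv] using hinv w hw
    · simp only [List.length]; omega
  · rintro k t τ hf ⟨l₁, l₂, rfl, h, rfl, hinv⟩ hb hk
    have e5 : τ.wreg 5 = σ₀.wreg 5 := hf.wreg 5 (by decide)
    simp only [Test.holds, e5, h5, h, List.length_append] at hb
    obtain _ | ⟨v, l₂⟩ := l₂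
    · refine ⟨by simp at hk ⊢; omega, by simpa using hinv⟩
    · simp at hb

/-- The loop computes `4 * (M / i + 1)`, where `i` is the number of the remaining inner nodes. -/
theorem runs_thresholdLoop {σ₀ : Memory} {i M : ℕ} (h10 : σ₀.wreg 10 = 0) (h20 : σ₀.wreg 20 = M)
    (h21 : σ₀.wreg 21 = 4) (h22 : σ₀.wreg 22 = σ₀.wreg 6) (h5 : σ₀.wreg 5 = σ₀.wreg 6 + i)
    (hi : 0 < i) :
    Runs thresholdLoop σ₀ fun k τ => k ≤ 9 * M + 1 ∧ 4 * M ≤ τ.wreg 21 * i ∧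
      τ.wreg 21 * i ≤ 4 * M + 4 * i ∧ 0 < τ.wreg 21 := by
  refine Runs.loop (fun t σ => σ.wreg 10 ≤ M ∧ t = 9 * (M - σ.wreg 10) ∧
    -- `d` and `c` are the quotient and the remainder of the count by `i`.
    ∃ c d, σ.wreg 22 = σ.wreg 6 + c ∧ c < i ∧ σ.wreg 21 = 4 * (d + 1) ∧ σ.wreg 10 = d * i + c) _
    ⟨by omega, rfl, 0, 0, by omega, hi, h21, by omega⟩ ?_ ?_
  · rintro t σ hf ⟨hle, rfl, c, d, hc22, hci, hd21, hcd⟩ hb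
    have e5 : σ.wreg 5 = σ₀.wreg 5 := hf.wreg 5 (by decide)
    have e6 : σ.wreg 6 = σ₀.wreg 6 := hf.wreg 6 (by decide)
    have e20 : σ.wreg 20 = M := (hf.wreg 20 (by decide)).trans h20
    simp only [Test.holds, e20] at hb
    refine Runs.seq (R := fun k τ => k = 2 ∧ τ.wreg 10 = σ.wreg 10 + 1 ∧
      τ.wreg 22 = σ.wreg 22 + 1) (Runs.ops fun τ hτ => ⟨rfl, by simp [hτ, Instr.effect],
      by simp [hτ, Instr.effect]⟩) ?_
    rintro k₁ σ₁ hf₁ ⟨rfl, g10, g22⟩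
    have g5 : σ₁.wreg 5 = σ₀.wreg 5 := (hf₁.wreg 5 (by decide)).trans e5
    have g6 : σ₁.wreg 6 = σ₀.wreg 6 := (hf₁.wreg 6 (by decide)).trans e6
    have g21 : σ₁.wreg 21 = σ.wreg 21 := hf₁.wreg 21 (by decide)
    refine Runs.branch (fun hb1 => Runs.ops fun τ hτ => ?_) (fun hb1 => Runs.skip ?_)
    · simp only [Test.holds, g22, g5] at hb1
      have t10 : τ.wreg 10 = σ₁.wreg 10 := by simp [hτ, Instr.effect]
      have t22 : τ.wreg 22 = σ₁.wreg 6 := by simp [hτ, Instr.effect]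
      have t6 : τ.wreg 6 = σ₁.wreg 6 := by simp [hτ, Instr.effect]
      have t21 : τ.wreg 21 = σ₁.wreg 21 + 4 := by simp [hτ, Instr.effect]
      refine ⟨9 * (M - τ.wreg 10), ⟨by omega, rfl, 0, d + 1, by omega, hi, by omega, ?_⟩, ?_⟩
      · have : c + 1 = i := by omega
        rw [add_one_mul]; omega
      · simp only [List.length]; omega
    · simp only [Test.holds, g22, g5] at hb1
      exact ⟨9 * (M - σ₁.wreg 10), ⟨by omega, rfl, c + 1, d, by omega, by omega, by omega,
        by omega⟩, by omega⟩
  · rintro k t τ hf ⟨hle, rfl, c, d, hc22, hci, hd21, hcd⟩ hb hk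
    have e20 : τ.wreg 20 = M := (hf.wreg 20 (by decide)).trans h20
    simp only [Test.holds, e20] at hb
    rw [hd21, show 4 * (d + 1) * i = 4 * (d * i) + 4 * i by ring]
    omega

/-! ### A phase: the elimination of a node -/

/-- The state during the elimination of the node `v`, when the lists `la` and `lb` of entering and
leaving arcs remain to be spliced. The lists of the nodes in `V` are maintained. -/
structure Eliminating (n p q N₀ : ℕ) (A : AddSubgroup ℝ) (F₀ : ℕ → ℝ) (V : Finset ℕ) (v : ℕ)
    (σ : Memory) (la lb : List ℕ) (O I : ℕ → List ℕ) : Prop where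
  derives : Derives n p q N₀ A σ.history F₀ (σ.wreg 4) (σ.xarr 0)
  wzero : σ.wreg 9 = 0
  inn : Chained (σ.warr 8) (σ.wreg 14) la
  out : Chained (σ.warr 6) (σ.wreg 15) lb
  inn_mem : ∀ e ∈ la, e < σ.wreg 4 ∧ σ.warr 1 e = v ∧ σ.warr 0 e ≠ v
  out_mem : ∀ e ∈ lb, e < σ.wreg 4 ∧ σ.warr 0 e = v ∧ σ.warr 1 e ≠ v
  lists : Lists V (σ.wreg 4) σ O I
  covers : ∀ e < σ.wreg 4, σ.xarr 0 e ≠ 0 → σ.warr 0 e ≠ σ.warr 1 e →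
    (σ.warr 0 e = v ∧ e ∈ lb ∨ σ.warr 0 e ∈ V ∧ e ∈ O (σ.warr 0 e)) ∧
    (σ.warr 1 e = v ∧ e ∈ la ∨ σ.warr 1 e ∈ V ∧ e ∈ I (σ.warr 1 e))
  len : ∀ w ∈ V, (O w).length + (I w).length ≤ σ.warr 9 w

end FlowDecomp

namespace FlowDecomp

theorem history_agree_of_update {σ τ : Memory} {N : ℕ} (h : ∀ a ∈ [0, 1, 11, 12, 13], ∀ e < N,
    τ.warr a e = σ.warr a e) (h2 : ∀ e < N, τ.xarr 2 e = σ.xarr 2 e) :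
    σ.history.Agree τ.history N where
  tl e he := (h 0 (by simp) e he).symm
  hd e he := (h 1 (by simp) e he).symm
  kd e he := (h 11 (by simp) e he).symm
  pa e he := (h 12 (by simp) e he).symm
  pb e he := (h 13 (by simp) e he).symm
  dl e he := (h2 e he).symm

/-- The lists after the new arc, the last one, has been inserted. -/
theorem Eliminating.push {n p q N₀ : ℕ} {A : AddSubgroup ℝ} {F₀ : ℕ → ℝ} {V : Finset ℕ} {v : ℕ}
    {σ τ : Memory} {la lb : List ℕ} {O I : ℕ → List ℕ} {N : ℕ}
    (hτ : Pushed σ τ) (h4 : σ.wreg 4 = N + 1)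
    (derives : Derives n p q N₀ A σ.history F₀ (N + 1) (σ.xarr 0))
    (wzero : σ.wreg 9 = 0)
    (inn : Chained (σ.warr 8) (σ.wreg 14) la)
    (out : Chained (σ.warr 6) (σ.wreg 15) lb)
    (inn_mem : ∀ e ∈ la, e < N ∧ σ.warr 1 e = v ∧ σ.warr 0 e ≠ v)
    (out_mem : ∀ e ∈ lb, e < N ∧ σ.warr 0 e = v ∧ σ.warr 1 e ≠ v)
    (lists : Lists V N σ O I)
    (covers : ∀ e < N, σ.xarr 0 e ≠ 0 → σ.warr 0 e ≠ σ.warr 1 e →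
      (σ.warr 0 e = v ∧ e ∈ lb ∨ σ.warr 0 e ∈ V ∧ e ∈ O (σ.warr 0 e)) ∧
      (σ.warr 1 e = v ∧ e ∈ la ∨ σ.warr 1 e ∈ V ∧ e ∈ I (σ.warr 1 e)))
    (len : ∀ w ∈ V, (O w).length + (I w).length ≤ σ.warr 9 w)
    (h13 : σ.wreg 13 = N) (ht : σ.warr 0 N = σ.wreg 11) (hh : σ.warr 1 N = σ.wreg 12)
    (hne : σ.wreg 11 ≠ σ.wreg 12) (hN : σ.xarr 0 N ≠ 0 → σ.wreg 11 ∈ V ∧ σ.wreg 12 ∈ V) :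
    Eliminating n p q N₀ A F₀ V v τ la lb (Function.update O (σ.wreg 11) (N :: O (σ.wreg 11)))
      (Function.update I (σ.wreg 12) (N :: I (σ.wreg 12))) := by
  have e0 : τ.warr 0 = σ.warr 0 := hτ.frame.warr 0 (by decide)
  have e1 : τ.warr 1 = σ.warr 1 := hτ.frame.warr 1 (by decide)
  have ex : τ.xarr = σ.xarr := funext fun a => hτ.frame.xarr a (by
    simp [FlowDecomp.push, ops, Program.instrs, Instr.xarrs])
  have e4 : τ.wreg 4 = N + 1 := (hτ.frame.wreg 4 (by decide)).trans h4
  have hhist : τ.history = σ.history := by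
    simp only [Memory.history, e0, e1, ex, hτ.frame.warr 11 (by decide),
      hτ.frame.warr 12 (by decide), hτ.frame.warr 13 (by decide)]
  refine ⟨?_, (hτ.frame.wreg 9 (by decide)).trans wzero, ?_, ?_, ?_, ?_, ?_, ?_, ?_⟩
  · rw [hhist, e4, ex]; exact derives
  · rw [hτ.frame.wreg 14 (by decide), hτ.inn_next, h13]
    exact inn.update fun h => by have := (inn_mem _ h).1; omega
  · rw [hτ.frame.wreg 15 (by decide), hτ.out_next, h13]
    exact out.update fun h => by have := (out_mem _ h).1; omega
  · intro e he
    rw [e0, e1, e4]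
    have := inn_mem e he
    exact ⟨by omega, this.2⟩
  · intro e he
    rw [e0, e1, e4]
    have := out_mem e he
    exact ⟨by omega, this.2⟩
  · have := lists.push (N' := N + 1) hτ (Nat.le_succ _) (by omega) ?_ ?_ (by rw [h13, ht])
      (by rw [h13, hh]) hne
    · rwa [h13, ← e4] at this
    · intro w hw h
      have := (lists.out_mem w hw _ h).1; omega
    · intro w hw h
      have := (lists.inn_mem w hw _ h).1; omega
  · intro e he hF hl
    rw [e4] at he
    rw [e0, e1] at hl ⊢
    rw [ex] at hF
    by_cases heN : e = N
    · subst heN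
      rw [ht, hh]
      exact ⟨Or.inr ⟨(hN hF).1, by simp⟩, Or.inr ⟨(hN hF).2, by simp⟩⟩
    · obtain ⟨h1, h2⟩ := covers e (by omega) hF hl
      exact ⟨h1.imp_right (And.imp_right hτ.mem), h2.imp_right (And.imp_right hτ.mem)⟩
  · intro w hw
    rw [length_update_cons, length_update_cons, hτ.len_apply]
    have := len w hw
    omega

/-- The part with the smaller value (on a tie, the entering one) becomes zero and is dropped, so the
two lists together lose exactly one entry. The new arc avoids `v`, as the lists at `v` contain no
loops; if its own ends coincide it is not listed at all. Otherwise it raises at most two counters by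
one. -/
theorem runs_splice {n p q N₀ : ℕ} {A : AddSubgroup ℝ} {F₀ : ℕ → ℝ} {V : Finset ℕ} {v : ℕ}
    {σ : Memory} {a b : ℕ} {la lb : List ℕ} {O I : ℕ → List ℕ}
    (h : Eliminating n p q N₀ A F₀ V v σ (a :: la) (b :: lb) O I) :
    Runs splice σ fun k τ => k ≤ 40 ∧ (∃ la' lb' O' I',
      Eliminating n p q N₀ A F₀ V v τ la' lb' O' I' ∧
        la'.length + lb'.length = la.length + lb.length + 1) ∧
      ∑ w ∈ V, τ.warr 9 w ≤ ∑ w ∈ V, σ.warr 9 w + 2 ∧ ∀ w, σ.warr 9 w ≤ τ.warr 9 w := by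
  obtain ⟨ha, hav, hav'⟩ := h.inn_mem a (by simp)
  obtain ⟨hb, hbv, hbv'⟩ := h.out_mem b (by simp)
  have hab : a ≠ b := fun hab => hav' (hab ▸ hbv)
  have hsane := h.derives.sane
  have h14 : σ.wreg 14 = a + 1 := h.inn.1
  have h15 : σ.wreg 15 = b + 1 := h.out.1
  refine Runs.seq (R := fun k τ => k = 6 ∧ τ.wreg 18 = a ∧ τ.wreg 19 = b ∧
    τ.xreg 1 = σ.xarr 0 a ∧ τ.xreg 2 = σ.xarr 0 b) (Runs.ops fun τ hτ => ⟨rfl,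
    by simp [hτ, Instr.effect, h14], by simp [hτ, Instr.effect, h15],
    by simp [hτ, Instr.effect, h14], by simp [hτ, Instr.effect, h15]⟩) ?_
  rintro k₁ σ₁ hf₁ ⟨rfl, h₁18, h₁19, h₁1, h₁2⟩
  have h₁8 : σ₁.warr 8 = σ.warr 8 := hf₁.warr 8 (by decide)
  have h₁6 : σ₁.warr 6 = σ.warr 6 := hf₁.warr 6 (by decide)
  have h₁14 : σ₁.wreg 14 = a + 1 := (hf₁.wreg 14 (by decide)).trans h14
  have h₁15 : σ₁.wreg 15 = b + 1 := (hf₁.wreg 15 (by decide)).trans h15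
  -- An arc leaves its list only if its value equals the minimum, hence only if it is zero after the
  -- splice; this keeps the coverage of nonzero arcs intact.
  refine Runs.seq (R := fun k τ => k = 3 ∧ τ.xreg 3 = min (σ.xarr 0 a) (σ.xarr 0 b) ∧
    ∃ la' lb', Chained (σ.warr 8) (τ.wreg 14) la' ∧ Chained (σ.warr 6) (τ.wreg 15) lb' ∧
      la' ⊆ a :: la ∧ lb' ⊆ b :: lb ∧ la'.length + lb'.length = la.length + lb.length + 1 ∧
      (∀ e ∈ a :: la, e ∉ la' → e = a ∧ σ.xarr 0 a = min (σ.xarr 0 a) (σ.xarr 0 b)) ∧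
      (∀ e ∈ b :: lb, e ∉ lb' → e = b ∧ σ.xarr 0 b = min (σ.xarr 0 a) (σ.xarr 0 b)))
    (Runs.branch (fun hle => Runs.ops fun τ hτ => ?_) (fun hle => Runs.ops fun τ hτ => ?_)) ?_
  · simp only [Test.holds, h₁1, h₁2] at hle
    refine ⟨rfl, by simp [hτ, Instr.effect, h₁1, hle], la, b :: lb, ?_, ?_, by simp, by simp,
      by simp; omega, ?_, fun e he he' => absurd he he'⟩
    · have : τ.wreg 14 = σ.warr 8 a := by simp [hτ, Instr.effect, h₁8, h₁18]
      rw [this]; exact h.inn.2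
    · have : τ.wreg 15 = b + 1 := by simp [hτ, Instr.effect, h₁15]
      rw [this, ← h15]; exact h.out
    · intro e he he'
      simp only [List.mem_cons, he', or_false] at he
      exact ⟨he, (min_eq_left hle).symm⟩
  · simp only [Test.holds, h₁1, h₁2, not_le] at hle
    refine ⟨rfl, by simp [hτ, Instr.effect, h₁2, hle.le], a :: la, lb, ?_, ?_, by simp, by simp,
      by simp; omega, fun e he he' => absurd he he', ?_⟩
    · have : τ.wreg 14 = a + 1 := by simp [hτ, Instr.effect, h₁14]
      rw [this, ← h14]; exact h.inn
    · have : τ.wreg 15 = σ.warr 6 b := by simp [hτ, Instr.effect, h₁6, h₁19]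
      rw [this]; exact h.out.2
    · intro e he he'
      simp only [List.mem_cons, he', or_false] at he
      exact ⟨he, (min_eq_right hle.le).symm⟩
  rintro k₂ σ₂ hf₂ ⟨rfl, h₂3, la', lb', hla, hlb, hlas, hlbs, hlen, hlad, hlbd⟩
  have g18 : σ₂.wreg 18 = a := (hf₂.wreg 18 (by decide)).trans h₁18
  have g19 : σ₂.wreg 19 = b := (hf₂.wreg 19 (by decide)).trans h₁19
  have g1 : σ₂.xreg 1 = σ.xarr 0 a := (hf₂.xreg 1 (by decide)).trans h₁1
  have g2 : σ₂.xreg 2 = σ.xarr 0 b := (hf₂.xreg 2 (by decide)).trans h₁2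
  have g4 : σ₂.wreg 4 = σ.wreg 4 := (hf₂.wreg 4 (by decide)).trans (hf₁.wreg 4 (by decide))
  have g9 : σ₂.wreg 9 = 0 := ((hf₂.wreg 9 (by decide)).trans (hf₁.wreg 9 (by decide))).trans h.wzero
  have gw : ∀ i, σ₂.warr i = σ.warr i := by
    intro i
    rw [hf₂.warr i (by simp [ops, Program.instrs, Instr.warrs]),
      hf₁.warr i (by simp [ops, Program.instrs, Instr.warrs])]
  have gx : ∀ i, σ₂.xarr i = σ.xarr i := by
    intro i
    rw [hf₂.xarr i (by simp [ops, Program.instrs, Instr.xarrs]),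
      hf₁.xarr i (by simp [ops, Program.instrs, Instr.xarrs])]
  clear hf₁ hf₂
  set δ := min (σ.xarr 0 a) (σ.xarr 0 b) with hδ
  set N := σ.wreg 4 with hN
  refine Runs.seq (R := fun k τ => k = 15 ∧ τ.wreg 4 = N + 1 ∧ τ.wreg 13 = N ∧
    τ.wreg 11 = σ.warr 0 a ∧ τ.wreg 12 = σ.warr 1 b ∧
    τ.warr 0 = Function.update (σ.warr 0) N (σ.warr 0 a) ∧
    τ.warr 1 = Function.update (σ.warr 1) N (σ.warr 1 b) ∧
    τ.warr 11 = Function.update (σ.warr 11) N 1 ∧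
    τ.warr 12 = Function.update (σ.warr 12) N a ∧
    τ.warr 13 = Function.update (σ.warr 13) N b ∧
    τ.xarr 0 = Function.update (Function.update (Function.update (σ.xarr 0) a (σ.xarr 0 a - δ)) b
      (σ.xarr 0 b - δ)) N δ) (Runs.ops fun τ hτ => ⟨rfl, by simp [hτ, Instr.effect, g4],
    by simp [hτ, Instr.effect, g4], by simp [hτ, Instr.effect, g18, gw],
    by simp [hτ, Instr.effect, g19, gw], by simp [hτ, Instr.effect, g4, g18, gw],
    by simp [hτ, Instr.effect, g4, g19, gw], by simp [hτ, Instr.effect, g4, gw],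
    by simp [hτ, Instr.effect, g4, g18, gw], by simp [hτ, Instr.effect, g4, g19, gw],
    by simp [hτ, Instr.effect, g4, g18, g19, gx, g1, g2, h₂3]⟩) ?_
  rintro k₃ σ₃ hf₃ ⟨rfl, t4, t13, t11, t12, tw0, tw1, tw11, tw12, tw13, tx⟩
  have u5 : σ₃.warr 5 = σ.warr 5 := (hf₃.warr 5 (by decide)).trans (gw 5)
  have u6 : σ₃.warr 6 = σ.warr 6 := (hf₃.warr 6 (by decide)).trans (gw 6)
  have u7 : σ₃.warr 7 = σ.warr 7 := (hf₃.warr 7 (by decide)).trans (gw 7)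
  have u8 : σ₃.warr 8 = σ.warr 8 := (hf₃.warr 8 (by decide)).trans (gw 8)
  have u9 : σ₃.warr 9 = σ.warr 9 := (hf₃.warr 9 (by decide)).trans (gw 9)
  have u2 : σ₃.xarr 2 = σ.xarr 2 := (hf₃.xarr 2 (by decide)).trans (gx 2)
  have v9 : σ₃.wreg 9 = 0 := (hf₃.wreg 9 (by decide)).trans g9
  have v14 : σ₃.wreg 14 = σ₂.wreg 14 := hf₃.wreg 14 (by decide)
  have v15 : σ₃.wreg 15 = σ₂.wreg 15 := hf₃.wreg 15 (by decide)
  clear hf₃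
  have w0 : ∀ e < N, σ₃.warr 0 e = σ.warr 0 e := fun e he => by
    rw [tw0, Function.update_of_ne he.ne]
  have w1 : ∀ e < N, σ₃.warr 1 e = σ.warr 1 e := fun e he => by
    rw [tw1, Function.update_of_ne he.ne]
  have w0N : σ₃.warr 0 N = σ.warr 0 a := by rw [tw0, Function.update_self]
  have w1N : σ₃.warr 1 N = σ.warr 1 b := by rw [tw1, Function.update_self]
  have hagree : σ.history.Agree σ₃.history N := by
    refine history_agree_of_update ?_ (by simp [u2])
    intro i hi e he
    simp only [List.mem_cons, List.not_mem_nil, or_false] at hi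
    rcases hi with rfl | rfl | rfl | rfl | rfl
    · exact w0 e he
    · exact w1 e he
    · rw [tw11, Function.update_of_ne he.ne]
    · rw [tw12, Function.update_of_ne he.ne]
    · rw [tw13, Function.update_of_ne he.ne]
  have hder : Derives n p q N₀ A σ₃.history F₀ (N + 1) (σ₃.xarr 0) := by
    have hpa : σ₃.history.pa N = a := by simp [Memory.history, tw12]
    have hpb : σ₃.history.pb N = b := by simp [Memory.history, tw13]
    refine .pair _ δ (h.derives.congr hagree) (by rwa [hpa]) (by rwa [hpb]) (by rwa [hpa, hpb])
      (by simp [Memory.history, tw11]) ?_ ?_ ?_ (by rw [hpa, hpb]) (by rw [hpa, hpb, tx])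
    · rw [hpa]; exact w0N.trans (w0 a ha).symm
    · rw [hpb]; exact w1N.trans (w1 b hb).symm
    · rw [hpa, hpb]
      exact (w1 a ha).trans (hav.trans (hbv.symm.trans (w0 b hb).symm))
  have hδa : δ ≤ σ.xarr 0 a := min_le_left _ _
  have hδb : δ ≤ σ.xarr 0 b := min_le_right _ _
  have h0a : 0 ≤ σ.xarr 0 a := hsane.nonneg a ha
  have h0b : 0 ≤ σ.xarr 0 b := hsane.nonneg b hb
  have hδ0 : 0 ≤ δ := le_min h0a h0b
  have hxa : σ₃.xarr 0 a = σ.xarr 0 a - δ := by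
    rw [tx, Function.update_of_ne ha.ne, Function.update_of_ne hab, Function.update_self]
  have hxb : σ₃.xarr 0 b = σ.xarr 0 b - δ := by
    rw [tx, Function.update_of_ne hb.ne, Function.update_self]
  have hxN : σ₃.xarr 0 N = δ := by rw [tx, Function.update_self]
  have hxe : ∀ e < N, σ₃.xarr 0 e ≠ 0 → σ.xarr 0 e ≠ 0 := by
    intro e he h1 h2
    by_cases hea : e = a
    · subst hea; rw [hxa] at h1; exact h1 (by linarith)
    by_cases heb : e = b
    · subst heb; rw [hxb] at h1; exact h1 (by linarith)
    · rw [tx, Function.update_of_ne he.ne, Function.update_of_ne heb, Function.update_of_ne hea]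
        at h1
      exact h1 h2
  have hcov : ∀ e < N, σ₃.xarr 0 e ≠ 0 → σ₃.warr 0 e ≠ σ₃.warr 1 e →
      (σ₃.warr 0 e = v ∧ e ∈ lb' ∨ σ₃.warr 0 e ∈ V ∧ e ∈ O (σ₃.warr 0 e)) ∧
      (σ₃.warr 1 e = v ∧ e ∈ la' ∨ σ₃.warr 1 e ∈ V ∧ e ∈ I (σ₃.warr 1 e)) := by
    intro e he hF hl
    rw [w0 e he, w1 e he] at hl ⊢
    obtain ⟨c1, c2⟩ := h.covers e he (hxe e he hF) hl
    refine ⟨c1.imp_left (And.imp_right fun hmem => ?_), c2.imp_left (And.imp_right fun hmem => ?_)⟩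
    · by_contra hnot
      obtain ⟨rfl, heq⟩ := hlbd e hmem hnot
      exact hF (by rw [hxb]; linarith)
    · by_contra hnot
      obtain ⟨rfl, heq⟩ := hlad e hmem hnot
      exact hF (by rw [hxa]; linarith)
  have hLists : Lists V N σ₃ O I := h.lists.congr le_rfl w0 w1 u5 u6 u7 u8
  have hinn : ∀ e ∈ la', e < N ∧ σ₃.warr 1 e = v ∧ σ₃.warr 0 e ≠ v := by
    intro e he
    have := h.inn_mem e (hlas he)
    rw [w0 e this.1, w1 e this.1]; exact this
  have hout : ∀ e ∈ lb', e < N ∧ σ₃.warr 0 e = v ∧ σ₃.warr 1 e ≠ v := by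
    intro e he
    have := h.out_mem e (hlbs he)
    rw [w0 e this.1, w1 e this.1]; exact this
  refine Runs.branch (fun heq => Runs.skip ?_) (fun hne => runs_push fun τ hτ => ?_)
  · simp only [Test.holds, t11, t12] at heq
    refine ⟨by omega, ⟨la', lb', O, I, ⟨by rw [t4]; exact hder, v9, ?_, ?_, ?_, ?_, ?_, ?_, ?_⟩,
      hlen⟩, by rw [u9]; omega, fun w => by rw [u9]⟩
    · rw [u8, v14]; exact hla
    · rw [u6, v15]; exact hlb
    · intro e he; rw [t4]; exact ⟨(hinn e he).1.trans (Nat.lt_succ_self N), (hinn e he).2⟩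
    · intro e he; rw [t4]; exact ⟨(hout e he).1.trans (Nat.lt_succ_self N), (hout e he).2⟩
    · rw [t4]
      exact hLists.congr (Nat.le_succ N) (fun _ _ => rfl) (fun _ _ => rfl) rfl rfl rfl rfl
    · intro e he hF hl
      have : e ≠ N := fun heN => hl (by rw [heN, w0N, w1N, heq])
      exact hcov e (by omega) hF hl
    · rw [u9]; exact h.len
  · simp only [Test.holds, t11, t12] at hne
    refine ⟨by omega, ⟨la', lb', _, _, Eliminating.push hτ t4 hder v9 (by rw [u8, v14]; exact hla)
      (by rw [u6, v15]; exact hlb) hinn hout hLists hcov (by rw [u9]; exact h.len) t13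
      (by rw [w0N, t11]) (by rw [w1N, t12]) (by rwa [t11, t12]) ?_, hlen⟩, ?_, ?_⟩
    · intro hF
      rw [hxN] at hF
      -- Then both parts were nonzero, so by coverage their ends other than `v` belong to `V`.
      have hδpos : 0 < δ := lt_of_le_of_ne hδ0 (Ne.symm hF)
      rw [t11, t12]
      constructor
      · obtain ⟨c1, -⟩ := h.covers a ha (by linarith) (by rw [hav]; exact hav')
        exact c1.elim (fun c => absurd c.1 hav') fun c => c.1
      · obtain ⟨-, c2⟩ := h.covers b hb (by linarith) (by rw [hbv]; exact hbv'.symm)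
        exact c2.elim (fun c => absurd c.1 hbv') fun c => c.1
    · rw [hτ.sum_len, u9]
      split_ifs <;> omega
    · intro w
      rw [hτ.len_apply, u9]
      omega

end FlowDecomp

namespace FlowDecomp

/-- The adjacency lists are complete and belong to the current arc values. -/
structure Tidy (n p q N₀ : ℕ) (A : AddSubgroup ℝ) (F₀ : ℕ → ℝ) (V : Finset ℕ) (σ : Memory)
    (O I : ℕ → List ℕ) : Prop where
  derives : Derives n p q N₀ A σ.history F₀ (σ.wreg 4) (σ.xarr 0)
  wzero : σ.wreg 9 = 0
  lists : Lists V (σ.wreg 4) σ O I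
  covers : Covers V σ O I
  len : ∀ w ∈ V, (O w).length + (I w).length ≤ σ.warr 9 w

section

variable {n p q N₀ : ℕ} {A : AddSubgroup ℝ} {F₀ : ℕ → ℝ} {V : Finset ℕ} {v : ℕ}
    {σ : Memory} {la lb : List ℕ} {O I : ℕ → List ℕ}

/-- If nothing but loops leaves `v`, all terms of its balance are nonpositive and sum to zero, so
every one of them vanishes. -/
theorem Eliminating.entering_eq_zero (h : Eliminating n p q N₀ A F₀ V v σ la lb O I)
    (hvn : v < n)
    (hlb : ∀ e < σ.wreg 4, σ.warr 0 e = v → σ.warr 0 e ≠ σ.warr 1 e → σ.xarr 0 e = 0) :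
    ∀ e < σ.wreg 4, σ.warr 1 e = v → σ.warr 0 e ≠ σ.warr 1 e → σ.xarr 0 e = 0 := by
  have hs := h.derives.sane
  have hterm : ∀ e ∈ Finset.range (σ.wreg 4), σ.xarr 0 e * σ.history.inc e v ≤ 0 := by
    intro e he
    have he := Finset.mem_range.1 he
    simp only [History.inc, Memory.history]
    have h0 := hs.nonneg e he
    by_cases h1 : σ.warr 0 e = v <;> by_cases h2 : σ.warr 1 e = v
    · simp [h1, h2]
    · rw [hlb e he h1 (by rw [h1]; exact fun h => h2 h.symm)]; simp
    · simpa [h1, h2] using h0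
    · simp [h1, h2]
  intro e he hev hne
  have := (Finset.sum_eq_zero_iff_of_nonpos hterm).1 (hs.bal v hvn) e (Finset.mem_range.2 he)
  have hne' : σ.warr 0 e ≠ v := by rwa [← hev]
  simp only [History.inc, Memory.history, hev, hne', if_true, if_false] at this
  linarith

theorem Eliminating.leaving_eq_zero (h : Eliminating n p q N₀ A F₀ V v σ la lb O I)
    (hvn : v < n)
    (hla : ∀ e < σ.wreg 4, σ.warr 1 e = v → σ.warr 0 e ≠ σ.warr 1 e → σ.xarr 0 e = 0) :
    ∀ e < σ.wreg 4, σ.warr 0 e = v → σ.warr 0 e ≠ σ.warr 1 e → σ.xarr 0 e = 0 := by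
  have hs := h.derives.sane
  have hterm : ∀ e ∈ Finset.range (σ.wreg 4), 0 ≤ σ.xarr 0 e * σ.history.inc e v := by
    intro e he
    have he := Finset.mem_range.1 he
    simp only [History.inc, Memory.history]
    have h0 := hs.nonneg e he
    by_cases h1 : σ.warr 0 e = v <;> by_cases h2 : σ.warr 1 e = v
    · simp [h1, h2]
    · simpa [h1, h2] using h0
    · rw [hla e he h2 (by rwa [h2])]; simp
    · simp [h1, h2]
  intro e he hev hne
  have := (Finset.sum_eq_zero_iff_of_nonneg hterm).1 (hs.bal v hvn) e (Finset.mem_range.2 he)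
  have hne' : σ.warr 1 e ≠ v := by rw [← hev]; exact hne.symm
  simp only [History.inc, Memory.history, hev, hne', if_true, if_false] at this
  linarith

/-- With the list of entering arcs exhausted, coverage makes all nonloop arcs into `v` zero, and
balance then does the same for those out of `v`. So `v` can be forgotten. -/
theorem Eliminating.tidy (h : Eliminating n p q N₀ A F₀ V v σ [] lb O I) (hv : v ∉ V)
    (hvn : v < n) : Tidy n p q N₀ A F₀ V σ O I := by
  have h1 : ∀ e < σ.wreg 4, σ.warr 1 e = v → σ.warr 0 e ≠ σ.warr 1 e → σ.xarr 0 e = 0 := by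
    intro e he hev hne
    by_contra hF
    exact (h.covers e he hF hne).2.elim (fun c => by simp at c) fun c => hv (hev ▸ c.1)
  have h2 := h.leaving_eq_zero hvn h1
  refine ⟨h.derives, h.wzero, h.lists, ?_, h.len⟩
  intro e he hF hne
  obtain ⟨c1, c2⟩ := h.covers e he hF hne
  have c1' := c1.resolve_left fun c => hF (h2 e he c.1 hne)
  have c2' := c2.resolve_left fun c => hF (h1 e he c.1 hne)
  exact ⟨c1'.1, c2'.1, c1'.2, c2'.2⟩

/-- The counter at `v` bounds the number of entries in its two lists, each splice removes one entry,
and each splice adds at most 2 to the counters of the other nodes. -/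
theorem runs_eliminate (hv : v ∈ V) (hvn : v < n) (h23 : σ.wreg 23 = v)
    (h : Tidy n p q N₀ A F₀ V σ O I) :
    Runs eliminate σ fun k τ => k ≤ 42 * σ.warr 9 v + 10 ∧
      (∃ O' I', Tidy n p q N₀ A F₀ (V.erase v) τ O' I') ∧
      ∑ w ∈ V.erase v, τ.warr 9 w ≤ ∑ w ∈ V.erase v, σ.warr 9 w + 2 * σ.warr 9 v ∧
      ∀ w, σ.warr 9 w ≤ τ.warr 9 w := by
  have hve : v ∉ V.erase v := Finset.notMem_erase v V
  refine Runs.seq (R := fun k τ => k = 2 ∧ τ.wreg 14 = σ.warr 7 v ∧ τ.wreg 15 = σ.warr 5 v)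
    (Runs.ops fun τ hτ => ⟨rfl, by simp [hτ, Instr.effect, h23], by simp [hτ, Instr.effect, h23]⟩)
    ?_
  rintro k₁ σ₁ hf₁ ⟨rfl, h14, h15⟩
  have gw : ∀ i, σ₁.warr i = σ.warr i := fun i =>
    hf₁.warr i (by simp [ops, Program.instrs, Instr.warrs])
  have gx : ∀ i, σ₁.xarr i = σ.xarr i := fun i =>
    hf₁.xarr i (by simp [ops, Program.instrs, Instr.xarrs])
  have g4 : σ₁.wreg 4 = σ.wreg 4 := hf₁.wreg 4 (by decide)
  have g9 : σ₁.wreg 9 = 0 := (hf₁.wreg 9 (by decide)).trans h.wzero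
  have hE : Eliminating n p q N₀ A F₀ (V.erase v) v σ₁ (I v) (O v) O I := by
    refine ⟨?_, g9, ?_, ?_, ?_, ?_, ?_, ?_, ?_⟩
    · have : σ₁.history = σ.history := by simp [Memory.history, gw, gx]
      rw [this, g4, gx]; exact h.derives
    · rw [gw, h14]; exact h.lists.inn v hv
    · rw [gw, h15]; exact h.lists.out v hv
    · rw [g4, gw, gw]; exact h.lists.inn_mem v hv
    · rw [g4, gw, gw]; exact h.lists.out_mem v hv
    · rw [g4]
      exact (h.lists.mono (Finset.erase_subset _ _)).congr le_rfl (by simp [gw]) (by simp [gw])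
        (gw _) (gw _) (gw _) (gw _)
    · intro e he hF hne
      rw [g4] at he
      rw [gx] at hF
      rw [gw, gw] at hne ⊢
      obtain ⟨c1, c2, c3, c4⟩ := h.covers e he hF hne
      constructor
      · by_cases hev : σ.warr 0 e = v
        · exact Or.inl ⟨hev, hev ▸ c3⟩
        · exact Or.inr ⟨Finset.mem_erase.2 ⟨hev, c1⟩, c3⟩
      · by_cases hev : σ.warr 1 e = v
        · exact Or.inl ⟨hev, hev ▸ c4⟩
        · exact Or.inr ⟨Finset.mem_erase.2 ⟨hev, c2⟩, c4⟩
    · intro w hw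
      rw [gw]; exact h.len w (Finset.mem_of_mem_erase hw)
  have hlenv := h.len v hv
  refine Runs.loop (fun t τ => ∃ la lb O' I',
    Eliminating n p q N₀ A F₀ (V.erase v) v τ la lb O' I' ∧
    -- 42 pays for the turn that makes a splice and removes an entry, and 4 for the turn that may
    -- abandon the remaining entering arcs.
    t = 42 * (la.length + lb.length) + (if la = [] then 0 else 4) ∧
    ∑ w ∈ V.erase v, τ.warr 9 w + 2 * (la.length + lb.length) ≤
      ∑ w ∈ V.erase v, σ.warr 9 w + 2 * σ.warr 9 v ∧
    ∀ w, σ.warr 9 w ≤ τ.warr 9 w) _ ⟨I v, O v, O, I, hE, rfl, ?_, fun w => by rw [gw]⟩ ?_ ?_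
  · rw [gw]; omega
  · rintro t τ - ⟨la, lb, O', I', hE', rfl, hsum, hmono⟩ hb
    obtain _ | ⟨a, la⟩ := la
    · exact absurd (hE'.inn.trans hE'.wzero.symm) hb
    refine Runs.branch (fun hb' => Runs.ops_frame fun ρ hf hρ => ?_) (fun hb' => ?_)
    · have hlb : lb = [] := by
        obtain _ | ⟨b, lb⟩ := lb
        · rfl
        · simp only [Test.holds, hE'.wzero] at hb'
          have := hE'.out.1
          omega
      subst hlb
      have r14 : ρ.wreg 14 = 0 := by simp [hρ, Instr.effect]
      have rw' : ∀ i, ρ.warr i = τ.warr i := fun i =>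
        hf.warr i (by simp [ops, Program.instrs, Instr.warrs])
      have rx : ∀ i, ρ.xarr i = τ.xarr i := fun i =>
        hf.xarr i (by simp [ops, Program.instrs, Instr.xarrs])
      have r4 : ρ.wreg 4 = τ.wreg 4 := hf.wreg 4 (by decide)
      have r9 : ρ.wreg 9 = τ.wreg 9 := hf.wreg 9 (by decide)
      have r15 : ρ.wreg 15 = τ.wreg 15 := hf.wreg 15 (by decide)
      have h1 := hE'.entering_eq_zero hvn (by
        intro e he hev hne
        by_contra hF
        exact (hE'.covers e he hF hne).1.elim (fun c => by simp at c)
          fun c => hve (hev ▸ c.1))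
      refine ⟨0, ⟨[], [], O', I', ⟨?_, r9.trans hE'.wzero, ?_, ?_, by simp, by simp, ?_, ?_, ?_⟩,
        by simp, ?_, by simpa [rw'] using hmono⟩, ?_⟩
      · have : ρ.history = τ.history := by simp [Memory.history, rw', rx]
        rw [this, r4, rx]; exact hE'.derives
      · exact r14
      · exact r15.trans hE'.out
      · rw [r4]
        exact hE'.lists.congr le_rfl (by simp [rw']) (by simp [rw']) (rw' _) (rw' _) (rw' _) (rw' _)
      · intro e he hF hne
        rw [r4] at he
        rw [rx] at hF
        rw [rw', rw'] at hne ⊢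
        obtain ⟨c1, c2⟩ := hE'.covers e he hF hne
        refine ⟨c1, Or.inr (c2.resolve_left fun c => hF (h1 e he c.1 hne))⟩
      · intro w hw
        rw [rw']; exact hE'.len w hw
      · simp only [List.length_cons, List.length_nil, rw'] at hsum ⊢
        omega
      · simp only [List.length]
        rw [if_neg (by simp)]
        omega
    · obtain _ | ⟨b, lb⟩ := lb
      · exact absurd (hE'.out.trans hE'.wzero.symm) hb'
      refine (runs_splice hE').mono ?_
      rintro k ρ - ⟨hk, ⟨la', lb', O'', I'', hE'', hlen⟩, hsum', hmono'⟩
      simp only [List.length_cons] at hsum ⊢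
      refine ⟨42 * (la'.length + lb'.length) + (if la' = [] then 0 else 4),
        ⟨la', lb', O'', I'', hE'', rfl, by omega, fun w => (hmono w).trans (hmono' w)⟩, ?_⟩
      rw [if_neg (List.cons_ne_nil _ _)]
      split_ifs <;> omega
  · rintro k t τ - ⟨la, lb, O', I', hE', rfl, hsum, hmono⟩ hb hk
    obtain _ | ⟨a, la⟩ := la
    · refine ⟨?_, ⟨O', I', hE'.tidy hve hvn⟩, by omega, hmono⟩
      simp only [List.length_nil, if_true] at hk
      split_ifs at hk <;> omega
    · refine absurd ?_ hb
      simp only [Test.holds, hE'.wzero, hE'.inn.1]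
      omega

end

end FlowDecomp

/-! ### A phase: the elimination of the nodes of small degree -/

namespace FlowDecomp

section

variable {n p q N₀ : ℕ} {A : AddSubgroup ℝ} {F₀ : ℕ → ℝ} {V : Finset ℕ} {O I : ℕ → List ℕ}

theorem Tidy.congr {σ τ : Memory} (h : Tidy n p q N₀ A F₀ V σ O I)
    (hw : ∀ i, i ≠ 10 → τ.warr i = σ.warr i) (hx : ∀ i, τ.xarr i = σ.xarr i)
    (h4 : τ.wreg 4 = σ.wreg 4) (h9 : τ.wreg 9 = σ.wreg 9) : Tidy n p q N₀ A F₀ V τ O I := by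
  have w0 := hw 0 (by decide)
  have w1 := hw 1 (by decide)
  have hhist : τ.history = σ.history := by
    simp [Memory.history, hx, hw]
  refine ⟨?_, h9.trans h.wzero, ?_, ?_, ?_⟩
  · rw [hhist, h4, hx]; exact h.derives
  · rw [h4]
    exact h.lists.congr le_rfl (by simp [w0]) (by simp [w1]) (hw _ (by decide)) (hw _ (by decide))
      (hw _ (by decide)) (hw _ (by decide))
  · intro e he hF hne
    rw [h4] at he
    rw [hx] at hF
    rw [w0, w1] at hne ⊢
    exact h.covers e he hF hne
  · rw [hw 9 (by decide)]; exact h.len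

theorem present_erase {L L' : List ℕ} {v : ℕ} (hn : (L ++ v :: L').Nodup) (hv : v < n) :
    (present n p q (L ++ v :: L')).erase v = present n p q (L ++ L') := by
  have h1 : v ∉ L ++ L' := (List.nodup_middle.1 hn).notMem
  ext w
  simp only [List.mem_append, not_or] at h1
  simp only [present, terminals, Finset.mem_erase, List.mem_toFinset, List.mem_append,
    List.mem_cons, List.mem_range'_1]
  constructor
  · rintro ⟨h2, h3⟩; tauto
  · intro h2
    refine ⟨?_, by tauto⟩
    rintro rfl
    rcases h2 with h2 | h2
    · omega
    · tauto

/-- Each node is judged by its counter at the time it is reached. An elimination then costs `O(D)`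
and adds at most `2 * D` to the other counters; since counters never decrease, the survivors end
with counters above `D`. -/
theorem runs_eliminateLoop {σ₀ : Memory} {L : List ℕ} {D : ℕ} (h10 : σ₀.wreg 10 = p + q)
    (h24 : σ₀.wreg 24 = p + q) (h21 : σ₀.wreg 21 = D) (h5 : σ₀.wreg 5 = p + q + L.length)
    (hseg : Segment (σ₀.warr 10) 0 (terminals n p q ++ L)) (hL : L.Nodup) (hlt : ∀ v ∈ L, v < n)
    (hT : Tidy n p q N₀ A F₀ (present n p q L) σ₀ O I) :
    Runs eliminateLoop σ₀ fun k τ => k ≤ (42 * D + 20) * L.length + 1 ∧ ∃ L' O' I',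
      τ.wreg 24 = p + q + L'.length ∧ Segment (τ.warr 10) 0 (terminals n p q ++ L') ∧
      L'.Nodup ∧ (∀ v ∈ L', v < n) ∧ Tidy n p q N₀ A F₀ (present n p q L') τ O' I' ∧
      (∀ v ∈ L', D < τ.warr 9 v) ∧ L'.length ≤ L.length ∧
      ∑ v ∈ present n p q L', τ.warr 9 v ≤
        ∑ v ∈ present n p q L, σ₀.warr 9 v + 2 * D * (L.length - L'.length) := by
  have hlen : (terminals n p q).length = p + q := by simp [terminals]
  -- `S` are the survivors so far, compacted after the terminals, and `l` the nodes still to be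
  -- examined; `S.length + l.length ≤ L.length` keeps the writes off the unread part.
  refine Runs.loop (fun t τ => ∃ S l O' I', τ.wreg 10 + l.length = p + q + L.length ∧
      τ.wreg 24 = p + q + S.length ∧ Segment (τ.warr 10) 0 (terminals n p q ++ S) ∧
      Segment (τ.warr 10) (τ.wreg 10) l ∧ S.length + l.length ≤ L.length ∧ (S ++ l).Nodup ∧
      (∀ v ∈ S ++ l, v < n) ∧ Tidy n p q N₀ A F₀ (present n p q (S ++ l)) τ O' I' ∧
      (∀ v ∈ S, D < τ.warr 9 v) ∧ t = (42 * D + 20) * l.length ∧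
      ∑ v ∈ present n p q (S ++ l), τ.warr 9 v ≤ ∑ v ∈ present n p q L, σ₀.warr 9 v +
        2 * D * (L.length - (S.length + l.length))) ((42 * D + 20) * L.length)
    ⟨[], L, O, I, by omega, by simpa using h24, ?_, ?_, by simp, by simpa using hL,
      by simpa using hlt, by simpa using hT, by simp, rfl, by simp⟩ ?_ ?_
  · rw [List.append_nil]; exact (segment_append.1 hseg).1
  · have := (segment_append.1 hseg).2
    rwa [hlen, zero_add, ← h10] at this
  · rintro t σ hf ⟨S, l, O', I', hj, hw, hS, hl, hSl, hnd, hlt', hT', hD, rfl, hsum⟩ hb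
    have e5 : σ.wreg 5 = p + q + L.length := (hf.wreg 5 (by decide)).trans h5
    have e21 : σ.wreg 21 = D := (hf.wreg 21 (by decide)).trans h21
    simp only [Test.holds, e5] at hb
    obtain _ | ⟨v, l⟩ := l
    · simp only [List.length_nil] at hj; omega
    simp only [List.length_cons] at hj hSl hsum
    have hvn : v < n := hlt' v (by simp)
    refine Runs.seq (R := fun k τ => k = 2 ∧ τ.wreg 23 = v ∧ τ.wreg 25 = σ.warr 9 v)
      (Runs.ops fun τ hτ => ⟨rfl, by simp [hτ, Instr.effect, hl.1],
        by simp [hτ, Instr.effect, hl.1]⟩) ?_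
    rintro k₁ σ₁ hf₁ ⟨rfl, h₁23, h₁25⟩
    have gw : ∀ i, σ₁.warr i = σ.warr i := fun i =>
      hf₁.warr i (by simp [ops, Program.instrs, Instr.warrs])
    have gx : ∀ i, σ₁.xarr i = σ.xarr i := fun i =>
      hf₁.xarr i (by simp [ops, Program.instrs, Instr.xarrs])
    have g10 : σ₁.wreg 10 = σ.wreg 10 := hf₁.wreg 10 (by decide)
    have g24 : σ₁.wreg 24 = σ.wreg 24 := hf₁.wreg 24 (by decide)
    have g21 : σ₁.wreg 21 = D := (hf₁.wreg 21 (by decide)).trans e21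
    have hT₁ : Tidy n p q N₀ A F₀ (present n p q (S ++ v :: l)) σ₁ O' I' :=
      hT'.congr (fun i _ => gw i) gx (hf₁.wreg 4 (by decide)) (hf₁.wreg 9 (by decide))
    refine Runs.seq (R := fun k τ => k ≤ 42 * D + 11 ∧ τ.wreg 10 = σ.wreg 10 ∧ ∃ S' O'' I'',
      τ.wreg 24 = p + q + S'.length ∧ Segment (τ.warr 10) 0 (terminals n p q ++ S') ∧
      Segment (τ.warr 10) (σ.wreg 10 + 1) l ∧ S'.length + l.length ≤ L.length ∧
      (S' ++ l).Nodup ∧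
      (∀ v ∈ S' ++ l, v < n) ∧ Tidy n p q N₀ A F₀ (present n p q (S' ++ l)) τ O'' I'' ∧
      (∀ v ∈ S', D < τ.warr 9 v) ∧ ∑ v ∈ present n p q (S' ++ l), τ.warr 9 v ≤
        ∑ v ∈ present n p q L, σ₀.warr 9 v + 2 * D * (L.length - (S'.length + l.length)))
      (Runs.branch (fun hb' => ?_) (fun hb' => Runs.ops_frame fun τ hfτ hτ => ?_)) ?_
    · simp only [Test.holds, h₁25, g21] at hb'
      have hvp : v ∈ present n p q (S ++ v :: l) := by simp [present]
      refine (runs_eliminate hvp hvn h₁23 hT₁).mono ?_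
      rintro k τ hfτ ⟨hk, ⟨O'', I'', hT''⟩, hsum', hmono⟩
      rw [present_erase hnd hvn] at hT'' hsum'
      rw [gw] at hk hsum' hmono
      have t10 : τ.warr 10 = σ.warr 10 := (hfτ.warr 10 (by decide)).trans (gw 10)
      refine ⟨by omega, (hfτ.wreg 10 (by decide)).trans g10, S, O'', I'',
        (hfτ.wreg 24 (by decide)).trans (g24.trans hw), by rwa [t10], by rw [t10]; exact hl.2,
        by omega, (List.nodup_cons.1 (List.nodup_middle.1 hnd)).2, ?_, hT'',
        fun w hw => (hD w hw).trans_le (hmono w), ?_⟩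
      · intro w hw
        refine hlt' w ?_
        simp only [List.mem_append, List.mem_cons] at hw ⊢
        tauto
      · have hsub : ∑ w ∈ present n p q (S ++ l), σ.warr 9 w ≤
            ∑ w ∈ present n p q (S ++ v :: l), σ.warr 9 w := by
          rw [← present_erase hnd hvn]
          exact Finset.sum_le_sum_of_subset (Finset.erase_subset _ _)
        have h2 : 2 * D * (L.length - (S.length + l.length)) =
            2 * D * (L.length - (S.length + (l.length + 1))) + 2 * D := by
          rw [show L.length - (S.length + l.length) =
            L.length - (S.length + (l.length + 1)) + 1 by omega, mul_add, mul_one]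
        omega
    · simp only [Test.holds, h₁25, g21, not_le] at hb'
      have t24 : τ.wreg 24 = σ.wreg 24 + 1 := by simp [hτ, Instr.effect, g24]
      have tR : τ.warr 10 = Function.update (σ.warr 10) (p + q + S.length) v := by
        simp [hτ, Instr.effect, g24, gw, h₁23, hw]
      have tw : ∀ i, i ≠ 10 → τ.warr i = σ₁.warr i := fun i hi =>
        hfτ.warr i (by simp [ops, Program.instrs, Instr.warrs, hi])
      have tx : ∀ i, τ.xarr i = σ₁.xarr i := fun i =>
        hfτ.xarr i (by simp [ops, Program.instrs, Instr.xarrs])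
      have t9 : τ.warr 9 = σ.warr 9 := (tw 9 (by decide)).trans (gw 9)
      have happ : S ++ [v] ++ l = S ++ v :: l := by simp
      simp only [List.length]
      refine ⟨by omega, (hfτ.wreg 10 (by decide)).trans g10, S ++ [v], O', I', ?_, ?_, ?_, ?_, ?_,
        ?_, ?_, ?_, ?_⟩
      · rw [t24, hw, List.length_append]; rfl
      · rw [← List.append_assoc, segment_append, tR]
        refine ⟨hS.update (by rw [List.length_append, hlen]; omega), ?_, trivial⟩
        rw [List.length_append, hlen, zero_add, Function.update_self]
      · rw [tR]
        exact hl.2.update (by omega)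
      · simp only [List.length_append, List.length_singleton]; omega
      · rwa [happ]
      · rwa [happ]
      · rw [happ]
        exact hT₁.congr tw tx (hfτ.wreg 4 (by decide)) (hfτ.wreg 9 (by decide))
      · intro w hw'
        rw [t9]
        simp only [List.mem_append, List.mem_singleton] at hw'
        rcases hw' with hw' | rfl
        · exact hD w hw'
        · exact hb'
      · rw [happ, t9, List.length_append, List.length_singleton,
          show S.length + 1 + l.length = S.length + (l.length + 1) by omega]
        exact hsum
    · rintro k₂ σ₂ - ⟨hk₂, h₂10, S', O'', I'', c1, c2, c3, c4, c5, c6, c7, c8, c9⟩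
      refine Runs.ops_frame fun τ hfτ hτ => ⟨(42 * D + 20) * l.length, ?_⟩
      have t10 : τ.wreg 10 = σ.wreg 10 + 1 := by simp [hτ, Instr.effect, h₂10]
      have tw : ∀ i, τ.warr i = σ₂.warr i := fun i =>
        hfτ.warr i (by simp [ops, Program.instrs, Instr.warrs])
      have tx : ∀ i, τ.xarr i = σ₂.xarr i := fun i =>
        hfτ.xarr i (by simp [ops, Program.instrs, Instr.xarrs])
      refine ⟨⟨S', l, O'', I'', by omega, (hfτ.wreg 24 (by decide)).trans c1, by rwa [tw],
        by rwa [tw, t10], c4, c5, c6, c7.congr (fun i _ => tw i) tx (hfτ.wreg 4 (by decide))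
          (hfτ.wreg 9 (by decide)), by rwa [tw], rfl, by rwa [tw]⟩, ?_⟩
      simp only [List.length, mul_add, mul_one]
      omega
  · rintro k t τ hf ⟨S, l, O', I', hj, hw, hS, hl, hSl, hnd, hlt', hT', hD, rfl, hsum⟩ hb hk
    have e5 : τ.wreg 5 = p + q + L.length := (hf.wreg 5 (by decide)).trans h5
    simp only [Test.holds, e5] at hb
    obtain rfl : l = [] := List.length_eq_zero_iff.1 (by omega)
    rw [List.append_nil] at hnd hlt' hT' hsum
    simp only [List.length_nil, add_zero] at hSl hsum
    exact ⟨by omega, S, O', I', hw, hS, hnd, hlt', hT', hD, hSl, hsum⟩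

end

end FlowDecomp

/-! ### A phase: building the lists anew without zero or parallel arcs -/

namespace FlowDecomp

/-- The state during the rebuilding of the lists. The lists of arcs that leave the nodes in `rest`
are still the old ones, and so is the pending list `l` of arcs that leave `u`. The arcs in `K` have
been kept so far. -/
structure Rebuilding (n p q N₀ : ℕ) (A : AddSubgroup ℝ) (F₀ : ℕ → ℝ) (V : Finset ℕ)
    (Oold : ℕ → List ℕ) (σ : Memory) (rest : List ℕ) (u : ℕ) (l : List ℕ) (K : Finset ℕ)
    (O I : ℕ → List ℕ) : Prop where
  derives : Derives n p q N₀ A σ.history F₀ (σ.wreg 4) (σ.xarr 0)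
  wzero : σ.wreg 9 = 0
  xzero : σ.xreg 0 = 0
  lists : Lists V (σ.wreg 4) σ O I
  old : ∀ v ∈ rest, O v = Oold v
  nodup : l.Nodup
  pending : ∀ e ∈ l, e < σ.wreg 4 ∧ σ.warr 0 e = u ∧ σ.warr 1 e ≠ u ∧ e ∉ K
  kept : ∀ e ∈ K, e < σ.wreg 4 ∧ σ.xarr 0 e ≠ 0 ∧ σ.warr 0 e ≠ σ.warr 1 e ∧ σ.warr 0 e ∈ V ∧
    σ.warr 1 e ∈ V ∧ σ.warr 0 e ∉ rest
  inj : ∀ e ∈ K, ∀ e' ∈ K, σ.warr 0 e = σ.warr 0 e' → σ.warr 1 e = σ.warr 1 e' → e = e'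
  count : σ.wreg 20 = K.card
  inn_kept : ∀ v ∈ V, ∀ e ∈ I v, e ∈ K
  out_kept : ∀ v ∈ V, v ∉ rest → ∀ e ∈ O v, e ∈ K
  covers : ∀ e < σ.wreg 4, σ.xarr 0 e ≠ 0 → σ.warr 0 e ≠ σ.warr 1 e → σ.warr 0 e ∈ V ∧
    σ.warr 1 e ∈ V ∧ (e ∈ l ∨ e ∈ O (σ.warr 0 e) ∧ (σ.warr 0 e ∉ rest → e ∈ I (σ.warr 1 e)))
  len : ∀ v ∈ V, (if v ∈ rest then 0 else (O v).length) + (I v).length ≤ σ.warr 9 v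
  sum : ∑ v ∈ V, σ.warr 9 v = 2 * K.card
  top : ∀ e ∈ K, σ.warr 0 e = u → σ.warr 7 (σ.warr 1 e) = e + 1

section

variable {n p q N₀ : ℕ} {A : AddSubgroup ℝ} {F₀ : ℕ → ℝ} {V : Finset ℕ} {Oold O I : ℕ → List ℕ}
  {rest l : List ℕ} {u : ℕ} {K : Finset ℕ}

theorem Rebuilding.congr {σ τ : Memory}
    (h : Rebuilding n p q N₀ A F₀ V Oold σ rest u l K O I) (hw : ∀ i, τ.warr i = σ.warr i)
    (hx : ∀ i, τ.xarr i = σ.xarr i) (h4 : τ.wreg 4 = σ.wreg 4) (h9 : τ.wreg 9 = σ.wreg 9)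
    (h20 : τ.wreg 20 = σ.wreg 20) (h0 : τ.xreg 0 = σ.xreg 0) :
    Rebuilding n p q N₀ A F₀ V Oold τ rest u l K O I := by
  have hhist : τ.history = σ.history := by simp [Memory.history, hx, hw]
  refine ⟨by rw [hhist, h4, hx]; exact h.derives, h9.trans h.wzero, h0.trans h.xzero, ?_, h.old,
    h.nodup, by simpa only [h4, hw] using h.pending, by simpa only [h4, hw, hx] using h.kept,
    by simpa only [hw] using h.inj, h20.trans h.count, h.inn_kept, h.out_kept,
    by simpa only [h4, hw, hx] using h.covers, by simpa only [hw] using h.len,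
    by simpa only [hw] using h.sum, by simpa only [hw] using h.top⟩
  rw [h4]
  exact h.lists.congr le_rfl (by simp [hw]) (by simp [hw]) (hw _) (hw _) (hw _) (hw _)

theorem Rebuilding.forget {σ : Memory} {e : ℕ}
    (h : Rebuilding n p q N₀ A F₀ V Oold σ rest u (e :: l) K O I) (he : σ.xarr 0 e = 0) :
    Rebuilding n p q N₀ A F₀ V Oold σ rest u l K O I := by
  refine ⟨h.derives, h.wzero, h.xzero, h.lists, h.old, (List.nodup_cons.1 h.nodup).2,
    fun e he => h.pending e (List.mem_cons_of_mem _ he), h.kept, h.inj, h.count, h.inn_kept,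
    h.out_kept, ?_, h.len, h.sum, h.top⟩
  intro e' he' hF hne
  obtain ⟨c1, c2, c3⟩ := h.covers e' he' hF hne
  refine ⟨c1, c2, c3.imp_left fun c => ?_⟩
  exact (List.mem_cons.1 c).resolve_left fun c => hF (c ▸ he)

/-- By `top`, a kept arc parallel to `e` would stand first in the list of the head of `e`, which
`hpar` excludes. So the kept arcs remain free of parallels, and `e` is now the first entry there. -/
theorem Rebuilding.push {σ τ : Memory} {e : ℕ}
    (h : Rebuilding n p q N₀ A F₀ V Oold σ rest u (e :: l) K O I) (hu : u ∉ rest)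
    (he : σ.xarr 0 e ≠ 0) (h11 : σ.wreg 11 = u) (h12 : σ.wreg 12 = σ.warr 1 e)
    (h13 : σ.wreg 13 = e) (hpar : ∀ g, σ.warr 7 (σ.warr 1 e) = g + 1 → σ.warr 0 g ≠ u)
    {ρ : Memory} (hρ : Pushed σ ρ) (hf : Frame (ops [.wsucc 20]) ρ τ)
    (h20 : τ.wreg 20 = ρ.wreg 20 + 1) :
    ∃ O' I', Rebuilding n p q N₀ A F₀ V Oold τ rest u l (insert e K) O' I' := by
  obtain ⟨he4, heu, hew, heK⟩ := h.pending e (by simp)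
  have hne : σ.warr 0 e ≠ σ.warr 1 e := by rw [heu]; exact hew.symm
  obtain ⟨huV, hwV, -⟩ := h.covers e he4 he hne
  rw [heu] at huV
  have tw : ∀ i, τ.warr i = ρ.warr i := fun i =>
    hf.warr i (by simp [ops, Program.instrs, Instr.warrs])
  have tx : ∀ i, τ.xarr i = σ.xarr i := fun i =>
    (hf.xarr i (by simp [ops, Program.instrs, Instr.xarrs])).trans
      (hρ.frame.xarr i (by simp [FlowDecomp.push, ops, Program.instrs, Instr.xarrs]))
  have t0 : τ.warr 0 = σ.warr 0 := (tw 0).trans (hρ.frame.warr 0 (by decide))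
  have t1 : τ.warr 1 = σ.warr 1 := (tw 1).trans (hρ.frame.warr 1 (by decide))
  have t4 : τ.wreg 4 = σ.wreg 4 := (hf.wreg 4 (by decide)).trans (hρ.frame.wreg 4 (by decide))
  have hhist : τ.history = σ.history := by
    simp only [Memory.history, t0, t1, tx, tw, hρ.frame.warr 11 (by decide),
      hρ.frame.warr 12 (by decide), hρ.frame.warr 13 (by decide)]
  have hL := h.lists.push hρ le_rfl (by rw [h13]; exact he4) (by
      intro v hv hmem
      rw [h13] at hmem
      have := h.lists.out_mem v hv e hmem
      have hvu : v = u := this.2.1.symm.trans heu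
      exact heK (h.out_kept v hv (hvu ▸ hu) e hmem)) (by
      intro v hv hmem
      rw [h13] at hmem
      exact heK (h.inn_kept v hv e hmem)) (by rw [h13, h11, heu]) (by rw [h13, h12])
    (by rw [h11, h12]; exact hew.symm)
  rw [h11, h12, h13] at hL
  have hcard : (insert e K).card = K.card + 1 := Finset.card_insert_of_notMem heK
  refine ⟨_, _, ⟨by rw [hhist, t4, tx]; exact h.derives,
    (hf.wreg 9 (by decide)).trans ((hρ.frame.wreg 9 (by decide)).trans h.wzero),
    (hf.xreg 0 (by decide)).trans ((hρ.frame.xreg 0 (by decide)).trans h.xzero),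
    by rw [t4]; exact hL.congr le_rfl (by simp [tw]) (by simp [tw]) (tw _) (tw _) (tw _) (tw _),
    ?_, (List.nodup_cons.1 h.nodup).2, ?_, ?_, ?_, ?_, ?_, ?_, ?_, ?_, ?_, ?_⟩⟩
  · intro v hv
    rw [Function.update_of_ne (fun h' : v = u => hu (h' ▸ hv))]
    exact h.old v hv
  · intro e' he'
    rw [t0, t1, t4]
    obtain ⟨c1, c2, c3, c4⟩ := h.pending e' (List.mem_cons_of_mem _ he')
    refine ⟨c1, c2, c3, ?_⟩
    rw [Finset.mem_insert, not_or]
    refine ⟨?_, c4⟩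
    rintro rfl
    exact (List.nodup_cons.1 h.nodup).1 he'
  · intro e' he'
    rw [t0, t1, t4, tx]
    rcases Finset.mem_insert.1 he' with rfl | he'
    · exact ⟨he4, he, hne, heu ▸ huV, hwV, heu ▸ hu⟩
    · exact h.kept e' he'
  · rw [t0, t1]
    have key : ∀ e' ∈ K, σ.warr 0 e' = σ.warr 0 e → σ.warr 1 e' = σ.warr 1 e → False := by
      intro e' he' h1 h2
      have h3 := h.top e' he' (h1.trans heu)
      rw [h2] at h3
      exact hpar e' h3 (h1.trans heu)
    intro e₁ he₁ e₂ he₂ h1 h2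
    rcases Finset.mem_insert.1 he₁ with c₁ | c₁ <;> rcases Finset.mem_insert.1 he₂ with c₂ | c₂
    · exact c₁.trans c₂.symm
    · exact (key e₂ c₂ (c₁ ▸ h1.symm) (c₁ ▸ h2.symm)).elim
    · exact (key e₁ c₁ (c₂ ▸ h1) (c₂ ▸ h2)).elim
    · exact h.inj e₁ c₁ e₂ c₂ h1 h2
  · rw [h20, hρ.frame.wreg 20 (by decide), h.count, hcard]
  · intro v hv e' he'
    by_cases hvw : v = σ.warr 1 e
    · subst hvw
      rw [Function.update_self, List.mem_cons] at he'
      rcases he' with rfl | he'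
      · exact Finset.mem_insert_self _ _
      · exact Finset.mem_insert_of_mem (h.inn_kept _ hv _ he')
    · rw [Function.update_of_ne hvw] at he'
      exact Finset.mem_insert_of_mem (h.inn_kept _ hv _ he')
  · intro v hv hvr e' he'
    by_cases hvw : v = u
    · subst hvw
      rw [Function.update_self, List.mem_cons] at he'
      rcases he' with rfl | he'
      · exact Finset.mem_insert_self _ _
      · exact Finset.mem_insert_of_mem (h.out_kept _ hv hvr _ he')
    · rw [Function.update_of_ne hvw] at he'
      exact Finset.mem_insert_of_mem (h.out_kept _ hv hvr _ he')
  · intro e' he' hF hl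
    rw [t4] at he'
    rw [tx] at hF
    rw [t0, t1] at hl ⊢
    obtain ⟨c1, c2, c3⟩ := h.covers e' he' hF hl
    refine ⟨c1, c2, ?_⟩
    by_cases hee : e' = e
    · subst hee
      right
      rw [heu]
      simp
    · rcases c3 with c3 | c3
      · exact Or.inl ((List.mem_cons.1 c3).resolve_left hee)
      · exact Or.inr ⟨hρ.mem c3.1, fun hr => hρ.mem (c3.2 hr)⟩
  · intro v hv
    have := h.len v hv
    rw [length_update_cons, length_update_cons, tw, hρ.len_apply, h11, h12]
    by_cases hvr : v ∈ rest
    · rw [if_pos hvr] at this ⊢; omega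
    · rw [if_neg hvr] at this ⊢; omega
  · rw [tw, hρ.sum_len, h11, h12, if_pos huV, if_pos hwV, h.sum, hcard]; ring
  · intro e' he' hu'
    rw [t0] at hu'
    rw [tw, t1, hρ.inn, h12, h13]
    rcases Finset.mem_insert.1 he' with rfl | he'
    · rw [Function.update_self]
    · by_cases hw' : σ.warr 1 e' = σ.warr 1 e
      · have h3 := h.top e' he' hu'
        rw [hw'] at h3
        exact absurd hu' (hpar e' h3)
      · rw [Function.update_of_ne hw']
        exact h.top e' he' hu'

/-- The first entry `g` of the list of the head is a kept arc, and having the tail `u` makes it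
parallel to `e`. It absorbs the value of `e`, so the kept arcs and all lists stay as they are; the
recorded value makes the step reversible. -/
theorem Rebuilding.merge {σ τ : Memory} {e g : ℕ}
    (h : Rebuilding n p q N₀ A F₀ V Oold σ rest u (e :: l) K O I)
    (he : σ.xarr 0 e ≠ 0) (hg : σ.warr 7 (σ.warr 1 e) = g + 1) (hgu : σ.warr 0 g = u)
    (hf : Frame FlowDecomp.merge σ τ) (h4 : τ.wreg 4 = σ.wreg 4 + 1)
    (h0 : τ.warr 0 = Function.update (σ.warr 0) (σ.wreg 4) 0)
    (h1 : τ.warr 1 = Function.update (σ.warr 1) (σ.wreg 4) 0)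
    (h11 : τ.warr 11 = Function.update (σ.warr 11) (σ.wreg 4) 0)
    (h12 : τ.warr 12 = Function.update (σ.warr 12) (σ.wreg 4) e)
    (h13 : τ.warr 13 = Function.update (σ.warr 13) (σ.wreg 4) g)
    (hx2 : τ.xarr 2 = Function.update (σ.xarr 2) (σ.wreg 4) (σ.xarr 0 e))
    (hx : τ.xarr 0 = Function.update (Function.update (Function.update (σ.xarr 0) g
      (σ.xarr 0 g + σ.xarr 0 e)) e 0) (σ.wreg 4) 0) :
    Rebuilding n p q N₀ A F₀ V Oold τ rest u l K O I := by
  obtain ⟨he4, heu, hew, heK⟩ := h.pending e (by simp)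
  have hne : σ.warr 0 e ≠ σ.warr 1 e := by rw [heu]; exact hew.symm
  obtain ⟨huV, hwV, -⟩ := h.covers e he4 he hne
  obtain ⟨hgI, hgK⟩ : g ∈ I (σ.warr 1 e) ∧ g ∈ K := by
    have hc := h.lists.inn _ hwV
    rw [hg] at hc
    have : g ∈ I (σ.warr 1 e) := by
      revert hc
      cases I (σ.warr 1 e) with
      | nil => intro hc; simp [Chained] at hc
      | cons g' l' =>
        intro hc
        have := hc.1
        simp only [add_left_inj] at this
        simp [this]
    exact ⟨this, h.inn_kept _ hwV _ this⟩
  obtain ⟨hg4, hgF, hgl, hgV, hgV', hgr⟩ := h.kept g hgK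
  have hgw : σ.warr 1 g = σ.warr 1 e := (h.lists.inn_mem _ hwV g hgI).2.1
  have heg : e ≠ g := fun h' => heK (h' ▸ hgK)
  have hsane := h.derives.sane
  have he0 := hsane.nonneg e he4
  have hg0 := hsane.nonneg g hg4
  have w0 : ∀ x < σ.wreg 4, τ.warr 0 x = σ.warr 0 x := fun x hx => by
    rw [h0, Function.update_of_ne hx.ne]
  have w1 : ∀ x < σ.wreg 4, τ.warr 1 x = σ.warr 1 x := fun x hx => by
    rw [h1, Function.update_of_ne hx.ne]
  have hagree : σ.history.Agree τ.history (σ.wreg 4) := by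
    refine history_agree_of_update ?_ fun x hx => by rw [hx2, Function.update_of_ne hx.ne]
    intro i hi x hx
    simp only [List.mem_cons, List.not_mem_nil, or_false] at hi
    rcases hi with rfl | rfl | rfl | rfl | rfl
    · exact w0 x hx
    · exact w1 x hx
    · rw [h11, Function.update_of_ne hx.ne]
    · rw [h12, Function.update_of_ne hx.ne]
    · rw [h13, Function.update_of_ne hx.ne]
  have hder : Derives n p q N₀ A τ.history F₀ (σ.wreg 4 + 1) (τ.xarr 0) := by
    have hpa : τ.history.pa (σ.wreg 4) = e := by simp [Memory.history, h12]
    have hpb : τ.history.pb (σ.wreg 4) = g := by simp [Memory.history, h13]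
    refine .merge _ (h.derives.congr hagree) (by rwa [hpa]) (by rwa [hpb]) (by rwa [hpa, hpb])
      (by simp [Memory.history, h11]) (by simp [Memory.history, h0])
      (by simp [Memory.history, h1]) ?_ ?_ (by rw [hpa]; simp [Memory.history, hx2])
      (by rw [hpa, hpb, hx])
    · rw [hpa, hpb]; exact (w0 e he4).trans (heu.trans (hgu.symm.trans (w0 g hg4).symm))
    · rw [hpa, hpb]; exact (w1 e he4).trans (hgw.symm.trans (w1 g hg4).symm)
  have hxe : τ.xarr 0 e = 0 := by rw [hx, Function.update_of_ne he4.ne, Function.update_self]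
  have hxg : τ.xarr 0 g ≠ 0 := by
    rw [hx, Function.update_of_ne hg4.ne, Function.update_of_ne heg.symm, Function.update_self]
    have := lt_of_le_of_ne he0 he.symm
    linarith
  have hxo : ∀ x < σ.wreg 4, x ≠ e → x ≠ g → τ.xarr 0 x = σ.xarr 0 x := by
    intro x hx' h1 h2
    rw [hx, Function.update_of_ne hx'.ne, Function.update_of_ne h1, Function.update_of_ne h2]
  have t7 : τ.warr 7 = σ.warr 7 := hf.warr 7 (by decide)
  have t9 : τ.warr 9 = σ.warr 9 := hf.warr 9 (by decide)
  refine ⟨by rw [h4]; exact hder, (hf.wreg 9 (by decide)).trans h.wzero,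
    (hf.xreg 0 (by decide)).trans h.xzero, ?_, h.old, (List.nodup_cons.1 h.nodup).2, ?_, ?_, ?_,
    (hf.wreg 20 (by decide)).trans h.count, h.inn_kept, h.out_kept, ?_, by rw [t9]; exact h.len,
    by rw [t9]; exact h.sum, ?_⟩
  · rw [h4]
    exact h.lists.congr (Nat.le_succ _) w0 w1 (hf.warr 5 (by decide)) (hf.warr 6 (by decide)) t7
      (hf.warr 8 (by decide))
  · intro x hx'
    obtain ⟨c1, c2, c3, c4⟩ := h.pending x (List.mem_cons_of_mem _ hx')
    rw [w0 x c1, w1 x c1, h4]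
    exact ⟨by omega, c2, c3, c4⟩
  · intro x hx'
    obtain ⟨c1, c2, c3⟩ := h.kept x hx'
    rw [w0 x c1, w1 x c1, h4]
    refine ⟨by omega, ?_, c3⟩
    by_cases hxg' : x = g
    · rw [hxg']; exact hxg
    · rw [hxo x c1 (fun h' => heK (h' ▸ hx')) hxg']; exact c2
  · intro x hx' y hy' e1 e2
    have c1 := (h.kept x hx').1
    have c2 := (h.kept y hy').1
    rw [w0 x c1, w0 y c2] at e1
    rw [w1 x c1, w1 y c2] at e2
    exact h.inj x hx' y hy' e1 e2
  · intro x hx' hF hl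
    rw [h4] at hx'
    by_cases hxN : x = σ.wreg 4
    · rw [hxN, h0, h1, Function.update_self, Function.update_self] at hl
      exact absurd rfl hl
    have hxN' : x < σ.wreg 4 := by omega
    rw [w0 x hxN', w1 x hxN'] at hl ⊢
    have hxe' : x ≠ e := fun h' => hF (h' ▸ hxe)
    have hF' : σ.xarr 0 x ≠ 0 := by
      by_cases hxg' : x = g
      · rw [hxg']; exact hgF
      · rwa [← hxo x hxN' hxe' hxg']
    obtain ⟨c1, c2, c3⟩ := h.covers x hxN' hF' hl
    exact ⟨c1, c2, c3.imp_left fun c => (List.mem_cons.1 c).resolve_left hxe'⟩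
  · intro x hx'
    have c1 := (h.kept x hx').1
    rw [w0 x c1, w1 x c1, t7]
    exact h.top x hx'

theorem runs_compareTail {σ : Memory} (h9 : σ.wreg 9 = 0) :
    Runs compareTail σ fun k τ => k ≤ 6 ∧
      (τ.wreg 17 = 0 ∧ (∀ g, σ.wreg 16 = g + 1 → σ.warr 0 g ≠ σ.wreg 11) ∨
      τ.wreg 17 ≠ 0 ∧ σ.wreg 16 = τ.wreg 16 + 1 ∧ σ.warr 0 (τ.wreg 16) = σ.wreg 11) := by
  refine Runs.seq (R := fun k τ => k = 1 ∧ τ.wreg 17 = 0)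
    (Runs.ops fun τ hτ => ⟨rfl, by simp [hτ, Instr.effect]⟩) ?_
  rintro k₁ σ₁ hf₁ ⟨rfl, h17⟩
  have g16 : σ₁.wreg 16 = σ.wreg 16 := hf₁.wreg 16 (by decide)
  have g9 : σ₁.wreg 9 = 0 := (hf₁.wreg 9 (by decide)).trans h9
  have g11 : σ₁.wreg 11 = σ.wreg 11 := hf₁.wreg 11 (by decide)
  have g0 : σ₁.warr 0 = σ.warr 0 := hf₁.warr 0 (by decide)
  refine Runs.branch (fun hb => Runs.skip ?_) (fun hb => ?_)
  · simp only [Test.holds, g16, g9] at hb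
    exact ⟨by omega, Or.inl ⟨h17, fun g hg => by omega⟩⟩
  · simp only [Test.holds, g16, g9] at hb
    refine Runs.seq (R := fun k τ => k = 2 ∧ τ.wreg 16 = σ.wreg 16 - 1 ∧
      τ.wreg 25 = σ.warr 0 (σ.wreg 16 - 1))
      (Runs.ops fun τ hτ => ⟨rfl, by simp [hτ, Instr.effect, g16],
        by simp [hτ, Instr.effect, g16, g0]⟩) ?_
    rintro k₂ σ₂ hf₂ ⟨rfl, h16, h25⟩
    have i11 : σ₂.wreg 11 = σ.wreg 11 := (hf₂.wreg 11 (by decide)).trans g11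
    have i17 : σ₂.wreg 17 = 0 := (hf₂.wreg 17 (by decide)).trans h17
    refine Runs.branch (fun hb' => Runs.ops fun τ hτ => ?_) (fun hb' => Runs.skip ?_)
    · simp only [Test.holds, h25, i11] at hb'
      have t16 : τ.wreg 16 = σ.wreg 16 - 1 := by simp [hτ, Instr.effect, h16]
      exact ⟨by simp, Or.inr ⟨by simp [hτ, Instr.effect], by omega, by rw [t16, hb']⟩⟩
    · simp only [Test.holds, h25, i11] at hb'
      exact ⟨by simp, Or.inl ⟨i17, fun g hg => by rwa [show g = σ.wreg 16 - 1 by omega]⟩⟩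

/-- The successor of `e` is read before `push` overwrites it, and the remaining chain is not
affected because `e ∉ l`. -/
theorem runs_rebuildArc {σ : Memory} {e : ℕ} (hu : u ∉ rest) (h11 : σ.wreg 11 = u)
    (hc : Chained (σ.warr 6) (σ.wreg 14) (e :: l))
    (h : Rebuilding n p q N₀ A F₀ V Oold σ rest u (e :: l) K O I) :
    Runs rebuildArc σ fun k τ => k ≤ 40 ∧ Chained (τ.warr 6) (τ.wreg 14) l ∧
      ∃ K' O' I', Rebuilding n p q N₀ A F₀ V Oold τ rest u l K' O' I' := by
  have hel : e ∉ l := (List.nodup_cons.1 h.nodup).1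
  have h14 : σ.wreg 14 = e + 1 := hc.1
  refine Runs.seq (R := fun k τ => k = 4 ∧ τ.wreg 13 = e ∧ τ.wreg 14 = σ.warr 6 e ∧
    τ.xreg 1 = σ.xarr 0 e) (Runs.ops fun τ hτ => ⟨rfl, by simp [hτ, Instr.effect, h14],
    by simp [hτ, Instr.effect, h14], by simp [hτ, Instr.effect, h14]⟩) ?_
  rintro k₁ σ₁ hf₁ ⟨rfl, g13, g14, gx1⟩
  have gw : ∀ i, σ₁.warr i = σ.warr i := fun i =>
    hf₁.warr i (by simp [ops, Program.instrs, Instr.warrs])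
  have gx : ∀ i, σ₁.xarr i = σ.xarr i := fun i =>
    hf₁.xarr i (by simp [ops, Program.instrs, Instr.xarrs])
  have h₁ : Rebuilding n p q N₀ A F₀ V Oold σ₁ rest u (e :: l) K O I :=
    h.congr gw gx (hf₁.wreg 4 (by decide)) (hf₁.wreg 9 (by decide)) (hf₁.wreg 20 (by decide))
      (hf₁.xreg 0 (by decide))
  have hc₁ : Chained (σ₁.warr 6) (σ₁.wreg 14) l := by rw [gw, g14]; exact hc.2
  have g11 : σ₁.wreg 11 = u := (hf₁.wreg 11 (by decide)).trans h11
  have gx0 := h₁.xzero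
  rw [← gx] at gx1
  clear hf₁
  refine Runs.branch (fun hb => Runs.skip ?_) (fun hb => ?_)
  · simp only [Test.holds, gx0, gx1] at hb
    exact ⟨by omega, hc₁, K, O, I, h₁.forget hb⟩
  simp only [Test.holds, gx0, gx1] at hb
  refine Runs.seq (R := fun k τ => k = 2 ∧ τ.wreg 12 = σ₁.warr 1 e ∧
    τ.wreg 16 = σ₁.warr 7 (σ₁.warr 1 e)) (Runs.ops fun τ hτ => ⟨rfl,
    by simp [hτ, Instr.effect, g13], by simp [hτ, Instr.effect, g13]⟩) ?_
  rintro k₂ σ₂ hf₂ ⟨rfl, i12, i16⟩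
  have iw : ∀ i, σ₂.warr i = σ₁.warr i := fun i =>
    hf₂.warr i (by simp [ops, Program.instrs, Instr.warrs])
  have ix : ∀ i, σ₂.xarr i = σ₁.xarr i := fun i =>
    hf₂.xarr i (by simp [ops, Program.instrs, Instr.xarrs])
  refine Runs.seq (runs_compareTail ((hf₂.wreg 9 (by decide)).trans h₁.wzero)) ?_
  rintro k₃ σ₃ hf₃ ⟨hk₃, hcmp⟩
  have jw : ∀ i, σ₃.warr i = σ₁.warr i := fun i => (hf₃.warr i (by
    simp [compareTail, block, ops, Program.instrs, Instr.warrs])).trans (iw i)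
  have jx : ∀ i, σ₃.xarr i = σ₁.xarr i := fun i => (hf₃.xarr i (by
    simp [compareTail, block, ops, Program.instrs, Instr.xarrs])).trans (ix i)
  have i11 : σ₂.wreg 11 = u := (hf₂.wreg 11 (by decide)).trans g11
  rw [iw, i16, i11] at hcmp
  have j11 : σ₃.wreg 11 = u := (hf₃.wreg 11 (by decide)).trans i11
  have j12 : σ₃.wreg 12 = σ₃.warr 1 e := by
    rw [jw]; exact (hf₃.wreg 12 (by decide)).trans i12
  have j13 : σ₃.wreg 13 = e := (hf₃.wreg 13 (by decide)).trans <|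
    (hf₂.wreg 13 (by decide)).trans g13
  have j14 : σ₃.wreg 14 = σ₁.wreg 14 := (hf₃.wreg 14 (by decide)).trans (hf₂.wreg 14 (by decide))
  have j1 : σ₃.xreg 1 = σ₁.xarr 0 e := (hf₃.xreg 1 (by decide)).trans <|
    (hf₂.xreg 1 (by decide)).trans gx1
  have h₃ : Rebuilding n p q N₀ A F₀ V Oold σ₃ rest u (e :: l) K O I :=
    h₁.congr jw jx ((hf₃.wreg 4 (by decide)).trans (hf₂.wreg 4 (by decide)))
      ((hf₃.wreg 9 (by decide)).trans (hf₂.wreg 9 (by decide)))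
      ((hf₃.wreg 20 (by decide)).trans (hf₂.wreg 20 (by decide)))
      ((hf₃.xreg 0 (by decide)).trans (hf₂.xreg 0 (by decide)))
  have hc₃ : Chained (σ₃.warr 6) (σ₃.wreg 14) l := by rw [jw, j14]; exact hc₁
  have j9 := h₃.wzero
  have jx0 := h₃.xzero
  rw [← jw 0, ← jw 7, ← jw 1] at hcmp
  rw [← jx] at hb j1
  clear hf₂ hf₃
  refine Runs.branch (fun hb' => ?_) (fun hb' => ?_)
  · simp only [Test.holds, j9] at hb'
    have hpar := (hcmp.resolve_right fun c => c.1 hb').2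
    refine Runs.seq (runs_push (Q := fun k τ => k = 14 ∧ Pushed σ₃ τ) fun τ hτ => ⟨rfl, hτ⟩) ?_
    rintro k₄ ρ - ⟨rfl, hρ⟩
    refine Runs.ops_frame fun τ hf hτ => ?_
    obtain ⟨O', I', hR⟩ := h₃.push hu hb j11 j12 j13 hpar hρ hf (by simp [hτ, Instr.effect])
    refine ⟨by simp; omega, ?_, _, O', I', hR⟩
    rw [hf.warr 6 (by decide), hf.wreg 14 (by decide), hρ.out_next, hρ.frame.wreg 14 (by decide),
      j13]
    exact hc₃.update hel
  · simp only [Test.holds, j9] at hb'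
    obtain ⟨-, hg, hgu⟩ := hcmp.resolve_left fun c => hb' c.1
    obtain ⟨he4, heu, hew, heK⟩ := h₃.pending e (by simp)
    refine Runs.ops_frame fun τ hf hτ => ⟨by simp; omega, ?_, K, O, I,
      h₃.merge hb hg hgu hf ?_ ?_ ?_ ?_ ?_ ?_ ?_ ?_⟩
    · rw [hf.warr 6 (by decide), hf.wreg 14 (by decide)]
      exact hc₃
    · simp [hτ, Instr.effect]
    · simp [hτ, Instr.effect, j9]
    · simp [hτ, Instr.effect, j9]
    · simp [hτ, Instr.effect, j9]
    · simp [hτ, Instr.effect, j13]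
    · simp [hτ, Instr.effect]
    · simp [hτ, Instr.effect, j1]
    · simp [hτ, Instr.effect, j13, jx0, j1]

end

end FlowDecomp

/-! ### A phase: completing the rebuilding, and the phase as a whole -/

namespace FlowDecomp

section

variable {n p q N₀ : ℕ} {A : AddSubgroup ℝ} {F₀ : ℕ → ℝ} {V : Finset ℕ} {Oold O I : ℕ → List ℕ}
  {rest l : List ℕ} {u : ℕ} {K : Finset ℕ}

/-- The old list of `u` becomes the pending one and its new list starts empty. No kept arc leaves
`u` yet, so `top` holds vacuously. -/
theorem Rebuilding.start {σ τ : Memory} {u' : ℕ}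
    (h : Rebuilding n p q N₀ A F₀ V Oold σ (u :: rest) u' [] K O I) (hu : u ∉ rest) (huV : u ∈ V)
    (hf : Frame (ops [.wload 11 10 10, .wload 14 5 11, .wstore 5 11 9]) σ τ)
    (h5 : τ.warr 5 = Function.update (σ.warr 5) u 0) :
    Rebuilding n p q N₀ A F₀ V Oold τ rest u (O u) K (Function.update O u []) I := by
  have tw : ∀ i, i ≠ 5 → τ.warr i = σ.warr i := fun i hi =>
    hf.warr i (by simp [ops, Program.instrs, Instr.warrs, hi])
  have tx : ∀ i, τ.xarr i = σ.xarr i := fun i =>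
    hf.xarr i (by simp [ops, Program.instrs, Instr.xarrs])
  have t0 := tw 0 (by decide)
  have t1 := tw 1 (by decide)
  have t4 : τ.wreg 4 = σ.wreg 4 := hf.wreg 4 (by decide)
  have hhist : τ.history = σ.history := by simp [Memory.history, tx, tw]
  have hK : ∀ e ∈ K, σ.warr 0 e ≠ u := fun e he heu =>
    (h.kept e he).2.2.2.2.2 (by rw [heu]; exact List.mem_cons_self)
  refine ⟨by rw [hhist, t4, tx]; exact h.derives, (hf.wreg 9 (by decide)).trans h.wzero,
    (hf.xreg 0 (by decide)).trans h.xzero, ⟨?_, ?_, ?_, ?_, ?_⟩, ?_, h.lists.nodup u huV, ?_, ?_,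
    by rw [t0, t1]; exact h.inj,
    (hf.wreg 20 (by decide)).trans h.count, h.inn_kept, ?_, ?_, ?_,
    by rw [tw 9 (by decide)]; exact h.sum, ?_⟩
  · intro v hv
    rw [h5, tw 6 (by decide)]
    by_cases hvu : v = u
    · subst hvu; simp [Chained]
    · simpa [hvu] using h.lists.out v hv
  · intro v hv
    rw [tw 7 (by decide), tw 8 (by decide)]
    exact h.lists.inn v hv
  · intro v hv e he
    rw [t0, t1, t4]
    by_cases hvu : v = u
    · subst hvu; simp at he
    · rw [Function.update_of_ne hvu] at he
      exact h.lists.out_mem v hv e he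
  · rw [t0, t1, t4]; exact h.lists.inn_mem
  · intro v hv
    by_cases hvu : v = u
    · subst hvu; simp
    · rw [Function.update_of_ne hvu]; exact h.lists.nodup v hv
  · intro v hv
    rw [Function.update_of_ne (fun h' : v = u => hu (h' ▸ hv))]
    exact h.old v (List.mem_cons_of_mem _ hv)
  · intro e he
    rw [t0, t1, t4]
    obtain ⟨c1, c2, c3⟩ := h.lists.out_mem u huV e he
    exact ⟨c1, c2, c3, fun hk => hK e hk c2⟩
  · intro e he
    rw [t0, t1, t4, tx]
    obtain ⟨c1, c2, c3, c4, c5, c6⟩ := h.kept e he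
    exact ⟨c1, c2, c3, c4, c5, fun h' => c6 (List.mem_cons_of_mem _ h')⟩
  · intro v hv hvr e he
    by_cases hvu : v = u
    · subst hvu; simp at he
    · rw [Function.update_of_ne hvu] at he
      exact h.out_kept v hv (by simp [hvu, hvr]) e he
  · intro e he hF hl
    rw [t4] at he
    rw [tx] at hF
    rw [t0, t1] at hl ⊢
    obtain ⟨c1, c2, c3⟩ := h.covers e he hF hl
    refine ⟨c1, c2, ?_⟩
    have c3 := c3.resolve_left (by simp)
    by_cases hvu : σ.warr 0 e = u
    · exact Or.inl (hvu ▸ c3.1)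
    · rw [Function.update_of_ne hvu]
      exact Or.inr ⟨c3.1, fun hr => c3.2 (by simp [hvu, hr])⟩
  · intro v hv
    rw [tw 9 (by decide)]
    have := h.len v hv
    by_cases hvu : v = u
    · subst hvu
      rw [if_neg hu, Function.update_self]
      simp at this ⊢
      exact this
    · rw [Function.update_of_ne hvu]
      simpa [hvu] using this
  · intro e he heu
    rw [t0] at heu
    exact absurd heu (hK e he)

theorem Rebuilding.tidy {σ : Memory}
    (h : Rebuilding n p q N₀ A F₀ V Oold σ [] u [] K O I) : Tidy n p q N₀ A F₀ V σ O I :=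
  ⟨h.derives, h.wzero, h.lists, fun e he hF hl => by
    obtain ⟨c1, c2, c3⟩ := h.covers e he hF hl
    have c3 := c3.resolve_left (by simp)
    exact ⟨c1, c2, c3.1, c3.2 (by simp)⟩, fun v hv => by simpa using h.len v hv⟩

/-- The kept arcs are nonzero, which gives the first bound, and each is determined by its pair of
ends in `V`, which gives the second. -/
theorem Rebuilding.card_le {σ : Memory}
    (h : Rebuilding n p q N₀ A F₀ V Oold σ rest u l K O I) : K.card ≤ N₀ ∧ K.card ≤ V.card ^ 2 := by
  constructor
  · refine le_trans (Finset.card_le_card fun e he => ?_) h.derives.sane.card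
    obtain ⟨c1, c2, -⟩ := h.kept e he
    simp [c1, c2]
  · rw [sq, ← Finset.card_product]
    refine Finset.card_le_card_of_injOn (fun e => (σ.warr 0 e, σ.warr 1 e)) ?_ ?_
    · intro e he
      obtain ⟨-, -, -, c4, c5, -⟩ := h.kept e he
      simp [c4, c5]
    · intro e he e' he' heq
      simp only [Prod.mk.injEq] at heq
      exact h.inj e he e' he' heq.1 heq.2

theorem runs_rebuildLoop {σ₀ : Memory} {nodes : List ℕ} (h10 : σ₀.wreg 10 = 0)
    (h5 : σ₀.wreg 5 = nodes.length) (hseg : Segment (σ₀.warr 10) 0 nodes) (hnd : nodes.Nodup)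
    (h : Rebuilding n p q N₀ A F₀ nodes.toFinset O σ₀ nodes 0 [] ∅ O fun _ => []) :
    Runs rebuildLoop σ₀ fun k τ => k ≤ (nodes.map fun v => 41 * (O v).length + 6).sum + 1 ∧
      ∃ M O' I', τ.wreg 20 = M ∧ Tidy n p q N₀ A F₀ nodes.toFinset τ O' I' ∧
        ∑ v ∈ nodes.toFinset, τ.warr 9 v = 2 * M ∧ M ≤ N₀ ∧ M ≤ nodes.length ^ 2 := by
  refine Runs.loop (fun t τ => ∃ rest u K O' I', τ.wreg 10 + rest.length = nodes.length ∧
    Segment (τ.warr 10) (τ.wreg 10) rest ∧ rest.Nodup ∧ rest ⊆ nodes ∧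
    Rebuilding n p q N₀ A F₀ nodes.toFinset O τ rest u [] K O' I' ∧
    t = (rest.map fun v => 41 * (O v).length + 6).sum) _
    ⟨nodes, 0, ∅, O, _, by omega, by rwa [h10], hnd, List.Subset.refl _, h, rfl⟩ ?_ ?_
  · rintro t σ hf ⟨rest, u', K, O', I', hlen, hs, hn, hsub, hR, rfl⟩ hb
    have e5 : σ.wreg 5 = nodes.length := (hf.wreg 5 (by decide)).trans h5
    simp only [Test.holds, e5] at hb
    obtain _ | ⟨u, rest⟩ := rest
    · simp only [List.length_nil] at hlen; omega
    have hu : u ∉ rest := (List.nodup_cons.1 hn).1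
    have huV : u ∈ nodes.toFinset := List.mem_toFinset.2 (hsub (by simp))
    refine Runs.seq (R := fun k τ => k = 3 ∧ τ.wreg 11 = u ∧ τ.warr 10 = σ.warr 10 ∧
      τ.wreg 10 = σ.wreg 10 ∧ Chained (τ.warr 6) (τ.wreg 14) (O u) ∧
      ∃ K O' I', Rebuilding n p q N₀ A F₀ nodes.toFinset O τ rest u (O u) K O' I')
      (Runs.ops_frame fun τ hfτ hτ => ⟨rfl, by simp [hτ, Instr.effect, hs.1],
        hfτ.warr 10 (by decide), hfτ.wreg 10 (by decide), ?_, K, _, I',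
        hR.old u (by simp) ▸ hR.start hu huV hfτ (by simp [hτ, Instr.effect, hs.1, hR.wzero])⟩) ?_
    · have t14 : τ.wreg 14 = σ.warr 5 u := by simp [hτ, Instr.effect, hs.1]
      rw [t14, hfτ.warr 6 (by decide), ← hR.old u (by simp)]
      exact hR.lists.out u huV
    rintro k₁ σ₁ - ⟨rfl, g11, gR, g10, hc, K₁, O₁, I₁, hR₁⟩
    refine Runs.seq (R := fun k τ => k ≤ 41 * (O u).length + 1 ∧ ∃ K O' I',
      Rebuilding n p q N₀ A F₀ nodes.toFinset O τ rest u [] K O' I')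
      (Runs.loop (fun t τ => ∃ l K O' I', Chained (τ.warr 6) (τ.wreg 14) l ∧
        Rebuilding n p q N₀ A F₀ nodes.toFinset O τ rest u l K O' I' ∧ t = 41 * l.length) _
        ⟨O u, K₁, O₁, I₁, hc, hR₁, rfl⟩ ?_ ?_) ?_
    · rintro t τ hfτ ⟨l, K', O', I', hc', hR', rfl⟩ hb'
      obtain _ | ⟨e, l⟩ := l
      · exact absurd (hc'.trans hR'.wzero.symm) hb'
      refine (runs_rebuildArc hu ((hfτ.wreg 11 (by decide)).trans g11) hc' hR').mono ?_
      rintro k ρ - ⟨hk, hc'', K'', O'', I'', hR''⟩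
      exact ⟨41 * l.length, ⟨l, K'', O'', I'', hc'', hR'', rfl⟩, by
        simp only [List.length_cons]; omega⟩
    · rintro k t τ hfτ ⟨l, K', O', I', hc', hR', rfl⟩ hb' hk
      obtain _ | ⟨e, l⟩ := l
      · exact ⟨by omega, K', O', I', hR'⟩
      · refine absurd ?_ hb'
        simp only [Test.holds, hc'.1, hR'.wzero]
        omega
    rintro k₂ σ₂ hf₂ ⟨hk₂, K₂, O₂, I₂, hR₂⟩
    refine Runs.ops_frame fun τ hfτ hτ => ⟨(rest.map fun v => 41 * (O v).length + 6).sum,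
      ⟨rest, u, K₂, O₂, I₂, ?_, ?_, (List.nodup_cons.1 hn).2,
        fun v hv => hsub (List.mem_cons_of_mem _ hv), ?_, rfl⟩, ?_⟩
    · have t10 : τ.wreg 10 = σ₂.wreg 10 + 1 := by simp [hτ, Instr.effect]
      rw [t10, hf₂.wreg 10 (by decide), g10]
      simp only [List.length_cons] at hlen
      omega
    · have t10 : τ.wreg 10 = σ₂.wreg 10 + 1 := by simp [hτ, Instr.effect]
      rw [t10, hf₂.wreg 10 (by decide), g10, hfτ.warr 10 (by decide), hf₂.warr 10 (by decide), gR]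
      exact hs.2
    · exact hR₂.congr (fun i => hfτ.warr i (by simp [ops, Program.instrs, Instr.warrs]))
        (fun i => hfτ.xarr i (by simp [ops, Program.instrs, Instr.xarrs]))
        (hfτ.wreg 4 (by decide)) (hfτ.wreg 9 (by decide)) (hfτ.wreg 20 (by decide))
        (hfτ.xreg 0 (by decide))
    · simp only [List.map_cons, List.sum_cons, List.length]
      omega
  · rintro k t τ hf ⟨rest, u', K, O', I', hlen, hs, hn, hsub, hR, rfl⟩ hb hk
    have e5 : τ.wreg 5 = nodes.length := (hf.wreg 5 (by decide)).trans h5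
    simp only [Test.holds, e5] at hb
    obtain rfl : rest = [] := List.length_eq_zero_iff.1 (by omega)
    refine ⟨by omega, K.card, O', I', hR.count, hR.tidy, hR.sum, hR.card_le.1,
      hR.card_le.2.trans (Nat.pow_le_pow_left (List.toFinset_card_le _) 2)⟩

set_option maxHeartbeats 1000000 in
/-- A phase reduces the number of the remaining inner nodes by a constant factor. -/
theorem runs_phase {σ₀ : Memory} {L : List ℕ} (hL : L ≠ [])
    (h : Ready n p q N₀ A F₀ σ₀ L O I) :
    Runs phase σ₀ fun k τ => ∃ M L' O' I', Ready n p q N₀ A F₀ τ L' O' I' ∧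
      k ≤ 220 * (∑ v ∈ present n p q L, σ₀.warr 9 v + (p + q) + L.length + M) ∧
      M ≤ N₀ ∧ M ≤ (p + q + L.length) ^ 2 ∧ 6 * L'.length ≤ 5 * L.length ∧
      ∑ v ∈ present n p q L', τ.warr 9 v ≤ 10 * M + 8 * L.length := by
  have hi : 0 < L.length := List.length_pos_of_ne_nil hL
  have hlenT : (terminals n p q).length = p + q := by simp [terminals]
  set nodes := terminals n p q ++ L with hnodes
  have hlen : nodes.length = p + q + L.length := by rw [hnodes, List.length_append, hlenT]
  have hnd : nodes.Nodup := by
    refine List.Nodup.append List.nodup_range' h.nodup ?_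
    intro v hv hv'
    simp only [terminals, List.mem_range'_1] at hv
    have := h.lt v hv'
    omega
  have hV : present n p q L = nodes.toFinset := rfl
  refine Runs.seq (R := fun k τ => k = 1 ∧ τ.wreg 10 = 0)
    (Runs.ops fun τ hτ => ⟨rfl, by simp [hτ, Instr.effect]⟩) ?_
  rintro k₁ σ₁ hf₁ ⟨rfl, h₁10⟩
  have gw : ∀ i, σ₁.warr i = σ₀.warr i := fun i =>
    hf₁.warr i (by simp [ops, Program.instrs, Instr.warrs])
  refine Runs.seq (runs_resetLoop (l := nodes) h₁10 ((hf₁.wreg 9 (by decide)).trans h.wzero)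
    (by rw [gw]; exact h.nodes) (by rw [hf₁.wreg 5 (by decide), h.count, hlen])) ?_
  rintro k₂ σ₂ hf₂ ⟨hk₂, h₂⟩
  refine Runs.seq (R := fun k τ => k = 2 ∧ τ.wreg 10 = 0 ∧ τ.wreg 20 = 0)
    (Runs.ops fun τ hτ => ⟨rfl, by simp [hτ, Instr.effect], by simp [hτ, Instr.effect]⟩) ?_
  rintro k₃ σ₃ hf₃ ⟨rfl, h₃10, h₃20⟩
  have iw : ∀ i, i ≠ 7 → i ≠ 9 → σ₃.warr i = σ₀.warr i := fun i hi hi' =>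
    (hf₃.warr i (by simp [ops, Program.instrs, Instr.warrs])).trans <|
    (hf₂.warr i (by simp [resetLoop, ops, Program.instrs, Instr.warrs, hi, hi'])).trans (gw i)
  have iw' : ∀ i, σ₃.warr i = σ₂.warr i := fun i =>
    hf₃.warr i (by simp [ops, Program.instrs, Instr.warrs])
  have ix : ∀ i, σ₃.xarr i = σ₀.xarr i := fun i =>
    (hf₃.xarr i (by simp [ops, Program.instrs, Instr.xarrs])).trans <|
    (hf₂.xarr i (by simp [resetLoop, ops, Program.instrs, Instr.xarrs])).trans
    (hf₁.xarr i (by simp [ops, Program.instrs, Instr.xarrs]))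
  have ir : ∀ i, i ∉ [10, 20, 23] → σ₃.wreg i = σ₀.wreg i := fun i hi => by
    simp only [List.mem_cons, List.not_mem_nil, or_false, not_or] at hi
    exact (hf₃.wreg i (by simp [ops, Program.instrs, Instr.wregs, hi])).trans <|
      (hf₂.wreg i (by simp [resetLoop, ops, Program.instrs, Instr.wregs, hi])).trans
      (hf₁.wreg i (by simp [ops, Program.instrs, Instr.wregs, hi]))
  have i0 : σ₃.xreg 0 = 0 := (hf₃.xreg 0 (by decide)).trans <|
    (hf₂.xreg 0 (by decide)).trans <| (hf₁.xreg 0 (by decide)).trans h.xzero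
  have i4 := ir 4 (by decide)
  have i5 : σ₃.wreg 5 = nodes.length := by rw [ir 5 (by decide), h.count, hlen]
  have i7 : ∀ v ∈ nodes, σ₃.warr 7 v = 0 ∧ σ₃.warr 9 v = 0 := by rw [iw', iw']; exact h₂
  have w0 := iw 0 (by decide) (by decide)
  have w1 := iw 1 (by decide) (by decide)
  have hR : Rebuilding n p q N₀ A F₀ nodes.toFinset O σ₃ nodes 0 [] ∅ O fun _ => [] := by
    refine ⟨?_, (ir 9 (by decide)).trans h.wzero, i0, ⟨?_, ?_, ?_, by simp, ?_⟩, fun _ _ => rfl,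
      List.nodup_nil, by simp, by simp, by simp, by simpa using h₃20, by simp, ?_, ?_, ?_, ?_,
      by simp⟩
    · have hhist : σ₃.history = σ₀.history := by simp [Memory.history, ix, iw]
      rw [hhist, i4, ix]; exact h.derives
    · rw [iw 5 (by decide) (by decide), iw 6 (by decide) (by decide)]; exact h.lists.out
    · intro v hv
      exact (i7 v (List.mem_toFinset.1 hv)).1
    · rw [w0, w1, i4]; exact h.lists.out_mem
    · exact h.lists.nodup
    · intro v hv hv'
      exact absurd (List.mem_toFinset.1 hv) hv'
    · rw [w0, w1, i4, ix]
      intro e he hF hl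
      obtain ⟨c1, c2, c3, c4⟩ := h.covers e he hF hl
      exact ⟨c1, c2, Or.inr ⟨c3, fun h' => absurd (List.mem_toFinset.1 c1) h'⟩⟩
    · intro v hv
      simp [List.mem_toFinset.1 hv]
    · rw [Finset.card_empty, mul_zero]
      exact Finset.sum_eq_zero fun v hv => (i7 v (List.mem_toFinset.1 hv)).2
  refine Runs.seq (runs_rebuildLoop h₃10 i5 (by
    rw [iw 10 (by decide) (by decide)]; exact h.nodes) hnd hR) ?_
  rintro k₄ σ₄ hf₄ ⟨hk₄, M, O₄, I₄, h₄20, hT₄, hsum₄, hM, hM'⟩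
  -- Every old list of leaving arcs is no longer than the counter of its node.
  have hk₄' : k₄ ≤ 41 * ∑ v ∈ present n p q L, σ₀.warr 9 v + 6 * nodes.length + 1 := by
    refine hk₄.trans (Nat.add_le_add_right ?_ 1)
    rw [List.sum_map_add, List.sum_map_mul_left, List.map_const', List.sum_replicate, smul_eq_mul,
      mul_comm nodes.length]
    refine Nat.add_le_add_right (Nat.mul_le_mul_left _ ?_) _
    rw [hV, ← List.sum_toFinset _ hnd]
    refine Finset.sum_le_sum fun v hv => ?_
    have := h.len v hv
    omega
  have j6 : σ₄.wreg 6 = p + q :=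
    (hf₄.wreg 6 (by decide)).trans ((ir 6 (by decide)).trans h.terminals)
  refine Runs.seq (R := fun k τ => k = 3 ∧ τ.wreg 21 = 4 ∧ τ.wreg 22 = p + q ∧ τ.wreg 10 = 0)
    (Runs.ops fun τ hτ => ⟨rfl, by simp [hτ, Instr.effect], by simp [hτ, Instr.effect, j6],
      by simp [hτ, Instr.effect]⟩) ?_
  rintro k₅ σ₅ hf₅ ⟨rfl, h₅21, h₅22, h₅10⟩
  have l6 : σ₅.wreg 6 = p + q := (hf₅.wreg 6 (by decide)).trans j6
  have l5 : σ₅.wreg 5 = p + q + L.length := (hf₅.wreg 5 (by decide)).trans <|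
    (hf₄.wreg 5 (by decide)).trans (i5.trans hlen)
  refine Runs.seq (runs_thresholdLoop (i := L.length) (M := M) h₅10
    ((hf₅.wreg 20 (by decide)).trans h₄20) h₅21 (h₅22.trans l6.symm) (by rw [l5, l6]) hi) ?_
  rintro k₆ σ₆ hf₆ ⟨hk₆, hD, hD', hDpos⟩
  have m6 : σ₆.wreg 6 = p + q := (hf₆.wreg 6 (by decide)).trans l6
  refine Runs.seq (R := fun k τ => k = 2 ∧ τ.wreg 10 = p + q ∧ τ.wreg 24 = p + q)
    (Runs.ops fun τ hτ => ⟨rfl, by simp [hτ, Instr.effect, m6], by simp [hτ, Instr.effect, m6]⟩) ?_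
  rintro k₇ σ₇ hf₇ ⟨rfl, h₇10, h₇24⟩
  have n21 : σ₇.wreg 21 = σ₆.wreg 21 := hf₇.wreg 21 (by decide)
  have n5 : σ₇.wreg 5 = p + q + L.length := (hf₇.wreg 5 (by decide)).trans <|
    (hf₆.wreg 5 (by decide)).trans l5
  have nw : ∀ i, σ₇.warr i = σ₄.warr i := fun i =>
    (hf₇.warr i (by simp [ops, Program.instrs, Instr.warrs])).trans <|
    (hf₆.warr i (by simp [thresholdLoop, block, ops, Program.instrs, Instr.warrs])).trans
    (hf₅.warr i (by simp [ops, Program.instrs, Instr.warrs]))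
  have nx : ∀ i, σ₇.xarr i = σ₄.xarr i := fun i =>
    (hf₇.xarr i (by simp [ops, Program.instrs, Instr.xarrs])).trans <|
    (hf₆.xarr i (by simp [thresholdLoop, block, ops, Program.instrs, Instr.xarrs])).trans
    (hf₅.xarr i (by simp [ops, Program.instrs, Instr.xarrs]))
  have hT₇ : Tidy n p q N₀ A F₀ (present n p q L) σ₇ O₄ I₄ := hT₄.congr (fun i _ => nw i) nx
    ((hf₇.wreg 4 (by decide)).trans <| (hf₆.wreg 4 (by decide)).trans (hf₅.wreg 4 (by decide)))
    ((hf₇.wreg 9 (by decide)).trans <| (hf₆.wreg 9 (by decide)).trans (hf₅.wreg 9 (by decide)))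
  refine Runs.seq (runs_eliminateLoop h₇10 h₇24 n21 n5 (by
    rw [nw, hf₄.warr 10 (by decide), iw 10 (by decide) (by decide)]; exact h.nodes) h.nodup h.lt
    hT₇) ?_
  rintro k₈ σ₈ hf₈ ⟨hk₈, L', O', I', h₈24, hseg, hnd', hlt', hT', hlow, hle, hsum⟩
  have r6 : σ₈.wreg 6 = p + q := (hf₈.wreg 6 (by decide)).trans <|
    (hf₇.wreg 6 (by decide)).trans m6
  have r0 : σ₈.xreg 0 = 0 := (hf₈.xreg 0 (by decide)).trans <| (hf₇.xreg 0 (by decide)).trans <|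
    (hf₆.xreg 0 (by decide)).trans <| (hf₅.xreg 0 (by decide)).trans <|
    (hf₄.xreg 0 (by decide)).trans i0
  refine Runs.ops_frame fun τ hfτ hτ => ?_
  have tw : ∀ i, τ.warr i = σ₈.warr i := fun i =>
    hfτ.warr i (by simp [ops, Program.instrs, Instr.warrs])
  have tx : ∀ i, τ.xarr i = σ₈.xarr i := fun i =>
    hfτ.xarr i (by simp [ops, Program.instrs, Instr.xarrs])
  have t5 : τ.wreg 5 = σ₈.wreg 24 := by simp [hτ, Instr.effect]
  have hT : Tidy n p q N₀ A F₀ (present n p q L') τ O' I' :=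
    hT'.congr (fun i _ => tw i) tx (hfτ.wreg 4 (by decide)) (hfτ.wreg 9 (by decide))
  rw [nw] at hsum
  rw [← hV] at hsum₄
  rw [hsum₄] at hsum
  set D := σ₆.wreg 21 with hDdef
  -- Each survivor has a counter above `D`.
  have hsurv : L'.length * D ≤ ∑ v ∈ present n p q L', σ₈.warr 9 v := by
    calc L'.length * D = ∑ v ∈ L'.toFinset, D := by
          rw [Finset.sum_const, List.toFinset_card_of_nodup hnd', smul_eq_mul]
      _ ≤ ∑ v ∈ L'.toFinset, σ₈.warr 9 v :=
          Finset.sum_le_sum fun v hv => (hlow v (List.mem_toFinset.1 hv)).le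
      _ ≤ ∑ v ∈ present n p q L', σ₈.warr 9 v := by
          refine Finset.sum_le_sum_of_subset fun v hv => ?_
          simp only [present, List.mem_toFinset, List.mem_append] at hv ⊢
          exact Or.inr hv
  obtain ⟨x, hx⟩ := Nat.exists_eq_add_of_le hle
  -- After the rebuilding the counters sum to `2 * M`, and each of the `x` eliminations adds at most
  -- `2 * D`, so `D * L' ≤ 2 * M + 2 * D * x` for the number `L'` of survivors. With `4 * M ≤ D *
  -- (L' + x)` this gives `2 * L' ≤ L' + 5 * x`, that is, `L' ≤ 5 * x`.
  have hfinal : 6 * L'.length ≤ 5 * L.length := by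
    have h1 : L'.length * D ≤ 2 * M + 2 * D * x := by
      refine hsurv.trans (hsum.trans_eq ?_)
      rw [show L.length - L'.length = x by omega]
    rw [hx] at hD ⊢
    have h2 : 2 * (L'.length * D) ≤ D * (L'.length + x) + 4 * (D * x) := by linarith
    have h3 : D * (2 * L'.length) ≤ D * (L'.length + x + 4 * x) := by linarith
    have h4 := Nat.le_of_mul_le_mul_left h3 hDpos
    omega
  refine ⟨M, L', O', I', ⟨hT.derives, by rwa [tw], t5.trans h₈24,
    (hfτ.wreg 6 (by decide)).trans r6, hT.wzero, (hfτ.xreg 0 (by decide)).trans r0, hnd', hlt',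
    hT.lists, hT.covers, hT.len⟩, ?_, hM, hlen ▸ hM', hfinal, ?_⟩
  · have h5 : (42 * D + 20) * L.length = 42 * (D * L.length) + 20 * L.length := by ring
    rw [h5] at hk₈
    simp only [List.length]
    omega
  · rw [tw]
    refine hsum.trans ?_
    -- The final sum is at most `2 * M + 2 * D * i`, and `D * i ≤ 4 * M + 4 * i` for `i = L.length`.
    have : D * (L.length - L'.length) ≤ D * L.length := Nat.mul_le_mul_left _ (Nat.sub_le _ _)
    rw [mul_assoc]
    omega

end

end FlowDecomp

namespace FlowDecomp

/-! ### The phases together -/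

/-- Applied to register 4, this bounds the number of arcs created by the number of steps, so
creations need no separate count. -/
theorem Exec.wreg_le {P : Program} {σ τ : Memory} {k d : ℕ} (h : Exec P σ k τ)
    (hP : ∀ i ∈ P.instrs, d ∉ i.wregs ∨ i = .wsucc d) : τ.wreg d ≤ σ.wreg d + k := by
  induction h with
  | skip σ => exact le_rfl
  | op i σ =>
    rcases hP i (by simp [Program.instrs]) with h | rfl
    · rw [(Frame.op i σ).wreg d (by simpa [Program.instrs] using h)]
      omega
    · simp [Instr.effect]
  | seq _ _ h₁ h₂ =>
    have := h₁ fun i hi => hP i (List.mem_append_left _ hi)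
    have := h₂ fun i hi => hP i (List.mem_append_right _ hi)
    omega
  | branch_true _ _ h =>
    have := h fun i hi => hP i (List.mem_append_left _ hi)
    omega
  | branch_false _ _ h =>
    have := h fun i hi => hP i (List.mem_append_right _ hi)
    omega
  | loop_true _ _ _ h₁ h₂ =>
    have := h₁ hP
    have := h₂ hP
    omega
  | loop_false _ => omega

/-- A program that writes the array `a` only at the address in the register `d`, which it only
increments, preserves the cells of `a` below that address. -/
theorem Exec.warr_eq {P : Program} {σ τ : Memory} {k a d : ℕ} (h : Exec P σ k τ)
    (hP : ∀ i ∈ P.instrs, d ∉ i.wregs ∨ i = .wsucc d)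
    (hP' : ∀ i ∈ P.instrs, a ∉ i.warrs ∨ ∃ b, i = .wstore a d b) :
    σ.wreg d ≤ τ.wreg d ∧ ∀ j < σ.wreg d, τ.warr a j = σ.warr a j := by
  induction h with
  | skip σ => exact ⟨le_rfl, fun _ _ => rfl⟩
  | op i σ =>
    constructor
    · rcases hP i (by simp [Program.instrs]) with h | rfl
      · rw [(Frame.op i σ).wreg d (by simpa [Program.instrs] using h)]
      · simp [Instr.effect]
    · rcases hP' i (by simp [Program.instrs]) with h | ⟨b, rfl⟩
      · rw [(Frame.op i σ).warr a (by simpa [Program.instrs] using h)]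
        exact fun _ _ => rfl
      · intro j hj
        simp [Instr.effect, hj.ne]
  | seq _ _ h₁ h₂ =>
    obtain ⟨h₁, h₁'⟩ := h₁ (fun i hi => hP i (List.mem_append_left _ hi))
      fun i hi => hP' i (List.mem_append_left _ hi)
    obtain ⟨h₂, h₂'⟩ := h₂ (fun i hi => hP i (List.mem_append_right _ hi))
      fun i hi => hP' i (List.mem_append_right _ hi)
    exact ⟨h₁.trans h₂, fun j hj => (h₂' j (hj.trans_le h₁)).trans (h₁' j hj)⟩
  | branch_true _ _ h =>
    exact h (fun i hi => hP i (List.mem_append_left _ hi))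
      fun i hi => hP' i (List.mem_append_left _ hi)
  | branch_false _ _ h =>
    exact h (fun i hi => hP i (List.mem_append_right _ hi))
      fun i hi => hP' i (List.mem_append_right _ hi)
  | loop_true _ _ _ h₁ h₂ =>
    obtain ⟨h₁, h₁'⟩ := h₁ hP hP'
    obtain ⟨h₂, h₂'⟩ := h₂ hP hP'
    exact ⟨h₁.trans h₂, fun j hj => (h₂' j (hj.trans_le h₁)).trans (h₁' j hj)⟩
  | loop_false _ => exact ⟨le_rfl, fun _ _ => rfl⟩

/-- A bound on the number of steps that remain when the inner nodes in a list of length `i` and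
`d` entries of lists of arcs remain. -/
noncomputable def potential (K μ : ℕ) (i d : ℕ) : ℝ :=
  220 * d + 15840 * (K + 1) ^ 2 * (μ * Real.log (1 + (i : ℝ) ^ 2 / μ)) + 6 * (220 * K + 1981) * i

theorem potential_nonneg (K μ i d : ℕ) : 0 ≤ potential K μ i d := by
  have : 0 ≤ Real.log (1 + (i : ℝ) ^ 2 / μ) :=
    Real.log_nonneg (le_add_of_nonneg_right (by positivity))
  unfold potential
  positivity

/-- The constants balance as follows. A phase costs `220 * (d + K + i + M)`, and up to `10 * M + 8 *
i` list entries remain afterwards, so besides `220 * d` one needs `2420 * M + 220 * K + 1980 * i +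
1`. The logarithmic term yields the part with `M`, as `15840 * (11 / 72) = 2420`; the linear term
drops by at least `(220 * K + 1981) * i`, which covers the rest because `1 ≤ i`. -/
theorem potential_le {K μ i i' d d' M k : ℕ} (hμ : 0 < μ) (hi : 0 < i) (hi' : 6 * i' ≤ 5 * i)
    (hM : M ≤ μ) (hM' : M ≤ (K + i) ^ 2) (hd : d' ≤ 10 * M + 8 * i)
    (hk : k ≤ 220 * (d + K + i + M)) : k + 1 + potential K μ i' d' ≤ potential K μ i d := by
  have hlog := min_le_log_sub_log (μ := μ) (x := i) (y := i') (by exact_mod_cast hμ)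
    (Nat.cast_nonneg _) (by exact_mod_cast hi')
  have hK : (1 : ℝ) ≤ (K + 1) ^ 2 := one_le_pow₀ (by linarith [Nat.cast_nonneg (α := ℝ) K])
  have h1 : (1 : ℝ) ≤ i := by exact_mod_cast hi
  -- As `i ≥ 1`, one has `K + i ≤ (K + 1) * i`; the terminals cost only the factor `(K + 1) ^ 2`.
  have hmin : (M : ℝ) ≤ (K + 1) ^ 2 * min (μ : ℝ) (i ^ 2) := by
    rcases min_choice (μ : ℝ) (i ^ 2) with h | h
    · rw [h]
      have : (M : ℝ) ≤ μ := by exact_mod_cast hM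
      nlinarith [Nat.cast_nonneg (α := ℝ) μ]
    · rw [h, ← mul_pow]
      have : (M : ℝ) ≤ (K + i) ^ 2 := by exact_mod_cast hM'
      refine this.trans (pow_le_pow_left₀ (by positivity) ?_ 2)
      nlinarith [Nat.cast_nonneg (α := ℝ) K]
  have hd : (d' : ℝ) ≤ 10 * M + 8 * i := by exact_mod_cast hd
  have hk : (k : ℝ) ≤ 220 * (d + K + i + M) := by exact_mod_cast hk
  have hi' : 6 * (i' : ℝ) ≤ 5 * i := by exact_mod_cast hi'
  have hKi : (K : ℝ) ≤ K * i := le_mul_of_one_le_right (Nat.cast_nonneg _) h1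
  have h2 := mul_le_mul_of_nonneg_left hlog (show (0 : ℝ) ≤ 15840 * (K + 1) ^ 2 by positivity)
  have h3 := mul_le_mul_of_nonneg_left hi' (show (0 : ℝ) ≤ 220 * K + 1981 by positivity)
  have h4 : 15840 * ((K : ℝ) + 1) ^ 2 * (11 / 72 * min (μ : ℝ) (i ^ 2)) =
      2420 * ((K + 1) ^ 2 * min (μ : ℝ) (i ^ 2)) := by ring
  rw [h4] at h2
  unfold potential
  linarith

theorem phase_wregs : ∀ i ∈ phase.instrs, 4 ∉ i.wregs ∨ i = .wsucc 4 := by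
  simp [phase, resetLoop, rebuildLoop, rebuildArc, compareTail, merge, thresholdLoop,
    eliminateLoop, eliminate, splice, push, block, ops, Program.instrs, Instr.wregs]

/-- Tails and heads are written only at the next free arc number, so the initial arcs keep their
ends through all phases. -/
theorem phase_warrs (a : ℕ) (ha : a < 2) :
    ∀ i ∈ phase.instrs, a ∉ i.warrs ∨ ∃ b, i = .wstore a 4 b := by
  have h : ∀ i ∈ phase.instrs, i.warrs.all (2 ≤ ·) ∨ ∃ a b, i = .wstore a 4 b := by
    simp [phase, resetLoop, rebuildLoop, rebuildArc, compareTail, merge, thresholdLoop,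
      eliminateLoop, eliminate, splice, push, block, ops, Program.instrs, Instr.warrs]
  intro i hi
  rcases h i hi with h | ⟨a', b, rfl⟩
  · refine Or.inl fun h' => ?_
    have := List.all_eq_true.1 h a h'
    simp at this
    omega
  · by_cases haa : a = a'
    · exact Or.inr ⟨b, by rw [haa]⟩
    · exact Or.inl (by simpa [Instr.warrs] using haa)

/-- The loop rule is used with the potential, rounded up, as the credit; the rounding and the last
test account for the `+ 2`. -/
theorem runs_eliminations {n p q N₀ : ℕ} {A : AddSubgroup ℝ} {F₀ : ℕ → ℝ} {L : List ℕ}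
    {O I : ℕ → List ℕ} {σ₀ : Memory} (hN₀ : 0 < N₀) (h : Ready n p q N₀ A F₀ σ₀ L O I) :
    Runs (.loop (.wlt 6 5) phase) σ₀ fun k τ => (∃ O I, Ready n p q N₀ A F₀ τ [] O I) ∧
      τ.wreg 4 ≤ σ₀.wreg 4 + k ∧
      (∀ e < σ₀.wreg 4, τ.warr 0 e = σ₀.warr 0 e ∧ τ.warr 1 e = σ₀.warr 1 e) ∧
      (k : ℝ) ≤ potential (p + q) N₀ L.length (∑ v ∈ present n p q L, σ₀.warr 9 v) + 2 := by
  have key : Runs (.loop (.wlt 6 5) phase) σ₀ fun k τ => (∃ O I, Ready n p q N₀ A F₀ τ [] O I) ∧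
      (k : ℝ) ≤ potential (p + q) N₀ L.length (∑ v ∈ present n p q L, σ₀.warr 9 v) + 2 := by
    refine Runs.loop (fun t τ => ∃ L O I, Ready n p q N₀ A F₀ τ L O I ∧
      potential (p + q) N₀ L.length (∑ v ∈ present n p q L, τ.warr 9 v) ≤ t) _
      ⟨L, O, I, h, Nat.le_ceil _⟩ ?_ ?_
    · rintro t σ - ⟨L, O, I, hR, ht⟩ hb
      have hL : L ≠ [] := by
        rintro rfl
        have h1 := hR.count
        have h2 := hR.terminals
        simp only [Test.holds, h1, h2, List.length_nil] at hb
        omega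
      refine (runs_phase hL hR).mono ?_
      rintro k τ - ⟨M, L', O', I', hR', hk, hM, hM', hL', hs⟩
      have := potential_le (K := p + q) hN₀ (List.length_pos_of_ne_nil hL) hL' hM hM' hs hk
      have h0 := potential_nonneg (p + q) N₀ L'.length (∑ v ∈ present n p q L', τ.warr 9 v)
      have hkt : k + 1 ≤ t := by
        have : ((k + 1 : ℕ) : ℝ) ≤ t := by push_cast; linarith
        exact_mod_cast this
      refine ⟨t - (k + 1), ⟨L', O', I', hR', ?_⟩, by omega⟩
      rw [Nat.cast_sub hkt]
      push_cast
      linarith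
    · rintro k t τ - ⟨L', O', I', hR, ht⟩ hb hk
      have h1 := hR.count
      have h2 := hR.terminals
      simp only [Test.holds, h1, h2] at hb
      obtain rfl : L' = [] := List.length_eq_zero_iff.1 (by omega)
      refine ⟨⟨O', I', hR⟩, ?_⟩
      have h3 := Nat.ceil_lt_add_one
        (potential_nonneg (p + q) N₀ L.length (∑ v ∈ present n p q L, σ₀.warr 9 v))
      have h4 : (k : ℝ) + t ≤ ⌈potential (p + q) N₀ L.length
        (∑ v ∈ present n p q L, σ₀.warr 9 v)⌉₊ + 1 := by exact_mod_cast hk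
      linarith [Nat.cast_nonneg (α := ℝ) t]
  obtain ⟨k, τ, he, hR, hk⟩ := key
  refine ⟨k, τ, he, hR, he.wreg_le phase_wregs, fun e h4 => ⟨?_, ?_⟩, hk⟩
  · exact (he.warr_eq phase_wregs (phase_warrs 0 (by omega))).2 e h4
  · exact (he.warr_eq phase_wregs (phase_warrs 1 (by omega))).2 e h4

end FlowDecomp

namespace FlowDecomp

/-! ### The final assignment -/

/-- Registers 29 and 30 run through the pairs `(n + c / q, n + p + c % q)` in step with `c`, so no
division is needed; register 30 returns to `n + p` when it reaches `n + p + q`. -/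
theorem runs_assignArc {σ₀ : Memory} {n p q : ℕ} (hq : 0 < q) (h31 : σ₀.wreg 31 = 0)
    (h29 : σ₀.wreg 29 = n) (h30 : σ₀.wreg 30 = n + p) (h26 : σ₀.wreg 26 = n + p)
    (h27 : σ₀.wreg 27 = n + p + q) :
    Runs assignArc σ₀ fun k τ => k ≤ 10 * σ₀.wreg 7 + 1 ∧
      τ.wreg 28 = σ₀.wreg 28 + σ₀.wreg 7 ∧
      (∀ c < σ₀.wreg 7, τ.xarr 1 (σ₀.wreg 28 + c) =
        if σ₀.wreg 11 = n + c / q ∧ σ₀.wreg 12 = n + p + c % q then σ₀.xreg 1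
        else σ₀.xarr 1 (σ₀.wreg 28 + c)) ∧
      ∀ i, i < σ₀.wreg 28 ∨ σ₀.wreg 28 + σ₀.wreg 7 ≤ i → τ.xarr 1 i = σ₀.xarr 1 i := by
  refine Runs.loop (fun t σ => σ.wreg 31 ≤ σ₀.wreg 7 ∧ t = 10 * (σ₀.wreg 7 - σ.wreg 31) ∧
    σ.wreg 28 = σ₀.wreg 28 + σ.wreg 31 ∧ σ.wreg 29 = n + σ.wreg 31 / q ∧
    σ.wreg 30 = n + p + σ.wreg 31 % q ∧
    (∀ c < σ.wreg 31, σ.xarr 1 (σ₀.wreg 28 + c) =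
      if σ₀.wreg 11 = n + c / q ∧ σ₀.wreg 12 = n + p + c % q then σ₀.xreg 1
      else σ₀.xarr 1 (σ₀.wreg 28 + c)) ∧
    ∀ i, i < σ₀.wreg 28 ∨ σ₀.wreg 28 + σ.wreg 31 ≤ i → σ.xarr 1 i = σ₀.xarr 1 i) _
    ⟨by omega, rfl, by omega, by simp [h31, h29], by simp [h31, h30], by simp [h31],
      fun _ _ => rfl⟩ ?_ ?_
  · rintro t σ hf ⟨hle, rfl, g28, g29, g30, hdone, hrest⟩ hb
    have e7 : σ.wreg 7 = σ₀.wreg 7 := hf.wreg 7 (by decide)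
    have e11 : σ.wreg 11 = σ₀.wreg 11 := hf.wreg 11 (by decide)
    have e12 : σ.wreg 12 = σ₀.wreg 12 := hf.wreg 12 (by decide)
    have e26 : σ.wreg 26 = n + p := (hf.wreg 26 (by decide)).trans h26
    have e27 : σ.wreg 27 = n + p + q := (hf.wreg 27 (by decide)).trans h27
    have ex : σ.xreg 1 = σ₀.xreg 1 := hf.xreg 1 (by decide)
    simp only [Test.holds, e7] at hb
    set c := σ.wreg 31 with hc
    refine Runs.seq (R := fun k τ => k ≤ 3 ∧ ∀ i, τ.xarr 1 i =
      if i = σ₀.wreg 28 + c ∧ σ₀.wreg 11 = n + c / q ∧ σ₀.wreg 12 = n + p + c % q then σ₀.xreg 1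
      else σ.xarr 1 i) ?_ ?_
    · refine Runs.branch (fun h1 => Runs.branch (fun h2 => Runs.ops fun τ hτ => ⟨le_rfl, ?_⟩)
        fun h2 => Runs.skip ⟨by omega, ?_⟩) fun h1 => Runs.skip ⟨by omega, ?_⟩
      · simp only [Test.holds, e11, e12, g29, g30] at h1 h2
        intro i
        by_cases hi : i = σ₀.wreg 28 + c <;> simp [hτ, Instr.effect, g28, ex, h1, h2, hi]
      · simp only [Test.holds, e11, e12, g29, g30] at h1 h2
        simp [h2]
      · simp only [Test.holds, e11, g29] at h1
        simp [h1]
    rintro k₁ σ₁ hf₁ ⟨hk₁, hx₁⟩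
    refine Runs.seq (R := fun k τ => k = 3 ∧ τ.wreg 28 = σ₀.wreg 28 + (c + 1) ∧ τ.wreg 31 = c + 1 ∧
      τ.wreg 29 = n + c / q ∧ τ.wreg 30 = n + p + c % q + 1 ∧ τ.xarr 1 = σ₁.xarr 1)
      (Runs.ops fun τ hτ => ?_) ?_
    · have f28 : σ₁.wreg 28 = σ.wreg 28 := hf₁.wreg 28 (by decide)
      have f29 : σ₁.wreg 29 = σ.wreg 29 := hf₁.wreg 29 (by decide)
      have f30 : σ₁.wreg 30 = σ.wreg 30 := hf₁.wreg 30 (by decide)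
      have f31 : σ₁.wreg 31 = c := hf₁.wreg 31 (by decide)
      simp [hτ, Instr.effect, f28, f29, f30, f31, g28, g29, g30, add_assoc]
    rintro k₂ σ₂ hf₂ ⟨rfl, h₂28, h₂31, h₂29, h₂30, h₂x⟩
    have h₂26 : σ₂.wreg 26 = n + p := (hf₂.wreg 26 (by decide)).trans <|
      (hf₁.wreg 26 (by decide)).trans e26
    have h₂27 : σ₂.wreg 27 = n + p + q := (hf₂.wreg 27 (by decide)).trans <|
      (hf₁.wreg 27 (by decide)).trans e27
    have hcq : c = c / q * q + c % q := by rw [mul_comm]; exact (Nat.div_add_mod c q).symm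
    have hmod := Nat.mod_lt c hq
    have fin : ∀ τ : Memory, τ.wreg 31 = c + 1 → τ.wreg 28 = σ₀.wreg 28 + (c + 1) →
        τ.xarr 1 = σ₁.xarr 1 →
        (∀ c' < τ.wreg 31, τ.xarr 1 (σ₀.wreg 28 + c') =
          if σ₀.wreg 11 = n + c' / q ∧ σ₀.wreg 12 = n + p + c' % q then σ₀.xreg 1
          else σ₀.xarr 1 (σ₀.wreg 28 + c')) ∧
        ∀ i, i < σ₀.wreg 28 ∨ σ₀.wreg 28 + τ.wreg 31 ≤ i → τ.xarr 1 i = σ₀.xarr 1 i := by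
      intro τ t31 t28 tx
      rw [t31, tx]
      constructor
      · intro c' hc'
        rw [hx₁]
        rcases Nat.lt_succ_iff_lt_or_eq.1 hc' with h1 | rfl
        · rw [if_neg (fun h => by omega), hdone c' h1]
        · simp only [true_and, hrest _ (Or.inr le_rfl)]
      · intro i hi
        rw [hx₁, if_neg (fun h => by omega), hrest i (by omega)]
    refine Runs.branch (fun h1 => Runs.ops fun τ hτ => ?_) (fun h1 => Runs.skip ?_)
    · simp only [Test.holds, h₂30, h₂27] at h1
      have t31 : τ.wreg 31 = c + 1 := by simp [hτ, Instr.effect, h₂31]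
      have t28 : τ.wreg 28 = σ₀.wreg 28 + (c + 1) := by simp [hτ, Instr.effect, h₂28]
      have tx : τ.xarr 1 = σ₁.xarr 1 := by simp [hτ, Instr.effect, h₂x]
      have hc1 : c + 1 = (c / q + 1) * q + 0 := by rw [add_mul]; omega
      obtain ⟨d1, d2⟩ := pair_div_mod (i := c / q + 1) hq
      rw [← hc1] at d1 d2
      refine ⟨10 * (σ₀.wreg 7 - τ.wreg 31), ⟨by omega, rfl, by omega, ?_, ?_, fin τ t31 t28 tx⟩, ?_⟩
      · rw [t31, d1]; simp [hτ, Instr.effect, h₂29, add_assoc]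
      · rw [t31, d2]; simp [hτ, Instr.effect, h₂26]
      · simp only [List.length]; omega
    · simp only [Test.holds, h₂30, h₂27] at h1
      have hc1 : c + 1 = c / q * q + (c % q + 1) := by omega
      obtain ⟨d1, d2⟩ := pair_div_mod (i := c / q) (show c % q + 1 < q by omega)
      rw [← hc1] at d1 d2
      exact ⟨10 * (σ₀.wreg 7 - σ₂.wreg 31), ⟨by omega, rfl, by omega, by rw [h₂31, d1, h₂29],
        by rw [h₂31, d2, h₂30, add_assoc], fin σ₂ h₂31 h₂28 h₂x⟩, by omega⟩
  · rintro k t τ hf ⟨hle, rfl, g28, g29, g30, hdone, hrest⟩ hb hk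
    have e7 : τ.wreg 7 = σ₀.wreg 7 := hf.wreg 7 (by decide)
    simp only [Test.holds, e7] at hb
    have e31 : τ.wreg 31 = σ₀.wreg 7 := by omega
    rw [e31] at hdone hrest g28
    exact ⟨by omega, g28, hdone, hrest⟩

/-- Each arc owns a block of `p * q` cells that are zero beforehand, so only the matching cell, or
cell `0` for a loop, has to be written. The start of each block is recorded because the undoing
cannot multiply. -/
theorem runs_assignLoop {σ₀ : Memory} {n p q : ℕ} (hp : 0 < p) (hq : 0 < q)
    (h13 : σ₀.wreg 13 = 0) (h28 : σ₀.wreg 28 = 0) (h0 : σ₀.wreg 0 = n) (h7 : σ₀.wreg 7 = p * q)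
    (h26 : σ₀.wreg 26 = n + p) (h27 : σ₀.wreg 27 = n + p + q) (hx : ∀ i, σ₀.xarr 1 i = 0) :
    Runs assignLoop σ₀ fun k τ => k ≤ (10 * (p * q) + 13) * σ₀.wreg 4 + 1 ∧
      ∀ e < σ₀.wreg 4, τ.warr 4 e = e * (p * q) ∧ ∀ c < p * q, τ.xarr 1 (e * (p * q) + c) =
        if (σ₀.warr 0 e = σ₀.warr 1 e ∧ c = 0) ∨
          (σ₀.warr 0 e = n + c / q ∧ σ₀.warr 1 e = n + p + c % q) then σ₀.xarr 0 e else 0 := by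
  have hr : 0 < p * q := Nat.mul_pos hp hq
  set r := p * q with hrdef
  refine Runs.loop (fun t σ => σ.wreg 13 ≤ σ₀.wreg 4 ∧
    t = (10 * r + 13) * (σ₀.wreg 4 - σ.wreg 13) ∧ σ.wreg 28 = σ.wreg 13 * r ∧
    (∀ e < σ.wreg 13, σ.warr 4 e = e * r ∧ ∀ c < r, σ.xarr 1 (e * r + c) =
        if (σ₀.warr 0 e = σ₀.warr 1 e ∧ c = 0) ∨
          (σ₀.warr 0 e = n + c / q ∧ σ₀.warr 1 e = n + p + c % q) then σ₀.xarr 0 e else 0) ∧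
    ∀ i, σ.wreg 13 * r ≤ i → σ.xarr 1 i = 0) _
    ⟨by omega, rfl, by simp [h13, h28], by simp [h13], fun i _ => hx i⟩ ?_ ?_
  · rintro t σ hf ⟨hle, rfl, g28, hdone, hrest⟩ hb
    have e4 : σ.wreg 4 = σ₀.wreg 4 := hf.wreg 4 (by decide)
    have e7 : σ.wreg 7 = r := (hf.wreg 7 (by decide)).trans h7
    have e0 : σ.wreg 0 = n := (hf.wreg 0 (by decide)).trans h0
    have e26 : σ.wreg 26 = n + p := (hf.wreg 26 (by decide)).trans h26
    have e27 : σ.wreg 27 = n + p + q := (hf.wreg 27 (by decide)).trans h27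
    have ew0 : σ.warr 0 = σ₀.warr 0 := hf.warr 0 (by decide)
    have ew1 : σ.warr 1 = σ₀.warr 1 := hf.warr 1 (by decide)
    have ex0 : σ.xarr 0 = σ₀.xarr 0 := hf.xarr 0 (by decide)
    simp only [Test.holds, e4] at hb
    set e := σ.wreg 13 with he
    refine Runs.seq (R := fun k τ => k = 4 ∧ τ.wreg 11 = σ₀.warr 0 e ∧ τ.wreg 12 = σ₀.warr 1 e ∧
      τ.xreg 1 = σ₀.xarr 0 e ∧ τ.warr 4 = Function.update (σ.warr 4) e (e * r))
      (Runs.ops fun τ hτ => ?_) ?_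
    · simp [hτ, Instr.effect, ew0, ew1, ex0, ← he, g28]
    rintro k₁ σ₁ hf₁ ⟨rfl, h₁11, h₁12, h₁1, h₁w⟩
    have h₁28 : σ₁.wreg 28 = e * r := (hf₁.wreg 28 (by decide)).trans g28
    have h₁x : σ₁.xarr 1 = σ.xarr 1 := hf₁.xarr 1 (by decide)
    refine Runs.seq (R := fun k τ => k ≤ 2 ∧ ∀ i, τ.xarr 1 i =
      if σ₀.warr 0 e = σ₀.warr 1 e ∧ i = e * r then σ₀.xarr 0 e else σ.xarr 1 i) ?_ ?_
    · refine Runs.branch (fun h1 => Runs.ops fun τ hτ => ⟨le_rfl, ?_⟩)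
        fun h1 => Runs.skip ⟨by omega, ?_⟩
      · simp only [Test.holds, h₁11, h₁12] at h1
        intro i
        by_cases hi : i = e * r <;> simp [hτ, Instr.effect, h₁28, h₁1, h₁x, h1, hi]
      · simp only [Test.holds, h₁11, h₁12] at h1
        simp [h1, h₁x]
    rintro k₂ σ₂ hf₂ ⟨hk₂, h₂x⟩
    have h₂26 : σ₂.wreg 26 = n + p := (hf₂.wreg 26 (by decide)).trans <|
      (hf₁.wreg 26 (by decide)).trans e26
    have h₂0 : σ₂.wreg 0 = n := (hf₂.wreg 0 (by decide)).trans <|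
      (hf₁.wreg 0 (by decide)).trans e0
    refine Runs.seq (R := fun k τ => k = 3 ∧ τ.wreg 31 = 0 ∧ τ.wreg 29 = n ∧ τ.wreg 30 = n + p)
      (Runs.ops fun τ hτ => by simp [hτ, Instr.effect, h₂26, h₂0]) ?_
    rintro k₃ σ₃ hf₃ ⟨rfl, h₃31, h₃29, h₃30⟩
    have h₃26 : σ₃.wreg 26 = n + p := (hf₃.wreg 26 (by decide)).trans h₂26
    have h₃27 : σ₃.wreg 27 = n + p + q := (hf₃.wreg 27 (by decide)).trans <|
      (hf₂.wreg 27 (by decide)).trans <| (hf₁.wreg 27 (by decide)).trans e27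
    have h₃7 : σ₃.wreg 7 = r := (hf₃.wreg 7 (by decide)).trans <|
      (hf₂.wreg 7 (by decide)).trans <| (hf₁.wreg 7 (by decide)).trans e7
    have h₃28 : σ₃.wreg 28 = e * r := (hf₃.wreg 28 (by decide)).trans <|
      (hf₂.wreg 28 (by decide)).trans h₁28
    have h₃11 : σ₃.wreg 11 = σ₀.warr 0 e := (hf₃.wreg 11 (by decide)).trans <|
      (hf₂.wreg 11 (by decide)).trans h₁11
    have h₃12 : σ₃.wreg 12 = σ₀.warr 1 e := (hf₃.wreg 12 (by decide)).trans <|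
      (hf₂.wreg 12 (by decide)).trans h₁12
    have h₃1 : σ₃.xreg 1 = σ₀.xarr 0 e := (hf₃.xreg 1 (by decide)).trans <|
      (hf₂.xreg 1 (by decide)).trans h₁1
    have h₃x : ∀ i, σ₃.xarr 1 i = if σ₀.warr 0 e = σ₀.warr 1 e ∧ i = e * r then σ₀.xarr 0 e
        else σ.xarr 1 i := fun i => (congrFun (hf₃.xarr 1 (by decide)) i).trans (h₂x i)
    refine Runs.seq (runs_assignArc hq h₃31 h₃29 h₃30 h₃26 h₃27) ?_
    rw [h₃7, h₃28, h₃11, h₃12, h₃1]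
    rintro k₄ σ₄ hf₄ ⟨hk₄, h₄28, h₄x, h₄x'⟩
    have h₄13 : σ₄.wreg 13 = e := (hf₄.wreg 13 (by decide)).trans <|
      (hf₃.wreg 13 (by decide)).trans <| (hf₂.wreg 13 (by decide)).trans (hf₁.wreg 13 (by decide))
    have h₄w : σ₄.warr 4 = Function.update (σ.warr 4) e (e * r) :=
      (hf₄.warr 4 (by decide)).trans <| (hf₃.warr 4 (by decide)).trans <|
      (hf₂.warr 4 (by decide)).trans h₁w
    refine Runs.ops_frame fun τ hfτ hτ => ?_
    have t13 : τ.wreg 13 = e + 1 := by simp [hτ, Instr.effect, h₄13]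
    have tx : τ.xarr 1 = σ₄.xarr 1 := hfτ.xarr 1 (by decide)
    have tw : τ.warr 4 = σ₄.warr 4 := hfτ.warr 4 (by decide)
    refine ⟨(10 * r + 13) * (σ₀.wreg 4 - τ.wreg 13), ⟨by omega, rfl, ?_, ?_, ?_⟩, ?_⟩
    · rw [hfτ.wreg 28 (by decide), h₄28, t13, add_one_mul]
    · rw [t13, tx, tw, h₄w]
      intro e' he'
      rcases Nat.lt_succ_iff_lt_or_eq.1 he' with h1 | rfl
      · have h2 : e' * r + r ≤ e * r := by
          rw [← add_one_mul]; exact Nat.mul_le_mul_right _ h1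
        refine ⟨by rw [Function.update_of_ne h1.ne]; exact (hdone e' h1).1, fun c hc => ?_⟩
        rw [h₄x' _ (by omega), h₃x, if_neg (fun h => by omega), (hdone e' h1).2 c hc]
      · refine ⟨by rw [Function.update_self], fun c hc => ?_⟩
        rw [h₄x c hc, h₃x, hrest _ (by omega)]
        by_cases h1 : σ₀.warr 0 e = n + c / q ∧ σ₀.warr 1 e = n + p + c % q
        · rw [if_pos h1, if_pos (Or.inr h1)]
        · rw [if_neg h1]
          simp [h1]
    · intro i hi
      rw [t13, add_one_mul] at hi
      rw [tx, h₄x' i (by omega), h₃x, if_neg (fun h => by omega), hrest i (by omega)]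
    · obtain ⟨x, hx⟩ : ∃ x, σ₀.wreg 4 = e + 1 + x := Nat.exists_eq_add_of_le hb
      rw [t13, hx, show e + 1 + x - (e + 1) = x by omega, show e + 1 + x - e = x + 1 by omega,
        mul_add_one]
      simp only [List.length]
      omega
  · rintro k t τ hf ⟨hle, rfl, g28, hdone, hrest⟩ hb hk
    have e4 : τ.wreg 4 = σ₀.wreg 4 := hf.wreg 4 (by decide)
    simp only [Test.holds, e4] at hb
    rw [h13, Nat.sub_zero] at hk
    exact ⟨by omega, fun e he => hdone e (by omega)⟩

end FlowDecomp

namespace FlowDecomp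

/-! ### Undoing the eliminations -/

/-- Blocks of different arcs are disjoint. -/
theorem mul_add_inj {r e e' c c' : ℕ} (hc : c < r) (hc' : c' < r) :
    e * r + c = e' * r + c' ↔ e = e' ∧ c = c' := by
  refine ⟨fun h => ?_, fun ⟨h, h'⟩ => by rw [h, h']⟩
  obtain ⟨h1, h2⟩ := pair_div_mod (i := e) hc
  obtain ⟨h3, h4⟩ := pair_div_mod (i := e') hc'
  rw [h] at h1 h2
  exact ⟨h1.symm.trans h3, h2.symm.trans h4⟩

theorem runs_unspliceLoop {σ₀ : Memory} {a b d r : ℕ} (h31 : σ₀.wreg 31 = 0) (h7 : σ₀.wreg 7 = r)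
    (h28 : σ₀.wreg 28 = a * r) (h29 : σ₀.wreg 29 = b * r) (h30 : σ₀.wreg 30 = d * r)
    (hab : a ≠ b) (had : a ≠ d) (hbd : b ≠ d) :
    Runs unspliceLoop σ₀ fun k τ => k ≤ 12 * r + 1 ∧ ∀ e, ∀ c < r, τ.xarr 1 (e * r + c) =
      σ₀.xarr 1 (e * r + c) + (if e = a then σ₀.xarr 1 (d * r + c) else 0) +
        (if e = b then σ₀.xarr 1 (d * r + c) else 0) := by
  refine Runs.loop (fun t σ => σ.wreg 31 ≤ r ∧ t = 12 * (r - σ.wreg 31) ∧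
    σ.wreg 28 = a * r + σ.wreg 31 ∧ σ.wreg 29 = b * r + σ.wreg 31 ∧
    σ.wreg 30 = d * r + σ.wreg 31 ∧ ∀ e, ∀ c < r, σ.xarr 1 (e * r + c) =
      σ₀.xarr 1 (e * r + c) +
        (if e = a ∧ c < σ.wreg 31 then σ₀.xarr 1 (d * r + c) else 0) +
        (if e = b ∧ c < σ.wreg 31 then σ₀.xarr 1 (d * r + c) else 0)) _
    ⟨by omega, rfl, by omega, by omega, by omega, by simp [h31]⟩ ?_ ?_
  · rintro t σ hf ⟨hle, rfl, g28, g29, g30, hx⟩ hb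
    have e7 : σ.wreg 7 = r := (hf.wreg 7 (by decide)).trans h7
    simp only [Test.holds, e7] at hb
    set j := σ.wreg 31 with hj
    refine Runs.ops fun τ hτ => ?_
    have t28 : τ.wreg 28 = a * r + (j + 1) := by simp [hτ, Instr.effect, g28, add_assoc]
    have t29 : τ.wreg 29 = b * r + (j + 1) := by simp [hτ, Instr.effect, g29, add_assoc]
    have t30 : τ.wreg 30 = d * r + (j + 1) := by simp [hτ, Instr.effect, g30, add_assoc]
    have t31 : τ.wreg 31 = j + 1 := by simp [hτ, Instr.effect, ← hj]
    have hne : b * r + j ≠ a * r + j := fun h => hab ((mul_add_inj hb hb).1 h).1.symm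
    have tx : τ.xarr 1 = Function.update (Function.update (σ.xarr 1) (a * r + j)
        (σ.xarr 1 (a * r + j) + σ.xarr 1 (d * r + j))) (b * r + j)
        (σ.xarr 1 (b * r + j) + σ.xarr 1 (d * r + j)) := by
      simp [hτ, Instr.effect, g28, g29, g30, Function.update_of_ne hne]
    refine ⟨12 * (r - τ.wreg 31), ⟨by omega, rfl, by omega, by omega, by omega, ?_⟩, ?_⟩
    · intro e c hc
      rw [tx, t31]
      by_cases hcj : c = j
      · subst hcj
        by_cases heb : e = b
        · subst heb
          rw [Function.update_self, hx _ _ hc, hx _ _ hc]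
          simp [hab.symm, had.symm, hbd.symm]
        rw [Function.update_of_ne fun h => heb ((mul_add_inj hc hc).1 h).1]
        by_cases hea : e = a
        · subst hea
          rw [Function.update_self, hx _ _ hc, hx _ _ hc]
          simp [hab, had.symm, hbd.symm]
        rw [Function.update_of_ne fun h => hea ((mul_add_inj hc hc).1 h).1, hx _ _ hc]
        simp [hea, heb]
      · rw [Function.update_of_ne fun h => hcj ((mul_add_inj hc hb).1 h).2,
          Function.update_of_ne fun h => hcj ((mul_add_inj hc hb).1 h).2, hx _ _ hc]
        have : c < j + 1 ↔ c < j := by omega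
        simp only [this]
    · simp only [List.length]; omega
  · rintro k t τ hf ⟨hle, rfl, g28, g29, g30, hx⟩ hb hk
    have e7 : τ.wreg 7 = r := (hf.wreg 7 (by decide)).trans h7
    simp only [Test.holds, e7] at hb
    refine ⟨by omega, fun e c hc => ?_⟩
    have : c < τ.wreg 31 := by omega
    simp only [hx e c hc, this, and_true]

/-- Greedy division: number register 3 holds the amount still to be moved, and each commodity gives
as much of it as it can. At all times either this amount is zero or everything offered so far has
been taken, so by `hle` it is zero at the end. All amounts are minima, sums and differences of
elements of `A`. -/
theorem runs_unmergeLoop {σ₀ : Memory} {a b r : ℕ} (A : AddSubgroup ℝ) (h31 : σ₀.wreg 31 = 0)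
    (h7 : σ₀.wreg 7 = r) (h28 : σ₀.wreg 28 = a * r) (h29 : σ₀.wreg 29 = b * r) (hab : a ≠ b)
    (h0 : ∀ c < r, 0 ≤ σ₀.xarr 1 (b * r + c)) (hA : ∀ c < r, σ₀.xarr 1 (b * r + c) ∈ A)
    (h3 : 0 ≤ σ₀.xreg 3) (h3A : σ₀.xreg 3 ∈ A)
    (hle : σ₀.xreg 3 ≤ ∑ c ∈ Finset.range r, σ₀.xarr 1 (b * r + c)) :
    Runs unmergeLoop σ₀ fun k τ => k ≤ 12 * r + 1 ∧ ∃ Y : ℕ → ℝ, (∀ c < r, 0 ≤ Y c) ∧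
      (∀ c < r, Y c ∈ A) ∧ (∀ c < r, Y c ≤ σ₀.xarr 1 (b * r + c)) ∧
      ∑ c ∈ Finset.range r, Y c = σ₀.xreg 3 ∧ ∀ e, ∀ c < r, τ.xarr 1 (e * r + c) =
        if e = a then Y c else if e = b then σ₀.xarr 1 (e * r + c) - Y c
        else σ₀.xarr 1 (e * r + c) := by
  refine Runs.loop (fun t σ => σ.wreg 31 ≤ r ∧ t = 12 * (r - σ.wreg 31) ∧
    σ.wreg 28 = a * r + σ.wreg 31 ∧ σ.wreg 29 = b * r + σ.wreg 31 ∧ 0 ≤ σ.xreg 3 ∧ σ.xreg 3 ∈ A ∧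
    ∃ Y : ℕ → ℝ, (∀ c < σ.wreg 31, 0 ≤ Y c ∧ Y c ∈ A ∧ Y c ≤ σ₀.xarr 1 (b * r + c)) ∧
      ∑ c ∈ Finset.range (σ.wreg 31), Y c + σ.xreg 3 = σ₀.xreg 3 ∧
      (σ.xreg 3 = 0 ∨ ∀ c < σ.wreg 31, Y c = σ₀.xarr 1 (b * r + c)) ∧
      ∀ e, ∀ c < r, σ.xarr 1 (e * r + c) =
        if e = a ∧ c < σ.wreg 31 then Y c
        else if e = b ∧ c < σ.wreg 31 then σ₀.xarr 1 (e * r + c) - Y c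
        else σ₀.xarr 1 (e * r + c)) _
    ⟨by omega, rfl, by omega, by omega, h3, h3A, fun _ => 0, by simp [h31], by simp [h31],
      by simp [h31], by simp [h31]⟩ ?_ ?_
  · rintro t σ hf ⟨hj, rfl, g28, g29, g3, g3A, Y, hY, hsum, hgreedy, hx⟩ hb
    have e7 : σ.wreg 7 = r := (hf.wreg 7 (by decide)).trans h7
    simp only [Test.holds, e7] at hb
    set j := σ.wreg 31 with hjdef
    set y := σ₀.xarr 1 (b * r + j) with hydef
    have hxb : σ.xarr 1 (b * r + j) = y := by rw [hx _ _ hb]; simp [hydef]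
    have hy0 := h0 j hb
    have hyA := hA j hb
    refine Runs.seq (R := fun k τ => k = 1 ∧ τ.xreg 2 = y)
      (Runs.ops fun τ hτ => ⟨rfl, by simp [hτ, Instr.effect, g29, hxb]⟩) ?_
    rintro k₁ σ₁ hf₁ ⟨rfl, h₁2⟩
    have h₁3 : σ₁.xreg 3 = σ.xreg 3 := hf₁.xreg 3 (by decide)
    refine Runs.seq (R := fun k τ => k = 2 ∧ τ.xreg 1 = min y (σ.xreg 3) ∧ τ.xreg 2 = y ∧
      τ.xreg 3 = σ.xreg 3) (Runs.branch (fun h1 => Runs.ops fun τ hτ => ?_)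
      fun h1 => Runs.ops fun τ hτ => ?_) ?_
    · simp only [Test.holds, h₁2, h₁3] at h1
      simp [hτ, Instr.effect, h₁2, h₁3, h1]
    · simp only [Test.holds, h₁2, h₁3, not_le] at h1
      simp [hτ, Instr.effect, h₁2, h₁3, h1.le]
    rintro k₂ σ₂ hf₂ ⟨rfl, h₂1, h₂2, h₂3⟩
    have h₂28 : σ₂.wreg 28 = a * r + j := (hf₂.wreg 28 (by decide)).trans <|
      (hf₁.wreg 28 (by decide)).trans g28
    have h₂29 : σ₂.wreg 29 = b * r + j := (hf₂.wreg 29 (by decide)).trans <|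
      (hf₁.wreg 29 (by decide)).trans g29
    have h₂31 : σ₂.wreg 31 = j := (hf₂.wreg 31 (by decide)).trans (hf₁.wreg 31 (by decide))
    have h₂x : σ₂.xarr 1 = σ.xarr 1 := (hf₂.xarr 1 (by decide)).trans (hf₁.xarr 1 (by decide))
    refine Runs.ops fun τ hτ => ?_
    set z := min y (σ.xreg 3) with hz
    have hzy : z ≤ y := min_le_left _ _
    have hz3 : z ≤ σ.xreg 3 := min_le_right _ _
    have hz0 : 0 ≤ z := le_min hy0 g3
    have hzA : z ∈ A := by
      rcases min_choice y (σ.xreg 3) with h | h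
      · rw [hz, h]; exact hyA
      · rw [hz, h]; exact g3A
    have t28 : τ.wreg 28 = a * r + (j + 1) := by simp [hτ, Instr.effect, h₂28, add_assoc]
    have t29 : τ.wreg 29 = b * r + (j + 1) := by simp [hτ, Instr.effect, h₂29, add_assoc]
    have t31 : τ.wreg 31 = j + 1 := by simp [hτ, Instr.effect, h₂31]
    have t3 : τ.xreg 3 = σ.xreg 3 - z := by simp [hτ, Instr.effect, h₂3, h₂1]
    have tx : τ.xarr 1 = Function.update (Function.update (σ.xarr 1) (b * r + j) (y - z))
        (a * r + j) z := by
      simp [hτ, Instr.effect, h₂28, h₂29, h₂1, h₂2, h₂x]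
    refine ⟨12 * (r - τ.wreg 31), ⟨by omega, rfl, by omega, by omega, by rw [t3]; linarith,
      by rw [t3]; exact A.sub_mem g3A hzA, Function.update Y j z, ?_, ?_, ?_, ?_⟩, ?_⟩
    · rw [t31]
      intro c hc
      rcases Nat.lt_succ_iff_lt_or_eq.1 hc with h1 | rfl
      · rw [Function.update_of_ne h1.ne]; exact hY c h1
      · rw [Function.update_self]; exact ⟨hz0, hzA, hzy⟩
    · rw [t31, Finset.sum_range_succ, Function.update_self, t3, ← hsum]
      have : ∑ c ∈ Finset.range j, Function.update Y j z c = ∑ c ∈ Finset.range j, Y c :=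
        Finset.sum_congr rfl fun c hc =>
          Function.update_of_ne (Finset.mem_range.1 hc).ne _ _
      rw [this]; ring
    · rw [t31, t3]
      rcases le_total y (σ.xreg 3) with h1 | h1
      · have hzy' : z = y := min_eq_left h1
        rcases hgreedy with h2 | h2
        · left; linarith
        · right
          intro c hc
          rcases Nat.lt_succ_iff_lt_or_eq.1 hc with h1 | rfl
          · rw [Function.update_of_ne h1.ne]; exact h2 c h1
          · rw [Function.update_self, hzy']
      · left
        rw [hz, min_eq_right h1, sub_self]
    · intro e c hc
      rw [tx, t31]
      by_cases hcj : c = j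
      · subst hcj
        by_cases hea : e = a
        · subst hea; simp
        rw [Function.update_of_ne fun h => hea ((mul_add_inj hc hc).1 h).1]
        by_cases heb : e = b
        · subst heb; simp [hea, hydef]
        rw [Function.update_of_ne fun h => heb ((mul_add_inj hc hc).1 h).1, hx _ _ hc]
        simp [hea, heb]
      · rw [Function.update_of_ne fun h => hcj ((mul_add_inj hc hb).1 h).2,
          Function.update_of_ne fun h => hcj ((mul_add_inj hc hb).1 h).2, hx _ _ hc,
          Function.update_of_ne hcj]
        have : c < j + 1 ↔ c < j := by omega
        simp only [this]
    · simp only [List.length]; omega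
  · rintro k t τ hf ⟨hj, rfl, g28, g29, g3, g3A, Y, hY, hsum, hgreedy, hx⟩ hb hk
    have e7 : τ.wreg 7 = r := (hf.wreg 7 (by decide)).trans h7
    simp only [Test.holds, e7] at hb
    obtain hr : τ.wreg 31 = r := by omega
    rw [hr] at hY hsum hgreedy hx
    refine ⟨by omega, Y, fun c hc => (hY c hc).1, fun c hc => (hY c hc).2.1,
      fun c hc => (hY c hc).2.2, ?_, fun e c hc => ?_⟩
    · rcases hgreedy with h | h
      · linarith
      · have := Finset.sum_congr rfl fun c hc => h c (Finset.mem_range.1 hc)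
        linarith
    · simp only [hx e c hc, hc, and_true]

/-- The derivation is read backwards while register 4 counts down: its last constructor says which
operation created the last arc, and the stored kind agrees with it. -/
theorem runs_undoLoop {σ₀ : Memory} {n p q N₀ : ℕ} {A : AddSubgroup ℝ} {F₀ F : ℕ → ℝ}
    (h8 : σ₀.wreg 8 = N₀) (h7 : σ₀.wreg 7 = p * q) (h9 : σ₀.wreg 9 = 0)
    (h4 : ∀ e < σ₀.wreg 4, σ₀.warr 4 e = e * (p * q))
    (hF : Derives n p q N₀ A σ₀.history F₀ (σ₀.wreg 4) F)
    (hX : Decomposes n p q A σ₀.history (σ₀.wreg 4) F fun e c => σ₀.xarr 1 (e * (p * q) + c)) :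
    Runs undoLoop σ₀ fun k τ => k ≤ (12 * (p * q) + 13) * σ₀.wreg 4 + 1 ∧
      Decomposes n p q A σ₀.history N₀ F₀ fun e c => τ.xarr 1 (e * (p * q) + c) := by
  set r := p * q with hr
  refine Runs.loop (fun t σ => σ.wreg 4 ≤ σ₀.wreg 4 ∧ t = (12 * r + 13) * σ.wreg 4 ∧ ∃ F,
    Derives n p q N₀ A σ₀.history F₀ (σ.wreg 4) F ∧
    Decomposes n p q A σ₀.history (σ.wreg 4) F fun e c => σ.xarr 1 (e * r + c)) _
    ⟨le_rfl, rfl, F, hF, hX⟩ ?_ ?_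
  · rintro t σ hf ⟨hle, rfl, F, hF, hX⟩ hb
    have e7 : σ.wreg 7 = r := (hf.wreg 7 (by decide)).trans h7
    have e8 : σ.wreg 8 = N₀ := (hf.wreg 8 (by decide)).trans h8
    have e9 : σ.wreg 9 = 0 := (hf.wreg 9 (by decide)).trans h9
    have ew : ∀ i, σ.warr i = σ₀.warr i := fun i => hf.warr i (by
      simp [unmergeLoop, unspliceLoop, block, ops, Program.instrs, Instr.warrs])
    have ex2 : σ.xarr 2 = σ₀.xarr 2 := hf.xarr 2 (by decide)
    simp only [Test.holds, e8] at hb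
    obtain ⟨N, hN⟩ : ∃ N, σ.wreg 4 = N + 1 := Nat.exists_eq_succ_of_ne_zero (by omega)
    rw [hN] at hb hle hF hX ⊢
    refine Runs.seq (R := fun k τ => k = 9 ∧ τ.wreg 4 = N ∧
      τ.wreg 28 = σ₀.warr 4 (σ₀.history.pa N) ∧ τ.wreg 29 = σ₀.warr 4 (σ₀.history.pb N) ∧
      τ.wreg 30 = σ₀.warr 4 N ∧ τ.wreg 17 = σ₀.history.kd N ∧ τ.wreg 31 = 0 ∧
      τ.xreg 3 = σ₀.history.dl N) (Runs.ops fun τ hτ => by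
        simp [hτ, Instr.effect, hN, ew, ex2, Memory.history]) ?_
    rintro k₁ σ₁ hf₁ ⟨rfl, h₁4, h₁28, h₁29, h₁30, h₁17, h₁31, h₁3⟩
    have h₁7 : σ₁.wreg 7 = r := (hf₁.wreg 7 (by decide)).trans e7
    have h₁9 : σ₁.wreg 9 = 0 := (hf₁.wreg 9 (by decide)).trans e9
    have h₁x : σ₁.xarr 1 = σ.xarr 1 := hf₁.xarr 1 (by decide)
    rw [h4 N (by omega)] at h₁30
    have hcost : (12 * r + 13) * (N + 1) = (12 * r + 13) * N + (12 * r + 13) := mul_add_one _ _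
    cases hF with
    | base _ => omega
    | @pair _ F' _ δ hD ha hb hab hk ht hh hm _ hF' =>
      rw [h4 _ (by omega)] at h₁28 h₁29
      refine Runs.branch (fun h1 => ?_) fun _ => ?_
      · simp only [Test.holds, h₁17, h₁9, hk] at h1
        omega
      refine (runs_unspliceLoop h₁31 h₁7 h₁28 h₁29 h₁30 hab ha.ne hb.ne).mono ?_
      rintro k τ hfτ ⟨hk', hx⟩
      have t4 : τ.wreg 4 = N := (hfτ.wreg 4 (by decide)).trans h₁4
      rw [h₁x] at hx
      refine ⟨_, ⟨by omega, rfl, F', by rwa [t4], ?_⟩, by rw [t4]; omega⟩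
      rw [t4]
      exact hX.unsplice ha hb hab ht hh hm hF' fun e _ c hc => hx e c hc
    | @merge _ F' _ hD ha hb hab hk ht hh hm hm' hdl hF' =>
      rw [h4 _ (by omega)] at h₁28 h₁29
      refine Runs.branch (fun _ => ?_) fun h1 => ?_
      swap
      · exact absurd (h₁17.trans (hk.trans h₁9.symm)) h1
      have hs := hD.sane
      have hsum := hX.sum _ (hb.trans (Nat.lt_succ_self N))
      have hFb : F (σ₀.history.pb N) = F' (σ₀.history.pb N) + F' (σ₀.history.pa N) := by
        simp [hF', hb.ne, hab.symm]
      refine (runs_unmergeLoop A h₁31 h₁7 h₁28 h₁29 hab (fun c hc => ?_) (fun c hc => ?_)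
        ?_ ?_ ?_).mono ?_
      · rw [h₁x]; exact hX.nonneg _ (hb.trans (Nat.lt_succ_self N)) c hc
      · rw [h₁x]; exact hX.mem _ (hb.trans (Nat.lt_succ_self N)) c hc
      · rw [h₁3, hdl]; exact hs.nonneg _ ha
      · rw [h₁3, hdl]; exact hs.mem _ ha
      -- The merged arc carried the sum of two nonnegative values, so it offers enough.
      · rw [h₁3, hdl, h₁x, hsum, hFb]
        linarith [hs.nonneg _ hb]
      rintro k τ hfτ ⟨hk', Y, hY0, hYA, hYle, hYs, hx⟩
      have t4 : τ.wreg 4 = N := (hfτ.wreg 4 (by decide)).trans h₁4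
      rw [h₁x] at hx hYle
      rw [h₁3, hdl] at hYs
      refine ⟨_, ⟨by omega, rfl, F', by rwa [t4], ?_⟩, by rw [t4]; omega⟩
      rw [t4]
      exact hX.unmerge ha hb hab ht hh hm hm' hF' hY0 hYA hYle hYs fun e _ c hc => hx e c hc
  · rintro k t τ hf ⟨hle, rfl, F, hF, hX⟩ hb hk
    have e8 : τ.wreg 8 = N₀ := (hf.wreg 8 (by decide)).trans h8
    simp only [Test.holds, e8] at hb
    refine ⟨by omega, ?_⟩
    -- A derivation never has fewer than `N₀` arcs, and one with exactly `N₀` arcs is `base`, whose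
    -- values are the initial ones.
    have hN : τ.wreg 4 = N₀ := le_antisymm (by omega) hF.sane.le
    rw [hN] at hX
    generalize τ.wreg 4 = N at hF hN
    cases hF with
    | base _ => exact hX
    | pair _ _ hD => have := hD.sane.le; omega
    | merge _ hD => have := hD.sane.le; omega

end FlowDecomp

namespace FlowDecomp

/-! ### The algorithm -/

section

variable {n m p q : ℕ} {G : Digraph n m} {s : Fin p → Fin n} {t : Fin q → Fin n} {f : Fin m → ℝ}

/-- Here `l` counts the steps of the eliminations. At most `m + p + q + l` arcs exist in the end,
and both the assignment and the undoing cost `O(p * q)` for each of them. -/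
theorem runs_decompose (A : AddSubgroup ℝ) (hp : 0 < p) (hq : 0 < q) (hs : Function.Injective s)
    (ht : Function.Injective t) (hst : Disjoint (Set.range s) (Set.range t))
    (hf : G.IsFlow (Set.range s) (Set.range t) f) (hA : ∀ e, f e ∈ A) :
    Runs decompose (inputMemory G s t f) fun k τ =>
      (∃ l : ℕ, k ≤ 50 * (m + n + p * q + p + q + 1) + 4 + l +
          (22 * (p * q) + 26) * (m + p + q + l) ∧
        (l : ℝ) ≤ potential (p + q) (m + p + q) n (2 * (m + p + q)) + 2) ∧
      ∃ (H : History) (F : ℕ → ℝ), H.Extends G s t ∧ (∀ e : Fin m, F e = f e) ∧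
        Decomposes n p q A H (m + p + q) F fun e c => τ.xarr 1 (e * (p * q) + c) := by
  refine Runs.seq (runs_setup G s t f A hp hs ht hst hf hA) ?_
  rintro k₁ σ₁ - ⟨hk₁, h₁0, h₁26, h₁27, h₁7, h₁8, h₁x, hext, hF, h₁4, O, I, hR, hsum⟩
  refine Runs.seq (runs_eliminations (by omega) hR) ?_
  rintro k₂ σ₂ hf₂ ⟨⟨O', I', hR'⟩, h₂4, hkeep, hk₂⟩
  rw [h₁4] at h₂4 hkeep
  have hframe : ∀ a ∈ [0, 7, 8, 26, 27], σ₂.wreg a = σ₁.wreg a := fun a ha => by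
    fin_cases ha <;> exact hf₂.wreg _ (by decide)
  refine Runs.seq (R := fun k τ => k = 2 ∧ τ.wreg 13 = 0 ∧ τ.wreg 28 = 0)
    (Runs.ops fun τ hτ => by simp [hτ, Instr.effect]) ?_
  rintro k₃ σ₃ hf₃ ⟨rfl, h₃13, h₃28⟩
  have h₃w : ∀ i, σ₃.warr i = σ₂.warr i := fun i =>
    hf₃.warr i (by simp [ops, Program.instrs, Instr.warrs])
  have h₃x : ∀ i, σ₃.xarr i = σ₂.xarr i := fun i =>
    hf₃.xarr i (by simp [ops, Program.instrs, Instr.xarrs])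
  have h₃4 : σ₃.wreg 4 = σ₂.wreg 4 := hf₃.wreg 4 (by decide)
  have h₃7 : σ₃.wreg 7 = p * q := (hf₃.wreg 7 (by decide)).trans <|
    (hframe 7 (by simp)).trans h₁7
  refine Runs.seq (runs_assignLoop (n := n) hp hq h₃13 h₃28
    ((hf₃.wreg 0 (by decide)).trans <| (hframe 0 (by simp)).trans h₁0) h₃7
    ((hf₃.wreg 26 (by decide)).trans <| (hframe 26 (by simp)).trans h₁26)
    ((hf₃.wreg 27 (by decide)).trans <| (hframe 27 (by simp)).trans h₁27) (fun i => by
      rw [h₃x, hf₂.xarr 1 (by decide), h₁x])) ?_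
  rw [h₃4, h₃w, h₃w, h₃x]
  rintro k₄ σ₄ hf₄ ⟨hk₄, h₄⟩
  have h₄4 : σ₄.wreg 4 = σ₂.wreg 4 := (hf₄.wreg 4 (by decide)).trans h₃4
  have h₄hist : σ₄.history = σ₂.history := by
    have hw : ∀ i, i ≠ 4 → σ₄.warr i = σ₂.warr i := fun i hi => (hf₄.warr i (by
      simp [assignLoop, assignArc, block, ops, Program.instrs, Instr.warrs, hi])).trans (h₃w i)
    have hx : σ₄.xarr 2 = σ₂.xarr 2 := (hf₄.xarr 2 (by decide)).trans (h₃x 2)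
    simp [Memory.history, hw, hx]
  refine (runs_undoLoop (n := n) (A := A) (F₀ := σ₁.xarr 0) (F := σ₂.xarr 0)
    ((hf₄.wreg 8 (by decide)).trans <| (hf₃.wreg 8 (by decide)).trans <|
      (hframe 8 (by simp)).trans h₁8)
    ((hf₄.wreg 7 (by decide)).trans h₃7)
    ((hf₄.wreg 9 (by decide)).trans <| (hf₃.wreg 9 (by decide)).trans hR'.wzero)
    (fun e he => (h₄ e (h₄4 ▸ he)).1) (by rw [h₄hist, h₄4]; exact hR'.derives) ?_).mono ?_
  · rw [h₄hist, h₄4]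
    refine hR'.derives.sane.decomposes hp hq (fun e he hFe hl => ?_) fun e he c hc =>
      (h₄ e he).2 c hc
    obtain ⟨c1, c2, -⟩ := hR'.covers e he hFe hl
    -- With no inner node left, coverage says that nonzero arcs other than loops join terminals.
    simp only [present, terminals, List.append_nil, List.mem_toFinset, List.mem_range'_1] at c1 c2
    exact ⟨c1.1, c2.1⟩
  · rintro k₅ τ - ⟨hk₅, hX⟩
    rw [h₄4] at hk₅
    refine ⟨⟨k₂, ?_, ?_⟩, σ₂.history, σ₁.xarr 0, ?_, hF, h₄hist ▸ hX⟩
    · have h1 : (12 * (p * q) + 13) * σ₂.wreg 4 + (10 * (p * q) + 13) * σ₂.wreg 4 =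
          (22 * (p * q) + 26) * σ₂.wreg 4 := by ring
      have h2 : (22 * (p * q) + 26) * σ₂.wreg 4 ≤ (22 * (p * q) + 26) * (m + p + q + k₂) :=
        Nat.mul_le_mul_left _ h₂4
      omega
    · refine hk₂.trans ?_
      have : ((∑ v ∈ present n p q (List.range n), σ₁.warr 9 v : ℕ) : ℝ) ≤
          (2 * (m + p + q) : ℕ) := by exact_mod_cast hsum
      rw [List.length_range]
      unfold potential
      linarith
    · refine ⟨fun e => ?_, fun e => ?_, fun i => ?_, fun i => ?_, fun j => ?_, fun j => ?_⟩
      · exact (hkeep e (by omega)).1.trans (hext.tl e)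
      · exact (hkeep e (by omega)).2.trans (hext.hd e)
      · exact (hkeep (m + i) (by omega)).1.trans (hext.tl_source i)
      · exact (hkeep (m + i) (by omega)).2.trans (hext.hd_source i)
      · exact (hkeep (m + p + j) (by omega)).1.trans (hext.tl_sink j)
      · exact (hkeep (m + p + j) (by omega)).2.trans (hext.hd_sink j)

/-- With `y = m * log (2 + n ^ 2 / m)` every term is at most a constant times `y`: the logarithm is
at least `1 / 2`, so `m ≤ 2 * y`; moreover `1 ≤ m`, `n ≤ c * m` and `m + p + q ≤ (k + 1) * m`.
Replacing `m` by the larger `m + p + q` in the denominator only decreases the logarithm. -/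
theorem steps_le {k l T : ℕ} {c : ℝ} (hn : 0 < n) (hnm : (n : ℝ) ≤ c * m) (hpq : p + q = k)
    (hT : T ≤ 50 * (m + n + p * q + p + q + 1) + 4 + l + (22 * (p * q) + 26) * (m + p + q + l))
    (hl : (l : ℝ) ≤ potential (p + q) (m + p + q) n (2 * (m + p + q)) + 2) :
    (T : ℝ) ≤ (100 * (c + (k + 1) ^ 2 + 1) + 8 + (22 * k ^ 2 + 27) *
      (882 * (k + 1) + 15840 * (k + 1) ^ 3 + 12 * (220 * k + 1981) * c + 4)) *
      (m * Real.log (2 + (n : ℝ) ^ 2 / m)) := by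
  have hn' : (0 : ℝ) < n := by exact_mod_cast hn
  -- There is a node, and `n ≤ c * m` then excludes `m = 0` and, below, a negative `c`.
  have hm : (1 : ℝ) ≤ m := by
    have : m ≠ 0 := by rintro rfl; simp at hnm; omega
    exact_mod_cast Nat.one_le_iff_ne_zero.2 this
  have hc : 0 ≤ c := by
    by_contra h
    nlinarith
  have hk0 : (0 : ℝ) ≤ k := Nat.cast_nonneg k
  have hpqk : (p : ℝ) + q = k := by exact_mod_cast hpq
  set y := (m : ℝ) * Real.log (2 + (n : ℝ) ^ 2 / m) with hy
  have hlog : 1 / 2 ≤ Real.log (2 + (n : ℝ) ^ 2 / m) := by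
    have h1 := Real.log_two_gt_d9
    have h2 : Real.log 2 ≤ Real.log (2 + (n : ℝ) ^ 2 / m) :=
      Real.log_le_log (by norm_num) (le_add_of_nonneg_right (by positivity))
    linarith
  have hmy : (m : ℝ) ≤ 2 * y := by
    rw [hy]
    nlinarith
  have hy0 : 0 < y := by linarith
  have h1y : 1 ≤ 2 * y := hm.trans hmy
  have hNk : (m : ℝ) + p + q ≤ (k + 1) * m := by nlinarith
  have hny : (n : ℝ) ≤ c * (2 * y) := hnm.trans (mul_le_mul_of_nonneg_left hmy hc)
  have hr : (p : ℝ) * q ≤ k ^ 2 := by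
    rw [← hpqk]
    nlinarith [Nat.cast_nonneg (α := ℝ) p, Nat.cast_nonneg (α := ℝ) q]
  have hNy : (m : ℝ) + p + q ≤ 2 * (k + 1) * y := by
    refine hNk.trans ?_
    have := mul_le_mul_of_nonneg_left hmy (show (0 : ℝ) ≤ k + 1 by positivity)
    linarith
  have hNlog : ((m : ℝ) + p + q) * Real.log (1 + (n : ℝ) ^ 2 / (m + p + q)) ≤ (k + 1) * y := by
    have h1 : Real.log (1 + (n : ℝ) ^ 2 / (m + p + q)) ≤ Real.log (2 + (n : ℝ) ^ 2 / m) := by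
      refine Real.log_le_log (by positivity) (add_le_add one_le_two ?_)
      refine div_le_div_of_nonneg_left (by positivity) (by linarith) ?_
      linarith [Nat.cast_nonneg (α := ℝ) p, Nat.cast_nonneg (α := ℝ) q]
    rw [hy, ← mul_assoc]
    exact mul_le_mul hNk h1 (Real.log_nonneg (le_add_of_nonneg_right (by positivity)))
      (by positivity)
  have hly : (l : ℝ) ≤
      (880 * (k + 1) + 15840 * (k + 1) ^ 3 + 12 * (220 * k + 1981) * c + 4) * y := by
    unfold potential at hl
    push_cast at hl
    rw [hpqk] at hl
    have h1 := mul_le_mul_of_nonneg_left hNlog (show (0 : ℝ) ≤ 15840 * (k + 1) ^ 2 by positivity)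
    have h2 := mul_le_mul_of_nonneg_left hny (show (0 : ℝ) ≤ 6 * (220 * k + 1981) by positivity)
    have h3 : 15840 * ((k : ℝ) + 1) ^ 2 * ((k + 1) * y) = 15840 * (k + 1) ^ 3 * y := by ring
    rw [h3] at h1
    linarith
  have hNl : (m : ℝ) + p + q + l ≤
      (882 * (k + 1) + 15840 * (k + 1) ^ 3 + 12 * (220 * k + 1981) * c + 4) * y := by linarith
  have hT' : (T : ℝ) ≤ 50 * (m + n + p * q + p + q + 1) + 4 + l +
      (22 * (p * q) + 26) * (m + p + q + l) := by exact_mod_cast hT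
  have hfix : (p : ℝ) * q + (p + q) + 1 ≤ ((k + 1) ^ 2) * (2 * y) := by
    have : (p : ℝ) * q + (p + q) + 1 ≤ (k + 1) ^ 2 := by rw [hpqk]; nlinarith
    refine this.trans (le_mul_of_one_le_right (by positivity) h1y)
  have hl' : (l : ℝ) ≤ m + p + q + l := by
    linarith [Nat.cast_nonneg (α := ℝ) p, Nat.cast_nonneg (α := ℝ) q]
  have hmul : (22 * ((p : ℝ) * q) + 27) * (m + p + q + l) ≤ (22 * k ^ 2 + 27) *
      ((882 * (k + 1) + 15840 * (k + 1) ^ 3 + 12 * (220 * k + 1981) * c + 4) * y) :=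
    mul_le_mul (by linarith) hNl (by positivity) (by positivity)
  linarith

end

end FlowDecomp

theorem theorem4 (k : ℕ) :
    ∃ P : FlowDecomp.Program, ∀ c : ℝ, ∃ C : ℝ,
      ∀ (n m p q : ℕ) (G : FlowDecomp.Digraph n m)
        (s : Fin p → Fin n) (t : Fin q → Fin n) (f : Fin m → ℝ),
        (n : ℝ) ≤ c * (m : ℝ) → 0 < p → 0 < q → p + q = k →
        Function.Injective s → Function.Injective t →
        Disjoint (Set.range s) (Set.range t) →
        G.IsFlow (Set.range s) (Set.range t) f →
        ∃ (steps : ℕ) (τ : FlowDecomp.Memory),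
          FlowDecomp.Exec P (FlowDecomp.inputMemory G s t f) steps τ ∧
          (steps : ℝ) ≤ C * ((m : ℝ) * Real.log (2 + (n : ℝ) ^ 2 / (m : ℝ))) ∧
          (∀ i j, G.IsFlow {s i} {t j} (FlowDecomp.outputFlow τ i j)) ∧
          (∀ e, f e = ∑ i : Fin p, ∑ j : Fin q, FlowDecomp.outputFlow τ i j e) ∧
          (FlowDecomp.IsIntegral f →
            ∀ (i : Fin p) (j : Fin q),
              FlowDecomp.IsIntegral (fun e : Fin m => FlowDecomp.outputFlow τ i j e)) := by
  -- One program serves all `k`; only the constant depends on `k` and `c`.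
  refine ⟨FlowDecomp.decompose, fun c => ⟨100 * (c + (k + 1) ^ 2 + 1) + 8 + (22 * k ^ 2 + 27) *
      (882 * (k + 1) + 15840 * (k + 1) ^ 3 + 12 * (220 * k + 1981) * c + 4), ?_⟩⟩
  intro n m p q G s t f hnm hp hq hpq hs ht hst hf
  -- The outputs lie in the group generated by the values of `f`, so one run covers both versions:
  -- if `f` is integral, this group consists of integers.
  let A : AddSubgroup ℝ := AddSubgroup.closure (Set.range f)
  obtain ⟨T, τ, hrun, ⟨l, hT, hl⟩, H, F, hext, hF, hX⟩ :=
    FlowDecomp.runs_decompose A hp hq hs ht hst hf fun e => AddSubgroup.subset_closure ⟨e, rfl⟩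
  have hout : ∀ (i : Fin p) (j : Fin q) (e : Fin m), FlowDecomp.outputFlow τ i j e =
      τ.xarr 1 ((e : ℕ) * (p * q) + ((i : ℕ) * q + j)) := fun i j e =>
    congrArg (τ.xarr 1) (by ring)
  refine ⟨T, τ, hrun, FlowDecomp.steps_le (s ⟨0, hp⟩).pos hnm hpq hT hl, fun i j => ?_, fun e => ?_,
    fun hint i j e => ?_⟩
  · exact funext (hout i j) ▸ hext.isFlow hX hst i j
  · simp only [hout]
    rw [← hF, ← hX.sum e (by omega)]
    exact FlowDecomp.sum_pairs p q fun c => τ.xarr 1 ((e : ℕ) * (p * q) + c)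
  · have hA : A ≤ (Int.castAddHom ℝ).range := by
      rw [AddSubgroup.closure_le]
      rintro _ ⟨e, rfl⟩
      obtain ⟨z, hz⟩ := hint e
      exact ⟨z, hz.symm⟩
    obtain ⟨z, hz⟩ := hA (hX.mem e (by omega) _ (FlowDecomp.pair_lt i.2 j.2))
    exact ⟨z, (hout i j e).trans hz.symm⟩
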